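/- Notation: \(dd^c=i\partial\bar\partial\); a Kähler form is written \(\omega=i\sum g_{i\bar j}\,dz^i\wedge d\bar z^j\), and \(\Delta_\omega\psi=\operatorname{tr}_\omega dd^c\psi=g^{i\bar j}\psi_{i\bar j}\), \(|\theta|_\omega^2=g^{k\bar l}g^{p\bar q}\theta_{p\bar l}\theta_{k\bar q}\) for a real \((1,1)\)-form \(\theta\), \(R_{i\bar jk\bar l}=-\partial_k\partial_{\bar l}g_{i\bar j}+g^{p\bar q}\,\partial_kg_{i\bar q}\,\partial_{\bar l}g_{p\bar j}\). Theorem 5.1. Let \(n\in\mathbb N\) and \(A,\kappa,B,D\in\mathbb R\). There is a constant \(C\), depending only on \(n,A,\kappa,B,D\), with the following property. Let \(M\) be a compact complex manifold of dimension \(n\) with a smooth Kähler form \(\omega_0\), let \((L,h)\) be a holomorphic line bundle on \(M\) with a smooth Hermitian metric, \(s\) a holomorphic section of \(L\), \(0<\tau<\tau'<1\) and \(\epsilon>0\), and suppose that \[\tilde\omega_\epsilon=\omega_0+dd^c\big((|s|_h^2+\epsilon)^{\tau}-(|s|_h^2+\epsilon)^{\tau'}\big)\] is positive definite. Let \(f_\epsilon\)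 be a smooth real function on \(M\) and let \(\phi\) be a real \(C^3\) solution of \[(\tilde\omega_\epsilon+dd^c\phi)^n=e^{f_\epsilon}\,\tilde\omega_\epsilon^n .\] Suppose that \(\|\phi\|_{L^\infty}\le A\), that the curvature tensor \(R^\epsilon\) of \(\tilde\omega_\epsilon\) satisfies \(R^\epsilon(v,\bar v,w,\bar w)\ge\kappa\) for all \(\tilde\omega_\epsilon\)-unit \((1,0)\)-vectors \(v,w\) at a common point, that \(f_\epsilon\ge B\), and that \((\Delta_{\tilde\omega_\epsilon}f_\epsilon)^-:=\min\{\Delta_{\tilde\omega_\epsilon}f_\epsilon,0\}\ge D\) on \(M\). Then \[|dd^c\phi|_{\tilde\omega_\epsilon}\le C\quad\text{at every point of }M .\] -/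

import Mathlib

open scoped Manifold ContDiff ComplexConjugate ComplexOrder

noncomputable section

namespace ComplexMA

/-- The model space `ℂⁿ`. -/
abbrev Cn (n : ℕ) : Type := EuclideanSpace ℂ (Fin n)

/-- The `j`-th standard basis vector of `ℂⁿ`. -/
def stdVec {n : ℕ} (j : Fin n) : Cn n := EuclideanSpace.single j 1

/-- The Wirtinger derivative `∂F/∂z^j` of a (real-differentiable) function on `ℂⁿ`. -/
def dz {n : ℕ} (j : Fin n) (F : Cn n → ℂ) (z : Cn n) : ℂ :=
  (fderiv ℝ F z (stdVec j) - Complex.I * fderiv ℝ F z (Complex.I • stdVec j)) / 2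

/-- The Wirtinger derivative `∂F/∂z̄^j`. -/
def dzbar {n : ℕ} (j : Fin n) (F : Cn n → ℂ) (z : Cn n) : ℂ :=
  (fderiv ℝ F z (stdVec j) + Complex.I * fderiv ℝ F z (Complex.I • stdVec j)) / 2

/-- A `(1,1)`-form `Ω = i ∑ Ω_{ij̄} dz^i ∧ dz̄^j` on an `n`-dimensional complex manifold `M`, given
by its coefficient matrices: `Ω e z i j` is the coefficient `Ω_{ij̄}` in the holomorphic chart `e`,
at the point with coordinates `z`. Only the values for `e` in the atlas of `M` and `z` in the
target of `e` are meaningful. -/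
abbrev Form11 (n : ℕ) (M : Type*) [TopologicalSpace M] : Type _ :=
  OpenPartialHomeomorph M (Cn n) → Cn n → Matrix (Fin n) (Fin n) ℂ

section Forms

variable {n : ℕ} {M : Type*} [TopologicalSpace M]

/-- The form `dd^c ψ = i ∂∂̄ψ` of a real function `ψ`: its coefficients in a chart are
`∂²ψ / ∂z^i ∂z̄^j`. -/
def ddc (ψ : M → ℝ) : Form11 n M := fun e z =>
  Matrix.of fun i j => dz i (dzbar j fun w => ((ψ (e.symm w) : ℝ) : ℂ)) z

/-- A `(1,1)`-form is positive if its coefficient matrices are Hermitian and positive definite. -/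
def IsPositive [ChartedSpace (Cn n) M] (Ω : Form11 n M) : Prop :=
  ∀ e ∈ atlas (Cn n) M, ∀ z ∈ e.target, (Ω e z).PosDef

/-- The holomorphic Jacobian matrix `∂w^k / ∂z^i` (row `k`, column `i`), at the point with
`e`-coordinates `z`, of the change from the coordinates `z` of `e` to the coordinates `w` of
`e'`. -/
def jacobian (e e' : OpenPartialHomeomorph M (Cn n)) (z : Cn n) : Matrix (Fin n) (Fin n) ℂ :=
  Matrix.of fun k i => fderiv ℂ (fun w => e' (e.symm w)) z (stdVec i) k

/-- Smooth Kähler forms on `M`: positive smooth closed real `(1,1)`-forms. -/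
structure IsKahler [ChartedSpace (Cn n) M] (Ω : Form11 n M) : Prop where
  /-- The coefficients in two charts are related by
  `Ω_{ij̄} = ∑ Ω'_{kl̄} (∂w^k/∂z^i) conj (∂w^l/∂z^j)`, i.e. they define a form on `M`. -/
  transform : ∀ e ∈ atlas (Cn n) M, ∀ e' ∈ atlas (Cn n) M, ∀ x ∈ e.source ∩ e'.source,
    ∀ i j, Ω e (e x) i j = ∑ k, ∑ l,
      Ω e' (e' x) k l * jacobian e e' (e x) k i * conj (jacobian e e' (e x) l j)
  smooth : ∀ e ∈ atlas (Cn n) M, ∀ i j, ContDiffOn ℝ ∞ (fun z => Ω e z i j) e.target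
  positive : IsPositive Ω
  /-- `dΩ = 0`; since `Ω` is real this amounts to `∂Ω = 0`. -/
  closed : ∀ e ∈ atlas (Cn n) M, ∀ z ∈ e.target, ∀ i j k,
    dz k (fun w => Ω e w i j) z = dz i (fun w => Ω e w k j) z

/-- The Laplacian `Δ_Ω ψ = tr_Ω dd^c ψ = ∑ g^{ij̄} ψ_{ij̄}` of the Kähler form `Ω` with
coefficients `g_{ij̄}`, where `g^{ij̄}` is the entry `(j, i)` of the inverse of the matrix
`(g_{ij̄})`. (The sum is real when `ψ` is of class `C²`.) -/
def laplacian (Ω : Form11 n M) (ψ : M → ℝ) (e : OpenPartialHomeomorph M (Cn n)) (z : Cn n) : ℝ :=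
  (∑ i, ∑ j, (Ω e z)⁻¹ j i * ddc ψ e z i j).re

/-- The pointwise norm `|Θ|_Ω = (∑ g^{kl̄} g^{pq̄} Θ_{pl̄} Θ_{kq̄})^{1/2}` of a real `(1,1)`-form
`Θ` with respect to the Kähler form `Ω`. (The sum is real and non-negative.) -/
def formNorm (Ω Θ : Form11 n M) (e : OpenPartialHomeomorph M (Cn n)) (z : Cn n) : ℝ :=
  Real.sqrt (∑ k, ∑ l, ∑ p, ∑ q,
    (Ω e z)⁻¹ l k * (Ω e z)⁻¹ q p * Θ e z p l * Θ e z k q).re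

/-- The curvature tensor
`R_{ij̄kl̄} = - ∂_k ∂_l̄ g_{ij̄} + ∑ g^{pq̄} (∂_k g_{iq̄}) (∂_l̄ g_{pj̄})` of `Ω`. -/
def curvature (Ω : Form11 n M) (e : OpenPartialHomeomorph M (Cn n)) (z : Cn n)
    (i j k l : Fin n) : ℂ :=
  - dz k (dzbar l fun w => Ω e w i j) z
    + ∑ p, ∑ q, (Ω e z)⁻¹ q p * dz k (fun w => Ω e w i q) z * dzbar l (fun w => Ω e w p j) z

/-- The square length `|v|_Ω² = ∑ g_{ij̄} v^i v̄^j` of the tangent vector `∑ v^i ∂/∂z^i`. -/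
def normSqVec (Ω : Form11 n M) (e : OpenPartialHomeomorph M (Cn n)) (z : Cn n)
    (v : Fin n → ℂ) : ℝ :=
  (∑ i, ∑ j, Ω e z i j * v i * conj (v j)).re

/-- `R(v, v̄, w, w̄) = ∑ R_{ij̄kl̄} v^i v̄^j w^k w̄^l`. -/
def bisectional (Ω : Form11 n M) (e : OpenPartialHomeomorph M (Cn n)) (z : Cn n)
    (v w : Fin n → ℂ) : ℝ :=
  (∑ i, ∑ j, ∑ k, ∑ l, curvature Ω e z i j k l * v i * conj (v j) * w k * conj (w l)).re

/-- The bisectional curvature of `Ω` is bounded below by `κ`: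
`R(v, v̄, w, w̄) ≥ κ` for all unit tangent vectors `v`, `w` of type `(1,0)` at a common point. -/
def BisectionalBoundedBelow [ChartedSpace (Cn n) M] (Ω : Form11 n M) (κ : ℝ) : Prop :=
  ∀ e ∈ atlas (Cn n) M, ∀ z ∈ e.target, ∀ v w : Fin n → ℂ,
    normSqVec Ω e z v = 1 → normSqVec Ω e z w = 1 → κ ≤ bisectional Ω e z v w

/-- The complex Monge-Ampère equation `(Ω + dd^c φ)^n = e^f Ω^n`. In a chart,
`Θ^n = n! det (Θ_{ij̄}) (i dz^1 ∧ dz̄^1) ∧ ⋯ ∧ (i dz^n ∧ dz̄^n)` for every `(1,1)`-form `Θ`. -/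
def SolvesMongeAmpere [ChartedSpace (Cn n) M] (Ω : Form11 n M) (f φ : M → ℝ) : Prop :=
  ∀ e ∈ atlas (Cn n) M, ∀ z ∈ e.target,
    ((Ω + ddc φ : Form11 n M) e z).det = (Real.exp (f (e.symm z)) : ℂ) * (Ω e z).det

end Forms

/-- A smooth Hermitian metric on a holomorphic line bundle `L` over the complex manifold `M`,
given by the functions `v ↦ |v|_h²` on the (one-dimensional) fibres. It is smooth in the sense that
the square length of every local holomorphic frame of the atlas of trivializations is a smooth
function. -/
structure HermitianLineMetric (n : ℕ) {M : Type*} [TopologicalSpace M] [ChartedSpace (Cn n) M]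
    (L : M → Type*) [TopologicalSpace (Bundle.TotalSpace ℂ L)]
    [∀ x, AddCommGroup (L x)] [∀ x, Module ℂ (L x)] [∀ x, TopologicalSpace (L x)]
    [FiberBundle ℂ L] [VectorBundle ℂ ℂ L] where
  normSq : ∀ x, L x → ℝ
  normSq_smul : ∀ x (c : ℂ) (v : L x), normSq x (c • v) = ‖c‖ ^ 2 * normSq x v
  normSq_pos : ∀ x (v : L x), v ≠ 0 → 0 < normSq x v
  smooth : ∀ (t : Bundle.Trivialization ℂ (Bundle.TotalSpace.proj : Bundle.TotalSpace ℂ L → M))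
    [MemTrivializationAtlas t],
    ContMDiffOn 𝓘(ℝ, Cn n) 𝓘(ℝ, ℝ) ∞ (fun x => normSq x (t.symm x 1)) t.baseSet

/-- The form `Ω₀ + dd^c ((σ + ε)^τ - (σ + ε)^τ')`, where `σ = |s|_h²`. -/
def approxForm {n : ℕ} {M : Type*} [TopologicalSpace M] (Ω₀ : Form11 n M) (σ : M → ℝ)
    (τ τ' ε : ℝ) : Form11 n M :=
  Ω₀ + ddc fun x => (σ x + ε) ^ τ - (σ x + ε) ^ τ'

end ComplexMA

end

universe u v

open ComplexMA

namespace ComplexMA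

open scoped Matrix.Norms.L2Operator
open Filter Topology

set_option linter.unusedSectionVars false

/-! Write γ for the coefficient matrix of Ω in a chart, γ' = γ + ∂∂̄φ, and λ_i for the eigenvalues
of γ' relative to γ. Then ∏ λ_i = e^f and |dd^c φ|² = Σ (λ_i − 1)², so the theorem is an upper bound
for S = Σ λ_i = tr_Ω(Ω + dd^c φ) (`relTrace`), once the λ_i are known to be positive. Positivity is
not assumed; it follows from the equation and compactness (`IsKahler.isPositive_add_ddc`).

The bound is the Aubin–Yau maximum principle for S e^{−Kφ}, with c = min(κ, 0) and K = 1 − c. At a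
maximum point S Σ 1/λ_i ≤ K n S − D (`sum_mul_sum_inv_le_of_max`). If S ≥ 1 this bounds every 1/λ_i,
and an upper bound for ∏ λ_i = e^f then bounds every λ_i. The upper bound for f comes from the
maximum of f + φ (`IsKahler.exp_le`). Moving from the maximum point to another point costs a factor
e^{2KA}.

Classically one differentiates log det γ' = f + log det γ twice, which involves fourth derivatives
of φ; a C³ solution need not have them. Here the differential inequality is proved in the viscosity
sense. The second derivatives of φ along holomorphic affine fields ξ_α are replaced by four-point
difference quotients D_h. Concavity of log det turns the equation at the four shifted points into an
inequality for the Hessian of D_h (`fourPoint_logDet_le`). If a C² function Q touches Σ φ_{ξ_α ξ̄_α}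
strictly from above at p, then Σ D_h − Q has local maxima z_h tending to p. The Hessian test at z_h
and the limit h → 0 give an inequality for ∂∂̄Q at p (`viscosity_of_strict`). Closedness of Ω
absorbs the terms in γ, so that tr(Y γ' Yᴴ) itself can be touched, Y being the matrix with rows ξ_α
(`viscosity_frame`).

It remains to choose Y and a C² majorant P. The weight w = |1 − K ∂φ(p)(z − p)|² has first
derivatives opposite to those of e^{K(φ − φ(p))}, and Y is chosen so that YᴴY = w γ⁻¹ up to second
order at p. With H = γ'(p) frozen, P = w (S e^{K(φ − φ(p))} − tr(γ⁻¹H)) + tr(YᴴYH) majorizes up to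
o(|z − p|²), although γ' is merely continuous in this argument (`eventually_le_comparison`). At p
the terms quadratic in ∂φ cancel, and ∂∂̄P consists of S K ∂∂̄φ and a curvature term
(`wd_wdb_comparison`). The choice of w and Y thereby takes the place of the usual Cauchy–Schwarz
treatment of the gradient terms. -/

section

/-! ### Wirtinger calculus for vector-valued functions. -/

section Wirtinger

variable {E F W W' W'' : Type*}
  [NormedAddCommGroup E] [NormedSpace ℝ E] [NormedSpace ℂ E] [IsScalarTower ℝ ℂ E]
  [NormedAddCommGroup F] [NormedSpace ℝ F] [NormedSpace ℂ F] [IsScalarTower ℝ ℂ F]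
  [NormedAddCommGroup W] [NormedSpace ℝ W] [NormedSpace ℂ W] [IsScalarTower ℝ ℂ W]
  [NormedAddCommGroup W'] [NormedSpace ℝ W'] [NormedSpace ℂ W'] [IsScalarTower ℝ ℂ W']
  [NormedAddCommGroup W''] [NormedSpace ℝ W''] [NormedSpace ℂ W''] [IsScalarTower ℝ ℂ W'']

/-- The Wirtinger derivative `∂_v f` in the direction `v`, for vector-valued `f`. -/
noncomputable def wd (v : E) (f : E → W) (z : E) : W :=
  (2⁻¹ : ℂ) • (fderiv ℝ f z v - Complex.I • fderiv ℝ f z (Complex.I • v))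

/-- The Wirtinger derivative `∂̄_v f` in the direction `v`, for vector-valued `f`. -/
noncomputable def wdb (v : E) (f : E → W) (z : E) : W :=
  (2⁻¹ : ℂ) • (fderiv ℝ f z v + Complex.I • fderiv ℝ f z (Complex.I • v))

theorem fderiv_eq_wd_add_wdb (f : E → W) (z v : E) :
    fderiv ℝ f z v = wd v f z + wdb v f z := by
  unfold wd wdb
  module

theorem smul_eq_re_add_im (c : ℂ) (v : E) : c • v = c.re • v + c.im • (Complex.I • v) := by
  conv_lhs => rw [← Complex.re_add_im c]
  rw [add_smul, mul_smul, ← Complex.coe_algebraMap, algebraMap_smul, algebraMap_smul]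

theorem wd_add_dir (v w : E) (f : E → W) (z : E) : wd (v + w) f z = wd v f z + wd w f z := by
  simp only [wd, smul_add, map_add]; module

theorem wdb_add_dir (v w : E) (f : E → W) (z : E) : wdb (v + w) f z = wdb v f z + wdb w f z := by
  simp only [wdb, smul_add, map_add]; module

theorem clm_complex_smul (L : E →L[ℝ] W) (c : ℂ) (v : E) :
    L (c • v) = (c.re : ℂ) • L v + (c.im : ℂ) • L (Complex.I • v) := by
  rw [smul_eq_re_add_im, map_add, map_smul, map_smul]
  simp only [← Complex.coe_algebraMap, algebraMap_smul]

theorem wd_smul_dir (c : ℂ) (v : E) (f : E → W) (z : E) : wd (c • v) f z = c • wd v f z := by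
  simp only [wd, smul_smul, clm_complex_smul _ c, clm_complex_smul _ (Complex.I * c)]
  simp only [Complex.mul_re, Complex.mul_im, Complex.I_re, Complex.I_im]
  conv_rhs => rw [← Complex.re_add_im c]
  match_scalars
  · ring_nf
  · ring_nf; simp; ring

theorem wdb_smul_dir (c : ℂ) (v : E) (f : E → W) (z : E) :
    wdb (c • v) f z = conj c • wdb v f z := by
  simp only [wdb, smul_smul, clm_complex_smul _ c, clm_complex_smul _ (Complex.I * c)]
  simp only [Complex.mul_re, Complex.mul_im, Complex.I_re, Complex.I_im]
  have hc : conj c = c.re - c.im * Complex.I := by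
    apply Complex.ext <;> simp
  rw [hc]
  match_scalars
  · ring_nf
  · ring_nf; simp; ring

theorem wd_zero_dir (f : E → W) (z : E) : wd 0 f z = 0 := by simp [wd]

theorem wdb_zero_dir (f : E → W) (z : E) : wdb 0 f z = 0 := by simp [wdb]

theorem wd_sum_dir {ι : Type*} (s : Finset ι) (v : ι → E) (f : E → W) (z : E) :
    wd (∑ i ∈ s, v i) f z = ∑ i ∈ s, wd (v i) f z := by
  classical
  induction s using Finset.induction_on with
  | empty => simp [wd_zero_dir]
  | insert a s ha ih => rw [Finset.sum_insert ha, Finset.sum_insert ha, wd_add_dir, ih]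

theorem wdb_sum_dir {ι : Type*} (s : Finset ι) (v : ι → E) (f : E → W) (z : E) :
    wdb (∑ i ∈ s, v i) f z = ∑ i ∈ s, wdb (v i) f z := by
  classical
  induction s using Finset.induction_on with
  | empty => simp [wdb_zero_dir]
  | insert a s ha ih => rw [Finset.sum_insert ha, Finset.sum_insert ha, wdb_add_dir, ih]

theorem wd_congr {f g : E → W} {z : E} (h : f =ᶠ[𝓝 z] g) (v : E) : wd v f z = wd v g z := by
  simp only [wd, h.fderiv_eq]

theorem wdb_congr {f g : E → W} {z : E} (h : f =ᶠ[𝓝 z] g) (v : E) : wdb v f z = wdb v g z := by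
  simp only [wdb, h.fderiv_eq]

theorem wdb_eventuallyEq {f g : E → W} {z : E} (h : f =ᶠ[𝓝 z] g) (v : E) :
    wdb v f =ᶠ[𝓝 z] wdb v g :=
  h.eventuallyEq_nhds.mono fun _ hy => wdb_congr hy v

theorem wd_const (v : E) (c : W) (z : E) : wd v (fun _ => c) z = 0 := by
  simp [wd]

theorem wdb_const (v : E) (c : W) (z : E) : wdb v (fun _ => c) z = 0 := by
  simp [wdb]

theorem wd_add {f g : E → W} {z : E} (hf : DifferentiableAt ℝ f z) (hg : DifferentiableAt ℝ g z)
    (v : E) : wd v (fun y => f y + g y) z = wd v f z + wd v g z := by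
  simp only [wd, fderiv_fun_add hf hg, _root_.add_apply]; module

theorem wdb_add {f g : E → W} {z : E} (hf : DifferentiableAt ℝ f z) (hg : DifferentiableAt ℝ g z)
    (v : E) : wdb v (fun y => f y + g y) z = wdb v f z + wdb v g z := by
  simp only [wdb, fderiv_fun_add hf hg, _root_.add_apply]; module

theorem wd_neg (f : E → W) (z : E)
    (v : E) : wd v (fun y => - f y) z = - wd v f z := by
  simp only [wd, fderiv_fun_neg, _root_.neg_apply]; module

theorem wdb_neg (f : E → W) (z : E)
    (v : E) : wdb v (fun y => - f y) z = - wdb v f z := by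
  simp only [wdb, fderiv_fun_neg, _root_.neg_apply]; module

theorem wd_sub {f g : E → W} {z : E} (hf : DifferentiableAt ℝ f z) (hg : DifferentiableAt ℝ g z)
    (v : E) : wd v (fun y => f y - g y) z = wd v f z - wd v g z := by
  simp only [wd, fderiv_fun_sub hf hg, _root_.sub_apply]; module

theorem wdb_sub {f g : E → W} {z : E} (hf : DifferentiableAt ℝ f z) (hg : DifferentiableAt ℝ g z)
    (v : E) : wdb v (fun y => f y - g y) z = wdb v f z - wdb v g z := by
  simp only [wdb, fderiv_fun_sub hf hg, _root_.sub_apply]; module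

theorem wd_sum {ι : Type*} (s : Finset ι) {f : ι → E → W} {z : E}
    (hf : ∀ i ∈ s, DifferentiableAt ℝ (f i) z) (v : E) :
    wd v (fun y => ∑ i ∈ s, f i y) z = ∑ i ∈ s, wd v (f i) z := by
  simp only [wd, fderiv_fun_sum hf, _root_.sum_apply, Finset.smul_sum,
    ← Finset.sum_sub_distrib]

theorem fderiv_clm_comp (L : W →L[ℂ] W') {f : E → W} {z : E} (hf : DifferentiableAt ℝ f z)
    (v : E) : fderiv ℝ (fun y => L (f y)) z v = L (fderiv ℝ f z v) := by
  have := ((L.restrictScalars ℝ).hasFDerivAt.comp z hf.hasFDerivAt).fderiv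
  have h2 : fderiv ℝ (fun y => L (f y)) z = (L.restrictScalars ℝ).comp (fderiv ℝ f z) := this
  rw [h2]; rfl

theorem wd_clm_comp (L : W →L[ℂ] W') {f : E → W} {z : E} (hf : DifferentiableAt ℝ f z)
    (v : E) : wd v (fun y => L (f y)) z = L (wd v f z) := by
  simp only [wd, fderiv_clm_comp L hf, map_smul, map_sub]

theorem wdb_clm_comp (L : W →L[ℂ] W') {f : E → W} {z : E} (hf : DifferentiableAt ℝ f z)
    (v : E) : wdb v (fun y => L (f y)) z = L (wdb v f z) := by
  simp only [wdb, fderiv_clm_comp L hf, map_smul, map_add]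

theorem differentiableAt_clm_comp (L : W →L[ℂ] W') {f : E → W} {z : E}
    (hf : DifferentiableAt ℝ f z) : DifferentiableAt ℝ (fun y => L (f y)) z :=
  (L.restrictScalars ℝ).differentiableAt.comp z hf

theorem contDiffAt_clm_comp (L : W →L[ℂ] W') {f : E → W} {z : E} {k : WithTop ℕ∞}
    (hf : ContDiffAt ℝ k f z) : ContDiffAt ℝ k (fun y => L (f y)) z :=
  (L.restrictScalars ℝ).contDiff.contDiffAt.comp z hf

theorem fderiv_real_eq {f : E → F} {z : E} (hf : DifferentiableAt ℂ f z) (v : E) :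
    fderiv ℝ f z v = fderiv ℂ f z v := by
  rw [(hf.hasFDerivAt.restrictScalars ℝ).fderiv]; rfl

theorem wd_of_holomorphic {f : E → F} {z : E} (hf : DifferentiableAt ℂ f z) (v : E) :
    wd v f z = fderiv ℂ f z v := by
  simp only [wd, fderiv_real_eq hf, map_smul, smul_smul]
  simp only [Complex.I_mul_I]
  module

theorem wdb_of_holomorphic {f : E → F} {z : E} (hf : DifferentiableAt ℂ f z) (v : E) :
    wdb v f z = 0 := by
  simp only [wdb, fderiv_real_eq hf, map_smul, smul_smul]
  simp only [Complex.I_mul_I]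
  module

/-- The derivative of Φ is complex linear, so it commutes with the multiplication by `Complex.I` in
the definition of `wd`. -/
theorem wd_comp_holomorphic {Φ : E → F} {f : F → W} {z : E} (hf : DifferentiableAt ℝ f (Φ z))
    (hΦ : DifferentiableAt ℂ Φ z) (v : E) :
    wd v (fun y => f (Φ y)) z = wd (fderiv ℂ Φ z v) f (Φ z) := by
  have h : fderiv ℝ (fun y => f (Φ y)) z = (fderiv ℝ f (Φ z)).comp (fderiv ℝ Φ z) :=
    fderiv_comp z hf (hΦ.restrictScalars ℝ)
  simp only [wd, h, ContinuousLinearMap.comp_apply, fderiv_real_eq hΦ, map_smul]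

theorem wdb_comp_holomorphic {Φ : E → F} {f : F → W} {z : E} (hf : DifferentiableAt ℝ f (Φ z))
    (hΦ : DifferentiableAt ℂ Φ z) (v : E) :
    wdb v (fun y => f (Φ y)) z = wdb (fderiv ℂ Φ z v) f (Φ z) := by
  have h : fderiv ℝ (fun y => f (Φ y)) z = (fderiv ℝ f (Φ z)).comp (fderiv ℝ Φ z) :=
    fderiv_comp z hf (hΦ.restrictScalars ℝ)
  simp only [wdb, h, ContinuousLinearMap.comp_apply, fderiv_real_eq hΦ, map_smul]

theorem contDiffAt_fderiv_apply {f : E → W} {z : E} {m k : WithTop ℕ∞} (hf : ContDiffAt ℝ k f z)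
    (hm : m + 1 ≤ k) (v : E) : ContDiffAt ℝ m (fun y => fderiv ℝ f y v) z :=
  (hf.fderiv_right hm).clm_apply contDiffAt_const

theorem contDiffAt_wd {f : E → W} {z : E} {m k : WithTop ℕ∞} (hf : ContDiffAt ℝ k f z)
    (hm : m + 1 ≤ k) (v : E) : ContDiffAt ℝ m (wd v f) z := by
  unfold wd
  exact contDiffAt_clm_comp ((2⁻¹ : ℂ) • ContinuousLinearMap.id ℂ W)
    ((contDiffAt_fderiv_apply hf hm v).sub
    (contDiffAt_clm_comp (Complex.I • ContinuousLinearMap.id ℂ W)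
      (contDiffAt_fderiv_apply hf hm (Complex.I • v))))

theorem contDiffAt_wdb {f : E → W} {z : E} {m k : WithTop ℕ∞} (hf : ContDiffAt ℝ k f z)
    (hm : m + 1 ≤ k) (v : E) : ContDiffAt ℝ m (wdb v f) z := by
  unfold wdb
  exact contDiffAt_clm_comp ((2⁻¹ : ℂ) • ContinuousLinearMap.id ℂ W)
    ((contDiffAt_fderiv_apply hf hm v).add
    (contDiffAt_clm_comp (Complex.I • ContinuousLinearMap.id ℂ W)
      (contDiffAt_fderiv_apply hf hm (Complex.I • v))))

theorem differentiableAt_wd {f : E → W} {z : E} (hf : ContDiffAt ℝ 2 f z) (v : E) :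
    DifferentiableAt ℝ (wd v f) z :=
  (contDiffAt_wd (m := 1) hf (by norm_num) v).differentiableAt (by norm_num)

theorem differentiableAt_wdb {f : E → W} {z : E} (hf : ContDiffAt ℝ 2 f z) (v : E) :
    DifferentiableAt ℝ (wdb v f) z :=
  (contDiffAt_wdb (m := 1) hf (by norm_num) v).differentiableAt (by norm_num)

theorem fderiv_fderiv_apply {f : E → W} {z : E} (hf : ContDiffAt ℝ 2 f z) (v w : E) :
    fderiv ℝ (fun y => fderiv ℝ f y w) z v = fderiv ℝ (fderiv ℝ f) z v w := by
  have h : DifferentiableAt ℝ (fderiv ℝ f) z :=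
    (hf.fderiv_right (m := 1) (by norm_num)).differentiableAt (by norm_num)
  rw [fderiv_clm_apply h (differentiableAt_const _)]
  simp

theorem fderiv_fderiv_symm {f : E → W} {z : E} (hf : ContDiffAt ℝ 2 f z) (v w : E) :
    fderiv ℝ (fderiv ℝ f) z v w = fderiv ℝ (fderiv ℝ f) z w v :=
  hf.isSymmSndFDerivAt (by simp) v w

theorem fderiv_wd {f : E → W} {z : E} (hf : ContDiffAt ℝ 2 f z) (v w : E) :
    fderiv ℝ (wd w f) z v = (2⁻¹ : ℂ) • (fderiv ℝ (fderiv ℝ f) z v w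
      - Complex.I • fderiv ℝ (fderiv ℝ f) z v (Complex.I • w)) := by
  have h1 : ∀ w, DifferentiableAt ℝ (fun y => fderiv ℝ f y w) z := fun w =>
    (contDiffAt_fderiv_apply (m := 1) hf (by norm_num) w).differentiableAt (by norm_num)
  have e : wd w f = fun y => ((2⁻¹ : ℂ) • ContinuousLinearMap.id ℂ W) (fderiv ℝ f y w -
    (Complex.I • ContinuousLinearMap.id ℂ W) (fderiv ℝ f y (Complex.I • w))) := rfl
  rw [e, fderiv_clm_comp _ (DifferentiableAt.fun_sub (h1 _) (differentiableAt_clm_comp _ (h1 _))),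
    fderiv_fun_sub (h1 _) (differentiableAt_clm_comp _ (h1 _)), _root_.sub_apply,
    fderiv_clm_comp _ (h1 _), fderiv_fderiv_apply hf, fderiv_fderiv_apply hf]
  rfl

theorem fderiv_wdb {f : E → W} {z : E} (hf : ContDiffAt ℝ 2 f z) (v w : E) :
    fderiv ℝ (wdb w f) z v = (2⁻¹ : ℂ) • (fderiv ℝ (fderiv ℝ f) z v w
      + Complex.I • fderiv ℝ (fderiv ℝ f) z v (Complex.I • w)) := by
  have h1 : ∀ w, DifferentiableAt ℝ (fun y => fderiv ℝ f y w) z := fun w =>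
    (contDiffAt_fderiv_apply (m := 1) hf (by norm_num) w).differentiableAt (by norm_num)
  have e : wdb w f = fun y => ((2⁻¹ : ℂ) • ContinuousLinearMap.id ℂ W) (fderiv ℝ f y w +
    (Complex.I • ContinuousLinearMap.id ℂ W) (fderiv ℝ f y (Complex.I • w))) := rfl
  rw [e, fderiv_clm_comp _ (DifferentiableAt.fun_add (h1 _) (differentiableAt_clm_comp _ (h1 _))),
    fderiv_fun_add (h1 _) (differentiableAt_clm_comp _ (h1 _)), _root_.add_apply,
    fderiv_clm_comp _ (h1 _), fderiv_fderiv_apply hf, fderiv_fderiv_apply hf]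
  rfl

theorem wd_wdb_comm {f : E → W} {z : E} (hf : ContDiffAt ℝ 2 f z) (v w : E) :
    wd v (wdb w f) z = wdb w (wd v f) z := by
  simp only [wd.eq_1 v (wdb w f), wdb.eq_1 w (wd v f), fderiv_wd hf, fderiv_wdb hf,
    fderiv_fderiv_symm hf w, fderiv_fderiv_symm hf (Complex.I • w)]
  module

theorem wd_wd_comm {f : E → W} {z : E} (hf : ContDiffAt ℝ 2 f z) (v w : E) :
    wd v (wd w f) z = wd w (wd v f) z := by
  simp only [wd.eq_1 v (wd w f), wd.eq_1 w (wd v f), fderiv_wd hf,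
    fderiv_fderiv_symm hf w, fderiv_fderiv_symm hf (Complex.I • w)]
  module

/-- The mixed terms D²f(v, iv) and D²f(iv, v) cancel by symmetry. What is left is a quarter of the
real Laplacian on the complex line through v, which a four-point difference quotient can compute. -/
theorem wd_wdb_self {f : E → W} {z : E} (hf : ContDiffAt ℝ 2 f z) (v : E) :
    wd v (wdb v f) z = (4⁻¹ : ℝ) • (fderiv ℝ (fderiv ℝ f) z v v
      + fderiv ℝ (fderiv ℝ f) z (Complex.I • v) (Complex.I • v)) := by
  simp only [wd.eq_1 v (wdb v f), fderiv_wdb hf, fderiv_fderiv_symm hf (Complex.I • v) v]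
  rw [← algebraMap_smul ℂ (4⁻¹ : ℝ)]
  simp only [Complex.coe_algebraMap, Complex.ofReal_inv, Complex.ofReal_ofNat, smul_add, smul_sub,
    smul_smul]
  match_scalars <;> (ring_nf; try simp)
  all_goals ring

section Star

variable [StarAddMonoid W] [NormedStarGroup W] [StarModule ℝ W] [StarModule ℂ W]

theorem fderiv_star_apply (f : E → W) (z v : E) :
    fderiv ℝ (fun y => star (f y)) z v = star (fderiv ℝ f z v) := by
  rw [fderiv_star]; rfl

theorem wd_star (f : E → W) (z v : E) :
    wd v (fun y => star (f y)) z = star (wdb v f z) := by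
  simp only [wd, wdb, fderiv_star_apply, star_smul, star_add]
  simp only [RCLike.star_def, map_inv₀, Complex.conj_ofNat, Complex.conj_I]
  module

theorem wdb_star (f : E → W) (z v : E) :
    wdb v (fun y => star (f y)) z = star (wd v f z) := by
  simp only [wd, wdb, fderiv_star_apply, star_smul, star_sub]
  simp only [RCLike.star_def, map_inv₀, Complex.conj_ofNat, Complex.conj_I]
  module

end Star

section Mul

variable {R : Type*} [NormedRing R] [NormedAlgebra ℂ R]

theorem fderiv_mul_apply {f g : E → R} {z : E} (hf : DifferentiableAt ℝ f z)
    (hg : DifferentiableAt ℝ g z) (v : E) :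
    fderiv ℝ (fun y => f y * g y) z v = fderiv ℝ f z v * g z + f z * fderiv ℝ g z v := by
  have h := fderiv_fun_mul' (𝕜 := ℝ) hf hg
  rw [h]
  simp [add_comm]

theorem wd_mul {f g : E → R} {z : E} (hf : DifferentiableAt ℝ f z) (hg : DifferentiableAt ℝ g z)
    (v : E) : wd v (fun y => f y * g y) z = wd v f z * g z + f z * wd v g z := by
  simp only [wd, fderiv_mul_apply hf hg, smul_mul_assoc, mul_smul_comm, sub_mul, mul_sub]
  module

theorem wdb_mul {f g : E → R} {z : E} (hf : DifferentiableAt ℝ f z) (hg : DifferentiableAt ℝ g z)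
    (v : E) : wdb v (fun y => f y * g y) z = wdb v f z * g z + f z * wdb v g z := by
  simp only [wdb, fderiv_mul_apply hf hg, smul_mul_assoc, mul_smul_comm, add_mul, mul_add]
  module

end Mul

section Smul

theorem fderiv_smul_apply {f : E → ℂ} {g : E → W} {z : E} (hf : DifferentiableAt ℝ f z)
    (hg : DifferentiableAt ℝ g z) (v : E) :
    fderiv ℝ (fun y => f y • g y) z v = fderiv ℝ f z v • g z + f z • fderiv ℝ g z v := by
  rw [fderiv_fun_smul hf hg]
  simp [add_comm]

theorem wd_smul {f : E → ℂ} {g : E → W} {z : E} (hf : DifferentiableAt ℝ f z)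
    (hg : DifferentiableAt ℝ g z)
    (v : E) : wd v (fun y => f y • g y) z = wd v f z • g z + f z • wd v g z := by
  simp only [wd, fderiv_smul_apply hf hg, smul_eq_mul]
  module

theorem wdb_smul {f : E → ℂ} {g : E → W} {z : E} (hf : DifferentiableAt ℝ f z)
    (hg : DifferentiableAt ℝ g z)
    (v : E) : wdb v (fun y => f y • g y) z = wdb v f z • g z + f z • wdb v g z := by
  simp only [wdb, fderiv_smul_apply hf hg, smul_eq_mul]
  module

end Smul

theorem dz_eq_wd {n : ℕ} (j : Fin n) (f : Cn n → ℂ) : dz j f = wd (stdVec j) f := by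
  ext z; simp only [dz, wd, smul_eq_mul]; ring

theorem dzbar_eq_wdb {n : ℕ} (j : Fin n) (f : Cn n → ℂ) : dzbar j f = wdb (stdVec j) f := by
  ext z; simp only [dzbar, wdb, smul_eq_mul]; ring

end Wirtinger

end

section

/-! ### Difference quotients converging to ∂_v ∂̄_v f. -/

section FourPoint

variable {E W : Type*}
  [NormedAddCommGroup E] [NormedSpace ℝ E] [NormedSpace ℂ E] [IsScalarTower ℝ ℂ E]
  [NormedAddCommGroup W] [NormedSpace ℝ W] [NormedSpace ℂ W] [IsScalarTower ℝ ℂ W]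

/-- Mean value inequality for t ↦ f(z + tv) + f(z − tv) − t² B(v, v). Its derivative is f'(z + tv) −
f'(z − tv) − B(2tv) applied to v, which is exactly what `hs` controls. The bound is uniform in z and
v. -/
theorem norm_second_difference_sub_le {f : E → W} {B : E →L[ℝ] E →L[ℝ] W} {s : Set E} {c : ℝ}
    (hd : ∀ x ∈ s, DifferentiableAt ℝ f x)
    (hs : ∀ x ∈ s, ∀ y ∈ s, ‖fderiv ℝ f x - fderiv ℝ f y - B (x - y)‖ ≤ c * ‖x - y‖)
    {z v : E} {h : ℝ} (hseg : ∀ t : ℝ, |t| ≤ |h| → z + t • v ∈ s) :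
    ‖f (z + h • v) + f (z - h • v) - (2 : ℝ) • f z - h ^ 2 • B v v‖ ≤ 2 * c * h ^ 2 * ‖v‖ ^ 2 := by
  set k : ℝ → W := fun t => f (z + t • v) + f (z + (-t) • v) - t ^ 2 • B v v with hk
  set I : Set ℝ := Set.Icc (-|h|) |h|
  have hmem : ∀ t ∈ I, z + t • v ∈ s := fun t ht => hseg t (abs_le.2 ht)
  have hmem' : ∀ t ∈ I, z + (-t) • v ∈ s := fun t ht => hseg _ (by rw [abs_neg]; exact abs_le.2 ht)
  have hder : ∀ t ∈ I, HasDerivWithinAt k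
      ((fderiv ℝ f (z + t • v) - fderiv ℝ f (z + (-t) • v)
        - B ((z + t • v) - (z + (-t) • v))) v) I t := by
    intro t ht
    have l1 : HasDerivAt (fun t : ℝ => z + t • v) v t := by
      simpa using ((hasDerivAt_id t).smul_const v).const_add z
    have l2 : HasDerivAt (fun t : ℝ => z + (-t) • v) (-v) t := by
      simpa using ((hasDerivAt_id t).neg.smul_const v).const_add z
    have d1 := (hd _ (hmem t ht)).hasFDerivAt.comp_hasDerivAt t l1
    have d2 := (hd _ (hmem' t ht)).hasFDerivAt.comp_hasDerivAt t l2
    have d3 : HasDerivAt (fun t : ℝ => t ^ 2 • B v v) ((2 * t) • B v v) t := by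
      simpa using ((hasDerivAt_id t).pow 2).smul_const (B v v)
    refine (((d1.add d2).sub d3).congr_deriv ?_).hasDerivWithinAt
    have : (z + t • v) - (z + (-t) • v) = (2 * t) • v := by module
    rw [this]
    simp only [map_smul, map_neg, _root_.sub_apply, _root_.smul_apply]
    abel
  have hbound : ∀ t ∈ I, ‖(fderiv ℝ f (z + t • v) - fderiv ℝ f (z + (-t) • v)
        - B ((z + t • v) - (z + (-t) • v))) v‖ ≤ 2 * c * |h| * ‖v‖ ^ 2 := by
    intro t ht
    have h1 := hs _ (hmem t ht) _ (hmem' t ht)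
    have h2 : ‖(z + t • v) - (z + (-t) • v)‖ = 2 * |t| * ‖v‖ := by
      rw [show (z + t • v) - (z + (-t) • v) = (2 * t) • v by module, norm_smul]
      simp
    rw [h2] at h1
    have ht' : |t| ≤ |h| := abs_le.2 ht
    by_cases hv : ‖v‖ = 0
    · have : v = 0 := norm_eq_zero.1 hv
      simp [this]
    by_cases hh : |h| = 0
    · have ht0 : t = 0 := by
        have := abs_nonneg t
        exact abs_eq_zero.1 (by linarith)
      simp [ht0, hh]
    have hv' : 0 < ‖v‖ := lt_of_le_of_ne (norm_nonneg _) (Ne.symm hv)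
    have hh' : 0 < |h| := lt_of_le_of_ne (abs_nonneg _) (Ne.symm hh)
    -- The sign of c is not assumed; it is forced by `hs` at the two distinct ends of the segment.
    have hc : 0 ≤ c := by
      have hI : |h| ∈ I := ⟨by linarith [abs_nonneg h], le_refl _⟩
      have h3 := (norm_nonneg _).trans (hs _ (hmem _ hI) _ (hmem' _ hI))
      have h4 : ‖(z + |h| • v) - (z + (-|h|) • v)‖ = 2 * |h| * ‖v‖ := by
        rw [show (z + |h| • v) - (z + (-|h|) • v) = (2 * |h|) • v by module, norm_smul]
        simp
      rw [h4] at h3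
      by_contra hneg
      have : c * (2 * |h| * ‖v‖) < 0 := mul_neg_of_neg_of_pos (not_le.1 hneg) (by positivity)
      linarith
    calc _ ≤ _ * ‖v‖ := ContinuousLinearMap.le_opNorm _ _
      _ ≤ (c * (2 * |t| * ‖v‖)) * ‖v‖ := by gcongr
      _ ≤ (c * (2 * |h| * ‖v‖)) * ‖v‖ := by gcongr
      _ = _ := by ring
  have key := Convex.norm_image_sub_le_of_norm_hasDerivWithin_le hder hbound (convex_Icc _ _)
    (show (0 : ℝ) ∈ I by constructor <;> simp) (show h ∈ I from ⟨neg_abs_le h, le_abs_self h⟩)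
  have e1 : k h - k 0 = f (z + h • v) + f (z - h • v) - (2 : ℝ) • f z - h ^ 2 • B v v := by
    simp only [hk, neg_smul, zero_smul, add_zero, ← sub_eq_add_neg]
    rw [two_smul]
    simp
    abel
  rw [e1] at key
  refine key.trans (le_of_eq ?_)
  rw [sub_zero, Real.norm_eq_abs, ← sq_abs h]
  ring

/-- The derivative of a C² function is strictly differentiable, so base point and direction may both
vary with the step. This is needed because the quotients are later evaluated at moving maximum
points. -/
theorem tendsto_second_difference {ι : Type*} {l : Filter ι} {f : E → W} {p v₀ : E}
    (hf : ContDiffAt ℝ 2 f p) {h : ι → ℝ} {z v : ι → E} (hh : Tendsto h l (𝓝 0))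
    (hh0 : ∀ᶠ i in l, h i ≠ 0) (hz : Tendsto z l (𝓝 p)) (hv : Tendsto v l (𝓝 v₀)) :
    Tendsto (fun i => (h i ^ 2)⁻¹ • (f (z i + h i • v i) + f (z i - h i • v i) - (2 : ℝ) • f (z i)))
      l (𝓝 (fderiv ℝ (fderiv ℝ f) p v₀ v₀)) := by
  set B := fderiv ℝ (fderiv ℝ f) p
  have hB : HasStrictFDerivAt (fderiv ℝ f) B p :=
    (hf.fderiv_right (m := 1) (by norm_num)).hasStrictFDerivAt (by norm_num)
  have hd : ∀ᶠ x in 𝓝 p, DifferentiableAt ℝ f x := by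
    filter_upwards [hf.eventually (by simp)] with x hx using hx.differentiableAt (by norm_num)
  have hBv : Tendsto (fun i => B (v i) (v i)) l (𝓝 (B v₀ v₀)) :=
    ((show Continuous fun v => B v v by fun_prop).tendsto v₀).comp hv
  suffices hs : Tendsto (fun i => (h i ^ 2)⁻¹ • (f (z i + h i • v i) + f (z i - h i • v i)
      - (2 : ℝ) • f (z i)) - B (v i) (v i)) l (𝓝 0) by
    simpa using hs.add hBv
  rw [Metric.tendsto_nhds]
  intro ε hε
  -- Chosen so that 2c‖v i‖² < ε as soon as ‖v i‖ < ‖v₀‖ + 1.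
  set c := ε / (2 * (‖v₀‖ + 1) ^ 2 + 1) with hc
  have hcpos : 0 < c := by positivity
  have hB' := (hasStrictFDerivAt_iff_isLittleO.1 hB).bound hcpos
  obtain ⟨r, hr, hball⟩ := Metric.eventually_nhds_iff_ball.1
    ((hd.prod_nhds (Eventually.of_forall fun _ => trivial)).and hB')
  have hball' : ∀ x ∈ Metric.ball p r, ∀ y ∈ Metric.ball p r, (x, y) ∈ Metric.ball (p, p) r := by
    intro x hx y hy
    rw [Metric.mem_ball, Prod.dist_eq]
    exact max_lt hx hy
  have ez : ∀ᶠ i in l, ‖z i - p‖ < r / 2 := by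
    have := Metric.tendsto_nhds.1 hz (r / 2) (by positivity)
    simpa [dist_eq_norm] using this
  have ev : ∀ᶠ i in l, ‖v i‖ < ‖v₀‖ + 1 := hv.norm.eventually_lt_const (by linarith)
  have ehv : ∀ᶠ i in l, |h i| * (‖v₀‖ + 1) < r / 2 := by
    have : Tendsto (fun i => |h i| * (‖v₀‖ + 1)) l (𝓝 0) := by
      simpa using hh.abs.mul_const (‖v₀‖ + 1)
    exact this.eventually_lt_const (by positivity)
  filter_upwards [ez, ev, ehv, hh0] with i h1 h2 h3 h4
  have hseg : ∀ t : ℝ, |t| ≤ |h i| → z i + t • v i ∈ Metric.ball p r := by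
    intro t ht
    rw [Metric.mem_ball, dist_eq_norm]
    calc ‖z i + t • v i - p‖ = ‖(z i - p) + t • v i‖ := by congr 1; abel
      _ ≤ ‖z i - p‖ + |t| * ‖v i‖ := by
        refine (norm_add_le _ _).trans ?_
        rw [norm_smul, Real.norm_eq_abs]
      _ ≤ ‖z i - p‖ + |h i| * (‖v₀‖ + 1) := by gcongr
      _ < r := by linarith
  have key := norm_second_difference_sub_le (f := f) (B := B) (s := Metric.ball p r) (c := c)
    (fun x hx => (hball _ (hball' x hx x hx)).1.1)
    (fun x hx y hy => (hball _ (hball' x hx y hy)).2) hseg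
  have hpos : 0 < h i ^ 2 := by positivity
  rw [dist_zero_right]
  have e : (h i ^ 2)⁻¹ • (f (z i + h i • v i) + f (z i - h i • v i) - (2 : ℝ) • f (z i))
      - B (v i) (v i) = (h i ^ 2)⁻¹ • (f (z i + h i • v i) + f (z i - h i • v i)
        - (2 : ℝ) • f (z i) - h i ^ 2 • B (v i) (v i)) := by
    rw [smul_sub _ _ (h i ^ 2 • _), smul_smul, inv_mul_cancel₀ hpos.ne', one_smul]
  rw [e, norm_smul, norm_inv, Real.norm_of_nonneg hpos.le]
  calc _ ≤ (h i ^ 2)⁻¹ * (2 * c * h i ^ 2 * ‖v i‖ ^ 2) := by gcongr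
    _ = c * (2 * ‖v i‖ ^ 2) := by field_simp
    _ ≤ c * (2 * (‖v₀‖ + 1) ^ 2) := by gcongr
    _ < c * (2 * (‖v₀‖ + 1) ^ 2 + 1) := by gcongr; linarith
    _ = ε := by rw [hc]; field_simp

/-- The four-point difference quotient `(4h²)⁻¹ (∑ f(z + i^k h v) - 4 f(z))`. -/
noncomputable def fourPoint {V : Type*} [NormedAddCommGroup V] [NormedSpace ℝ V] (f : E → V) (h : ℝ) (z v : E) : V :=
  (4⁻¹ : ℝ) • ((h ^ 2)⁻¹ • (f (z + h • v) + f (z - h • v) - (2 : ℝ) • f z)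
    + (h ^ 2)⁻¹ • (f (z + h • (Complex.I • v)) + f (z - h • (Complex.I • v)) - (2 : ℝ) • f z))

theorem tendsto_fourPoint {ι : Type*} {l : Filter ι} {f : E → W} {p v₀ : E}
    (hf : ContDiffAt ℝ 2 f p) {h : ι → ℝ} {z v : ι → E} (hh : Tendsto h l (𝓝 0))
    (hh0 : ∀ᶠ i in l, h i ≠ 0) (hz : Tendsto z l (𝓝 p)) (hv : Tendsto v l (𝓝 v₀)) :
    Tendsto (fun i => fourPoint f (h i) (z i) (v i)) l (𝓝 (wd v₀ (wdb v₀ f) p)) := by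
  rw [wd_wdb_self hf]
  exact ((tendsto_second_difference hf hh hh0 hz hv).add
    (tendsto_second_difference hf hh hh0 hz (hv.const_smul Complex.I))).const_smul _

theorem fourPoint_nonpos {f : E → ℝ} {h : ℝ} {z v : E}
    (hf : ∀ x ∈ ({z + h • v, z - h • v, z + h • (Complex.I • v), z - h • (Complex.I • v)} : Set E),
      f x ≤ f z) : fourPoint f h z v ≤ 0 := by
  simp only [Set.mem_insert_iff, Set.mem_singleton_iff, forall_eq_or_imp, forall_eq] at hf
  obtain ⟨h1, h2, h3, h4⟩ := hf
  have hp : 0 ≤ (h ^ 2)⁻¹ := by positivity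
  simp only [fourPoint, smul_eq_mul]
  nlinarith

theorem fourPoint_clm_comp {V V' : Type*} [NormedAddCommGroup V] [NormedSpace ℝ V]
    [NormedAddCommGroup V'] [NormedSpace ℝ V'] (L : V →L[ℝ] V') (f : E → V) (h : ℝ) (z v : E) :
    fourPoint (fun y => L (f y)) h z v = L (fourPoint f h z v) := by
  simp only [fourPoint, map_smul, map_add, map_sub]

/-- The four-point quotient at a local maximum is nonpositive for all small steps; pass to the
limit. -/
theorem re_wd_wdb_nonpos_of_isLocalMax {f : E → ℝ} {p : E}
    (hf : ContDiffAt ℝ 2 f p) (hmax : IsLocalMax f p) (v : E) :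
    (wd v (wdb v fun y => (f y : ℂ)) p).re ≤ 0 := by
  have hfc : ContDiffAt ℝ 2 (fun y => (f y : ℂ)) p :=
    Complex.ofRealCLM.contDiff.contDiffAt.comp p hf
  have hh : Tendsto (fun t : ℝ => t) (𝓝[>] 0) (𝓝 0) := nhdsWithin_le_nhds
  have hh0 : ∀ᶠ t : ℝ in 𝓝[>] 0, t ≠ 0 := by
    filter_upwards [self_mem_nhdsWithin] with t ht using ne_of_gt ht
  have T := tendsto_fourPoint (v₀ := v) hfc hh hh0 (tendsto_const_nhds (x := p))
    (tendsto_const_nhds (x := v))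
  have T' := (Complex.continuous_re.tendsto _).comp T
  refine le_of_tendsto T' ?_
  have near : ∀ u : E, ∀ᶠ t : ℝ in 𝓝[>] 0, f (p + t • u) ≤ f p := by
    intro u
    have c : Tendsto (fun t : ℝ => p + t • u) (𝓝[>] 0) (𝓝 p) := by
      have : Tendsto (fun t : ℝ => p + t • u) (𝓝 0) (𝓝 (p + (0 : ℝ) • u)) :=
        (continuous_const.add (continuous_id.smul continuous_const)).tendsto 0
      rw [zero_smul, add_zero] at this
      exact this.mono_left nhdsWithin_le_nhds
    exact c.eventually hmax
  filter_upwards [near v, near (-v), near (Complex.I • v), near (-(Complex.I • v))]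
    with t h1 h2 h3 h4
  simp only [smul_neg, ← sub_eq_add_neg] at h2 h4
  have e : fourPoint (fun y => (f y : ℂ)) t p v = (fourPoint f t p v : ℝ) :=
    fourPoint_clm_comp Complex.ofRealCLM f t p v
  simp only [Function.comp]
  rw [e, Complex.ofReal_re]
  apply fourPoint_nonpos
  simp [*]

end FourPoint

end

section

open Matrix

/-! ### Hermitian linear algebra: congruence, relative eigenvalues, concavity of log det. -/

section LinearAlgebra

variable {n : ℕ}

/-- The sesquilinear form `∑ N_{ij} v^i conj (w^j)` of a matrix `N`. -/
noncomputable def sesq (N : Matrix (Fin n) (Fin n) ℂ) (v w : Fin n → ℂ) : ℂ :=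
  ∑ i, ∑ j, N i j * v i * conj (w j)

theorem mul_mul_conjTranspose_apply (V N W : Matrix (Fin n) (Fin n) ℂ) (k l : Fin n) :
    (V * N * Wᴴ) k l = sesq N (V k) (W l) := by
  simp only [sesq, mul_apply, conjTranspose_apply, Finset.sum_mul, RCLike.star_def]
  rw [Finset.sum_comm]
  refine Finset.sum_congr rfl fun i _ => Finset.sum_congr rfl fun j _ => by ring

theorem sesq_neg (N : Matrix (Fin n) (Fin n) ℂ) (v w : Fin n → ℂ) :
    sesq (-N) v w = - sesq N v w := by
  simp only [sesq, Matrix.neg_apply, neg_mul, Finset.sum_neg_distrib]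

/-- In `sesq` the row index is the linear slot, so it matches the usual quadratic form only after
conjugating the vector. This is harmless for positivity, which quantifies over all vectors. -/
theorem sesq_star_star (N : Matrix (Fin n) (Fin n) ℂ) (x : Fin n → ℂ) :
    sesq N (star x) (star x) = star x ⬝ᵥ (N *ᵥ x) := by
  simp only [sesq, dotProduct, mulVec, Finset.mul_sum, Pi.star_apply, RCLike.star_def,
    Complex.conj_conj]
  refine Finset.sum_congr rfl fun i _ => Finset.sum_congr rfl fun j _ => by ring

theorem posSemidef_of_sesq {N : Matrix (Fin n) (Fin n) ℂ} (hN : N.IsHermitian)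
    (h : ∀ v, 0 ≤ (sesq N v v).re) : N.PosSemidef := by
  refine PosSemidef.of_dotProduct_mulVec_nonneg hN fun x => ?_
  have h1 := h (star x)
  rw [sesq_star_star] at h1
  rw [Complex.nonneg_iff]
  refine ⟨h1, ?_⟩
  have := hN.im_star_dotProduct_mulVec_self x
  simpa using this.symm

theorem exists_mul_mul_conjTranspose_eq_one {G : Matrix (Fin n) (Fin n) ℂ} (hG : G.PosDef) :
    ∃ W : Matrix (Fin n) (Fin n) ℂ, W * G * Wᴴ = 1 := by
  set U : Matrix (Fin n) (Fin n) ℂ := (hG.1.eigenvectorUnitary : Matrix (Fin n) (Fin n) ℂ) with hU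
  have hUU : Uᴴ * U = 1 := by
    have := Unitary.coe_star_mul_self hG.1.eigenvectorUnitary
    rwa [star_eq_conjTranspose] at this
  set d : Fin n → ℝ := hG.1.eigenvalues
  have hd : ∀ i, 0 < d i := hG.eigenvalues_pos
  have hs : Uᴴ * G * U = diagonal (fun i => (d i : ℂ)) := by
    have := hG.1.conjStarAlgAut_star_eigenvectorUnitary
    rw [Unitary.conjStarAlgAut_star_apply, star_eq_conjTranspose] at this
    exact this
  refine ⟨diagonal (fun i => (((Real.sqrt (d i))⁻¹ : ℝ) : ℂ)) * Uᴴ, ?_⟩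
  rw [conjTranspose_mul, conjTranspose_conjTranspose, diagonal_conjTranspose]
  rw [show ∀ A B C D : Matrix (Fin n) (Fin n) ℂ, A * B * G * (C * D) = A * (B * G * C) * D from
    fun A B C D => by simp only [Matrix.mul_assoc], hs, diagonal_mul_diagonal,
    diagonal_mul_diagonal, ← diagonal_one]
  congr 1
  ext i
  simp only [Pi.star_apply, RCLike.star_def, Complex.conj_ofReal]
  rw [← Complex.ofReal_mul, ← Complex.ofReal_mul, ← Complex.ofReal_one]
  congr 1
  have h1 : Real.sqrt (d i) * Real.sqrt (d i) = d i := Real.mul_self_sqrt (hd i).le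
  have h2 : Real.sqrt (d i) ≠ 0 := (Real.sqrt_pos.2 (hd i)).ne'
  field_simp
  nlinarith

theorem isUnit_of_mul_mul_conjTranspose_eq_one {W G : Matrix (Fin n) (Fin n) ℂ}
    (h : W * G * Wᴴ = 1) : IsUnit W := by
  rw [Matrix.mul_assoc] at h
  exact IsUnit.of_mul_eq_one _ h

theorem inv_eq_conjTranspose_mul_self {V G : Matrix (Fin n) (Fin n) ℂ} (h : V * G * Vᴴ = 1) :
    G⁻¹ = Vᴴ * V := by
  refine inv_eq_left_inv ?_
  have h1 : Vᴴ * (V * G) = 1 := mul_eq_one_comm.1 h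
  rw [Matrix.mul_assoc, h1]

/-- Two positive definite matrices are simultaneously diagonalizable by a congruence. -/
theorem exists_simultaneous_diagonalization {G H : Matrix (Fin n) (Fin n) ℂ} (hG : G.PosDef)
    (hH : H.PosDef) : ∃ (V : Matrix (Fin n) (Fin n) ℂ) (lam : Fin n → ℝ), (∀ i, 0 < lam i) ∧
      V * G * Vᴴ = 1 ∧ V * H * Vᴴ = diagonal (fun i => (lam i : ℂ)) := by
  obtain ⟨W, hW⟩ := exists_mul_mul_conjTranspose_eq_one hG
  have hWu := isUnit_of_mul_mul_conjTranspose_eq_one hW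
  have hK : (W * H * Wᴴ).PosDef := by
    rw [← star_eq_conjTranspose]
    exact (IsUnit.posDef_star_right_conjugate_iff hWu).2 hH
  set U : Matrix (Fin n) (Fin n) ℂ := (hK.1.eigenvectorUnitary : Matrix (Fin n) (Fin n) ℂ) with hU
  have hUU : Uᴴ * U = 1 := by
    have := Unitary.coe_star_mul_self hK.1.eigenvectorUnitary
    rwa [star_eq_conjTranspose] at this
  refine ⟨Uᴴ * W, hK.1.eigenvalues, hK.eigenvalues_pos, ?_, ?_⟩
  · rw [conjTranspose_mul, conjTranspose_conjTranspose,
      show Uᴴ * W * G * (Wᴴ * U) = Uᴴ * (W * G * Wᴴ) * U by simp only [Matrix.mul_assoc], hW,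
      Matrix.mul_one, hUU]
  · rw [conjTranspose_mul, conjTranspose_conjTranspose,
      show Uᴴ * W * H * (Wᴴ * U) = Uᴴ * (W * H * Wᴴ) * U by simp only [Matrix.mul_assoc]]
    have := hK.1.conjStarAlgAut_star_eigenvectorUnitary
    rw [Unitary.conjStarAlgAut_star_apply, star_eq_conjTranspose] at this
    exact this

theorem trace_inv_mul {V G : Matrix (Fin n) (Fin n) ℂ} (h : V * G * Vᴴ = 1)
    (N : Matrix (Fin n) (Fin n) ℂ) : (G⁻¹ * N).trace = ∑ k, sesq N (V k) (V k) := by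
  rw [inv_eq_conjTranspose_mul_self h, Matrix.mul_assoc, trace_mul_comm, trace]
  simp only [diag_apply, mul_mul_conjTranspose_apply]

theorem re_trace_inv_mul_nonpos {G N : Matrix (Fin n) (Fin n) ℂ} (hG : G.PosDef)
    (hN : ∀ v, (sesq N v v).re ≤ 0) : ((G⁻¹ * N).trace).re ≤ 0 := by
  obtain ⟨W, hW⟩ := exists_mul_mul_conjTranspose_eq_one hG
  rw [trace_inv_mul hW, Complex.re_sum]
  exact Finset.sum_nonpos fun k _ => hN _

theorem det_ratio {V G H : Matrix (Fin n) (Fin n) ℂ} {lam : Fin n → ℝ}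
    (h1 : V * G * Vᴴ = 1) (h2 : V * H * Vᴴ = diagonal (fun i => (lam i : ℂ))) :
    H.det = ((∏ i, lam i : ℝ) : ℂ) * G.det := by
  have e1 := congrArg det h1
  have e2 := congrArg det h2
  rw [det_mul, det_mul, det_one] at e1
  rw [det_mul, det_mul, det_diagonal] at e2
  have e3 : V.det * Vᴴ.det * G.det = 1 := by rw [← e1]; ring
  have hne : V.det * Vᴴ.det ≠ 0 := left_ne_zero_of_mul_eq_one e3
  apply mul_left_cancel₀ hne
  rw [Complex.ofReal_prod, ← e2]
  linear_combination -(V.det * H.det * Vᴴ.det) * e3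

theorem det_re_pos {G : Matrix (Fin n) (Fin n) ℂ} (hG : G.PosDef) : 0 < G.det.re :=
  (Complex.pos_iff.1 hG.det_pos).1

theorem det_eq_re {G : Matrix (Fin n) (Fin n) ℂ} (hG : G.PosDef) : G.det = (G.det.re : ℂ) := by
  apply Complex.ext
  · simp
  · simpa using (Complex.pos_iff.1 hG.det_pos).2.symm

/-- Concavity of log det, as the tangent plane inequality at G. After simultaneous diagonalization
it is log λ ≤ λ − 1 for each relative eigenvalue. -/
theorem log_det_sub_log_det_le {G H : Matrix (Fin n) (Fin n) ℂ} (hG : G.PosDef) (hH : H.PosDef) :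
    Real.log H.det.re - Real.log G.det.re ≤ ((G⁻¹ * (H - G)).trace).re := by
  obtain ⟨V, lam, hlam, h1, h2⟩ := exists_simultaneous_diagonalization hG hH
  have e : H.det.re = (∏ i, lam i) * G.det.re := by
    rw [det_ratio h1 h2, Complex.re_ofReal_mul]
  have hprod : 0 < ∏ i, lam i := Finset.prod_pos fun i _ => hlam i
  rw [e, Real.log_mul hprod.ne' (det_re_pos hG).ne', add_sub_cancel_right,
    Real.log_prod (fun i _ => (hlam i).ne'), trace_inv_mul h1, Complex.re_sum]
  refine Finset.sum_le_sum fun i _ => ?_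
  rw [← mul_mul_conjTranspose_apply, Matrix.mul_sub, Matrix.sub_mul, h1, h2]
  have := Real.log_le_sub_one_of_pos (hlam i)
  simpa using this

end LinearAlgebra

end

section

open Matrix

/-! ### Derivatives of the inverse, the determinant and log det. -/

section MatrixCalculus

variable {n : ℕ} {E : Type*}
  [NormedAddCommGroup E] [NormedSpace ℝ E] [NormedSpace ℂ E] [IsScalarTower ℝ ℂ E]

/-- The `(i, j)` entry as a continuous linear map. -/
noncomputable def entryL (i j : Fin n) : Matrix (Fin n) (Fin n) ℂ →L[ℂ] ℂ :=
  LinearMap.toContinuousLinearMap (Matrix.entryLinearMap ℂ ℂ i j)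

/-- The trace as a continuous linear map. -/
noncomputable def traceL : Matrix (Fin n) (Fin n) ℂ →L[ℂ] ℂ :=
  LinearMap.toContinuousLinearMap (Matrix.traceLinearMap (Fin n) ℂ ℂ)

theorem contDiffAt_of_entries {k : WithTop ℕ∞} {γ : E → Matrix (Fin n) (Fin n) ℂ} {z : E}
    (h : ∀ i j, ContDiffAt ℝ k (fun y => γ y i j) z) : ContDiffAt ℝ k γ z := by
  have e : γ = fun y => ∑ i, ∑ j, (((ContinuousLinearMap.id ℂ ℂ).smulRight
      (Matrix.single i j (1 : ℂ)) : ℂ →L[ℂ] Matrix (Fin n) (Fin n) ℂ)) (γ y i j) := by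
    ext1 y
    conv_lhs => rw [Matrix.matrix_eq_sum_single (γ y)]
    refine Finset.sum_congr rfl fun i _ => Finset.sum_congr rfl fun j _ => ?_
    simp [Matrix.smul_single]
  rw [e]
  exact ContDiffAt.sum fun i _ => ContDiffAt.sum fun j _ => contDiffAt_clm_comp _ (h i j)

theorem contDiffAt_entry {k : WithTop ℕ∞} {γ : E → Matrix (Fin n) (Fin n) ℂ} {z : E}
    (h : ContDiffAt ℝ k γ z) (i j : Fin n) : ContDiffAt ℝ k (fun y => γ y i j) z :=
  contDiffAt_clm_comp (entryL i j) h

theorem wd_entry {γ : E → Matrix (Fin n) (Fin n) ℂ} {z : E}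
    (h : DifferentiableAt ℝ γ z) (v : E) (i j : Fin n) :
    wd v (fun y => γ y i j) z = wd v γ z i j :=
  wd_clm_comp (entryL i j) h v

theorem wdb_entry {γ : E → Matrix (Fin n) (Fin n) ℂ} {z : E}
    (h : DifferentiableAt ℝ γ z) (v : E) (i j : Fin n) :
    wdb v (fun y => γ y i j) z = wdb v γ z i j :=
  wdb_clm_comp (entryL i j) h v

theorem wd_trace {γ : E → Matrix (Fin n) (Fin n) ℂ} {z : E}
    (h : DifferentiableAt ℝ γ z) (v : E) :
    wd v (fun y => (γ y).trace) z = (wd v γ z).trace :=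
  wd_clm_comp traceL h v

theorem wd_wdb_entry {γ : E → Matrix (Fin n) (Fin n) ℂ} {z : E}
    (h : ContDiffAt ℝ 2 γ z) (v w : E) (i j : Fin n) :
    wd v (wdb w (fun y => γ y i j)) z = wd v (wdb w γ) z i j := by
  have e : wdb w (fun y => γ y i j) =ᶠ[𝓝 z] fun y => wdb w γ y i j := by
    filter_upwards [h.eventually (by simp)] with y hy using
      wdb_entry (hy.differentiableAt (by norm_num)) w i j
  rw [wd_congr e, wd_entry (differentiableAt_wdb h w)]

theorem contDiffAt_inv {k : WithTop ℕ∞} {γ : E → Matrix (Fin n) (Fin n) ℂ} {z : E}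
    (h : ContDiffAt ℝ k γ z) (hu : IsUnit (γ z)) : ContDiffAt ℝ k (fun y => (γ y)⁻¹) z := by
  obtain ⟨u, hu⟩ := hu
  have h1 : ContDiffAt ℝ k Ring.inverse (γ z) := by
    rw [← hu]; exact contDiffAt_ringInverse ℝ u
  have h2 := h1.comp z h
  refine h2.congr_of_eventuallyEq (Eventually.of_forall fun y => ?_)
  simp [Matrix.nonsing_inv_eq_ringInverse]

theorem eventually_isUnit {γ : E → Matrix (Fin n) (Fin n) ℂ} {z : E}
    (h : ContinuousAt γ z) (hu : IsUnit (γ z)) : ∀ᶠ y in 𝓝 z, IsUnit (γ y) :=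
  h.eventually (Units.isOpen.mem_nhds hu)

theorem wd_inv {γ : E → Matrix (Fin n) (Fin n) ℂ} {z : E}
    (h : ContDiffAt ℝ 1 γ z) (hu : IsUnit (γ z)) (v : E) :
    wd v (fun y => (γ y)⁻¹) z = -((γ z)⁻¹ * wd v γ z * (γ z)⁻¹) := by
  have hd := h.differentiableAt (by norm_num)
  have hi := (contDiffAt_inv h hu).differentiableAt (by norm_num)
  have e : (fun y => (γ y)⁻¹ * γ y) =ᶠ[𝓝 z] fun _ => 1 := by
    filter_upwards [eventually_isUnit h.continuousAt hu] with y hy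
    exact Matrix.nonsing_inv_mul _ ((Matrix.isUnit_iff_isUnit_det _).1 hy)
  have h1 := wd_congr e v
  rw [wd_const, wd_mul hi hd] at h1
  have h2 := congrArg (· * (γ z)⁻¹) h1
  simp only [add_mul, zero_mul, mul_assoc] at h2
  rw [Matrix.mul_nonsing_inv _ ((Matrix.isUnit_iff_isUnit_det _).1 hu), mul_one] at h2
  rw [eq_neg_of_add_eq_zero_left h2, mul_assoc]

theorem wdb_inv {γ : E → Matrix (Fin n) (Fin n) ℂ} {z : E}
    (h : ContDiffAt ℝ 1 γ z) (hu : IsUnit (γ z)) (v : E) :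
    wdb v (fun y => (γ y)⁻¹) z = -((γ z)⁻¹ * wdb v γ z * (γ z)⁻¹) := by
  have hd := h.differentiableAt (by norm_num)
  have hi := (contDiffAt_inv h hu).differentiableAt (by norm_num)
  have e : (fun y => (γ y)⁻¹ * γ y) =ᶠ[𝓝 z] fun _ => 1 := by
    filter_upwards [eventually_isUnit h.continuousAt hu] with y hy
    exact Matrix.nonsing_inv_mul _ ((Matrix.isUnit_iff_isUnit_det _).1 hy)
  have h1 := wdb_congr e v
  rw [wdb_const, wdb_mul hi hd] at h1
  have h2 := congrArg (· * (γ z)⁻¹) h1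
  simp only [add_mul, zero_mul, mul_assoc] at h2
  rw [Matrix.mul_nonsing_inv _ ((Matrix.isUnit_iff_isUnit_det _).1 hu), mul_one] at h2
  rw [eq_neg_of_add_eq_zero_left h2, mul_assoc]

theorem wd_wdb_inv {γ : E → Matrix (Fin n) (Fin n) ℂ} {z : E}
    (h : ContDiffAt ℝ 2 γ z) (hu : IsUnit (γ z)) (v w : E) :
    wd v (wdb w (fun y => (γ y)⁻¹)) z = (γ z)⁻¹ * wd v γ z * (γ z)⁻¹ * wdb w γ z * (γ z)⁻¹
      + (γ z)⁻¹ * wdb w γ z * (γ z)⁻¹ * wd v γ z * (γ z)⁻¹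
      - (γ z)⁻¹ * wd v (wdb w γ) z * (γ z)⁻¹ := by
  have e : wdb w (fun y => (γ y)⁻¹) =ᶠ[𝓝 z] fun y => -((γ y)⁻¹ * wdb w γ y * (γ y)⁻¹) := by
    filter_upwards [eventually_isUnit h.continuousAt hu, h.eventually (by simp)] with y hy hy'
    exact wdb_inv (hy'.of_le (by norm_num)) hy w
  have h1 : ContDiffAt ℝ 1 γ z := h.of_le (by norm_num)
  have hi := (contDiffAt_inv h1 hu).differentiableAt (by norm_num)
  have hw := differentiableAt_wdb h w
  rw [wd_congr e, wd_neg, wd_mul (DifferentiableAt.fun_mul hi hw) hi, wd_mul hi hw, wd_inv h1 hu]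
  noncomm_ring

theorem contDiff_det {k : WithTop ℕ∞} :
    ContDiff ℂ k (fun A : Matrix (Fin n) (Fin n) ℂ => A.det) := by
  simp only [det_apply]
  refine ContDiff.sum fun σ _ => ?_
  have : ContDiff ℂ k (fun A : Matrix (Fin n) (Fin n) ℂ => ∏ i, entryL (σ i) i A) :=
    contDiff_prod fun i _ => (entryL (σ i) i).contDiff
  have h2 := (contDiff_const (c := ((Equiv.Perm.sign σ : ℤ) : ℂ))).mul this
  have e : (fun A : Matrix (Fin n) (Fin n) ℂ => Equiv.Perm.sign σ • ∏ i, A (σ i) i) =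
      fun A => ((Equiv.Perm.sign σ : ℤ) : ℂ) * ∏ i, entryL (σ i) i A := by
    ext1 A
    rw [Units.smul_def, zsmul_eq_mul]
    rfl
  rw [e]
  exact h2

/-- Jacobi's formula at the identity, read off from det(1 + rM) = 1 + r tr M + O(r²) as a polynomial
in r. The general case `fderiv_det` factors det B = det A · det(A⁻¹B). -/
theorem fderiv_det_one (M : Matrix (Fin n) (Fin n) ℂ) :
    fderiv ℂ (fun A : Matrix (Fin n) (Fin n) ℂ => A.det) 1 M = M.trace := by
  have h1 : HasFDerivAt (fun A : Matrix (Fin n) (Fin n) ℂ => A.det) _ 1 :=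
    ((contDiff_det (n := n) (k := 1)).differentiable (by norm_num) 1).hasFDerivAt
  have l : HasDerivAt (fun r : ℂ => (1 : Matrix (Fin n) (Fin n) ℂ) + r • M) M 0 := by
    simpa using ((hasDerivAt_id (0 : ℂ)).smul_const M).const_add 1
  have h1' : HasFDerivAt (fun A : Matrix (Fin n) (Fin n) ℂ => A.det)
      (fderiv ℂ (fun A : Matrix (Fin n) (Fin n) ℂ => A.det) 1) (1 + (0 : ℂ) • M) := by
    simpa using h1
  have h2 := h1'.comp_hasDerivAt (0 : ℂ) l
  set q := (det (1 + (Polynomial.X : Polynomial ℂ) • M.map Polynomial.C)).divX.divX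
  have h3 : HasDerivAt (fun r : ℂ => 1 + M.trace * r + q.eval r * r ^ 2) M.trace 0 := by
    have a : HasDerivAt (fun r : ℂ => 1 + M.trace * r) M.trace 0 := by
      simpa using ((hasDerivAt_id (0 : ℂ)).const_mul M.trace).const_add 1
    have b := (q.hasDerivAt 0).mul ((hasDerivAt_id (0 : ℂ)).pow 2)
    have c : HasDerivAt (fun r : ℂ => 1 + M.trace * r + q.eval r * r ^ 2) _ 0 := a.add b
    simpa using c
  refine h2.unique (h3.congr_of_eventuallyEq (Eventually.of_forall fun r => ?_))
  exact det_one_add_smul r M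

theorem fderiv_det {A : Matrix (Fin n) (Fin n) ℂ} (hA : IsUnit A) (M : Matrix (Fin n) (Fin n) ℂ) :
    fderiv ℂ (fun A : Matrix (Fin n) (Fin n) ℂ => A.det) A M = A.det * (A⁻¹ * M).trace := by
  have hA' := (Matrix.isUnit_iff_isUnit_det _).1 hA
  have e : (fun B : Matrix (Fin n) (Fin n) ℂ => B.det) =
      fun B => A.det * (ContinuousLinearMap.mul ℂ (Matrix (Fin n) (Fin n) ℂ) A⁻¹ B).det := by
    ext1 B
    simp only [ContinuousLinearMap.mul_apply']
    rw [← det_mul, ← Matrix.mul_assoc, Matrix.mul_nonsing_inv _ hA', Matrix.one_mul]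
  have hd : DifferentiableAt ℂ (fun A : Matrix (Fin n) (Fin n) ℂ => A.det)
      (ContinuousLinearMap.mul ℂ (Matrix (Fin n) (Fin n) ℂ) A⁻¹ A) :=
    (contDiff_det (n := n) (k := 1)).differentiable (by norm_num) _
  have h1 := hd.hasFDerivAt.comp A
    (ContinuousLinearMap.mul ℂ (Matrix (Fin n) (Fin n) ℂ) A⁻¹).hasFDerivAt
  have h2 := (h1.const_mul A.det).fderiv
  have h3 : (ContinuousLinearMap.mul ℂ (Matrix (Fin n) (Fin n) ℂ) A⁻¹) A = 1 := by
    simp only [ContinuousLinearMap.mul_apply']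
    exact Matrix.nonsing_inv_mul _ hA'
  conv_lhs => rw [e]
  simp only [Function.comp_def] at h2
  rw [h2, h3]
  simp only [_root_.smul_apply, ContinuousLinearMap.comp_apply, fderiv_det_one, smul_eq_mul,
    ContinuousLinearMap.mul_apply']

theorem wd_holomorphic_comp {W W' : Type*} [NormedAddCommGroup W] [NormedSpace ℝ W]
    [NormedSpace ℂ W] [IsScalarTower ℝ ℂ W] [NormedAddCommGroup W'] [NormedSpace ℝ W']
    [NormedSpace ℂ W'] [IsScalarTower ℝ ℂ W'] {g : W → W'} {f : E → W} {z : E}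
    (hg : DifferentiableAt ℂ g (f z)) (hf : DifferentiableAt ℝ f z) (v : E) :
    wd v (fun y => g (f y)) z = fderiv ℂ g (f z) (wd v f z) := by
  have h : fderiv ℝ (fun y => g (f y)) z = (fderiv ℝ g (f z)).comp (fderiv ℝ f z) :=
    fderiv_comp z (hg.restrictScalars ℝ) hf
  simp only [wd, h, ContinuousLinearMap.comp_apply, fderiv_real_eq hg, map_smul, map_sub]

theorem wdb_holomorphic_comp {W W' : Type*} [NormedAddCommGroup W] [NormedSpace ℝ W]
    [NormedSpace ℂ W] [IsScalarTower ℝ ℂ W] [NormedAddCommGroup W'] [NormedSpace ℝ W']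
    [NormedSpace ℂ W'] [IsScalarTower ℝ ℂ W'] {g : W → W'} {f : E → W} {z : E}
    (hg : DifferentiableAt ℂ g (f z)) (hf : DifferentiableAt ℝ f z) (v : E) :
    wdb v (fun y => g (f y)) z = fderiv ℂ g (f z) (wdb v f z) := by
  have h : fderiv ℝ (fun y => g (f y)) z = (fderiv ℝ g (f z)).comp (fderiv ℝ f z) :=
    fderiv_comp z (hg.restrictScalars ℝ) hf
  simp only [wdb, h, ContinuousLinearMap.comp_apply, fderiv_real_eq hg, map_smul, map_add]

/-- The logarithm of the determinant, as a complex-valued function. -/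
noncomputable def logDet (A : Matrix (Fin n) (Fin n) ℂ) : ℂ := (Real.log A.det.re : ℝ)

/-- On positive definite matrices the determinant is real and positive, so `logDet` agrees with a
function holomorphic in the matrix. The chain rule for holomorphic outer functions then computes its
Wirtinger derivatives. -/
theorem logDet_eq {A : Matrix (Fin n) (Fin n) ℂ} (hA : A.PosDef) : logDet A = Complex.log A.det := by
  rw [logDet, Complex.ofReal_log (det_re_pos hA).le, ← det_eq_re hA]

theorem det_mem_slitPlane {A : Matrix (Fin n) (Fin n) ℂ} (hA : A.PosDef) :
    A.det ∈ Complex.slitPlane := by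
  left; exact det_re_pos hA

theorem fderiv_log_det {A : Matrix (Fin n) (Fin n) ℂ} (hA : A.PosDef)
    (M : Matrix (Fin n) (Fin n) ℂ) :
    DifferentiableAt ℂ (fun A : Matrix (Fin n) (Fin n) ℂ => Complex.log A.det) A ∧
    fderiv ℂ (fun A : Matrix (Fin n) (Fin n) ℂ => Complex.log A.det) A M = (A⁻¹ * M).trace := by
  have hd : DifferentiableAt ℂ (fun A : Matrix (Fin n) (Fin n) ℂ => A.det) A :=
    (contDiff_det (n := n) (k := 1)).differentiable (by norm_num) A
  have h := hd.hasFDerivAt.clog (det_mem_slitPlane hA)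
  refine ⟨h.differentiableAt, ?_⟩
  rw [h.fderiv]
  simp only [_root_.smul_apply, fderiv_det hA.isUnit, smul_eq_mul]
  rw [← mul_assoc, inv_mul_cancel₀ (Complex.slitPlane_ne_zero (det_mem_slitPlane hA)), one_mul]

theorem contDiffAt_logDet {k : WithTop ℕ∞} {γ : E → Matrix (Fin n) (Fin n) ℂ} {z : E}
    (h : ContDiffAt ℝ k γ z) (hp : ∀ᶠ y in 𝓝 z, (γ y).PosDef) :
    ContDiffAt ℝ k (fun y => logDet (γ y)) z := by
  have e : (fun y => logDet (γ y)) =ᶠ[𝓝 z] fun y => Complex.log (γ y).det := by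
    filter_upwards [hp] with y hy using logDet_eq hy
  refine ContDiffAt.congr_of_eventuallyEq ?_ e
  have h1 : ContDiffAt ℂ k (fun A : Matrix (Fin n) (Fin n) ℂ => Complex.log A.det) (γ z) :=
    (Complex.contDiffAt_log (det_mem_slitPlane hp.self_of_nhds)).comp (γ z) contDiff_det.contDiffAt
  exact (h1.restrict_scalars ℝ).comp z h

theorem wd_wdb_logDet {γ : E → Matrix (Fin n) (Fin n) ℂ} {z : E}
    (h : ContDiffAt ℝ 2 γ z) (hp : ∀ᶠ y in 𝓝 z, (γ y).PosDef) (v w : E) :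
    wd v (wdb w (fun y => logDet (γ y))) z =
      ((γ z)⁻¹ * wd v (wdb w γ) z - (γ z)⁻¹ * wd v γ z * (γ z)⁻¹ * wdb w γ z).trace := by
  have e : wdb w (fun y => logDet (γ y)) =ᶠ[𝓝 z] fun y => ((γ y)⁻¹ * wdb w γ y).trace := by
    filter_upwards [hp.eventually_nhds, h.eventually (by simp)] with y hy hy'
    have e' : (fun y => logDet (γ y)) =ᶠ[𝓝 y] fun y => Complex.log (γ y).det := by
      filter_upwards [hy] with y hy using logDet_eq hy
    rw [wdb_congr e']
    have := wdb_holomorphic_comp (fderiv_log_det hy.self_of_nhds 0).1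
      (hy'.differentiableAt (by norm_num)) w
    rw [this, (fderiv_log_det hy.self_of_nhds _).2]
  have hu := hp.self_of_nhds.isUnit
  have h1 : ContDiffAt ℝ 1 γ z := h.of_le (by norm_num)
  have hi := (contDiffAt_inv h1 hu).differentiableAt (by norm_num)
  have hw := differentiableAt_wdb h w
  rw [wd_congr e, wd_trace (DifferentiableAt.fun_mul hi hw), wd_mul hi hw, wd_inv h1 hu]
  congr 1
  noncomm_ring

end MatrixCalculus

end

section

open Matrix

/-! ### The complex Hessian and its behaviour under holomorphic maps. -/

section Hessian

variable {n : ℕ} {W : Type*}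
  [NormedAddCommGroup W] [NormedSpace ℝ W] [NormedSpace ℂ W] [IsScalarTower ℝ ℂ W]

theorem sum_smul_stdVec (v : Cn n) : ∑ i, v i • stdVec i = v := by
  ext k
  simp [stdVec, Pi.single_apply]

theorem wd_eq_sum (v : Cn n) (f : Cn n → W) (z : Cn n) :
    wd v f z = ∑ i, v i • wd (stdVec i) f z := by
  conv_lhs => rw [← sum_smul_stdVec v]
  simp only [wd_sum_dir, wd_smul_dir]

theorem wdb_eq_sum (v : Cn n) (f : Cn n → W) (z : Cn n) :
    wdb v f z = ∑ i, conj (v i) • wdb (stdVec i) f z := by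
  conv_lhs => rw [← sum_smul_stdVec v]
  simp only [wdb_sum_dir, wdb_smul_dir]

theorem wd_const_smul (c : ℂ) {f : Cn n → W} {z : Cn n} (hf : DifferentiableAt ℝ f z) (v : Cn n) :
    wd v (fun y => c • f y) z = c • wd v f z :=
  wd_clm_comp (c • ContinuousLinearMap.id ℂ W) hf v

theorem wd_wdb_eq_sum {f : Cn n → W} {z : Cn n} (hf : ContDiffAt ℝ 2 f z) (v w : Cn n) :
    wd v (wdb w f) z = ∑ i, ∑ j, (v i * conj (w j)) • wd (stdVec i) (wdb (stdVec j) f) z := by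
  have e : wdb w f = fun y => ∑ j, conj (w j) • wdb (stdVec j) f y := by
    ext1 y; exact wdb_eq_sum w f y
  have hd : ∀ j, DifferentiableAt ℝ (wdb (stdVec j) f) z := fun j => differentiableAt_wdb hf _
  rw [wd_eq_sum]
  refine Finset.sum_congr rfl fun i _ => ?_
  have hd' : ∀ j, DifferentiableAt ℝ (fun y => conj (w j) • wdb (stdVec j) f y) z := fun j =>
    differentiableAt_clm_comp (conj (w j) • ContinuousLinearMap.id ℂ W) (hd j)
  rw [e, wd_sum _ (fun j _ => hd' j), Finset.smul_sum]
  refine Finset.sum_congr rfl fun j _ => ?_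
  rw [wd_const_smul _ (hd j), smul_smul]

/-- The complex Hessian matrix `∂²F / ∂z^i ∂z̄^j`. -/
noncomputable def hess (F : Cn n → ℂ) (z : Cn n) : Matrix (Fin n) (Fin n) ℂ :=
  Matrix.of fun i j => wd (stdVec i) (wdb (stdVec j) F) z

theorem hess_apply (F : Cn n → ℂ) (z : Cn n) (i j : Fin n) :
    hess F z i j = wd (stdVec i) (wdb (stdVec j) F) z := rfl

theorem sesq_hess {F : Cn n → ℂ} {z : Cn n} (hF : ContDiffAt ℝ 2 F z) (v w : Cn n) :
    sesq (hess F z) v w = wd v (wdb w F) z := by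
  rw [wd_wdb_eq_sum hF, sesq]
  refine Finset.sum_congr rfl fun i _ => Finset.sum_congr rfl fun j _ => ?_
  rw [hess_apply, smul_eq_mul]; ring

theorem hess_congr {F F' : Cn n → ℂ} {z : Cn n} (h : F =ᶠ[𝓝 z] F') : hess F z = hess F' z := by
  ext i j
  exact wd_congr (wdb_eventuallyEq h _) _

theorem wd_wdb_add {E : Type*} [NormedAddCommGroup E] [NormedSpace ℝ E] [NormedSpace ℂ E]
    [IsScalarTower ℝ ℂ E] {f g : E → W} {z : E} (hf : ContDiffAt ℝ 2 f z)
    (hg : ContDiffAt ℝ 2 g z) (v w : E) :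
    wd v (wdb w (fun y => f y + g y)) z = wd v (wdb w f) z + wd v (wdb w g) z := by
  have e : wdb w (fun y => f y + g y) =ᶠ[𝓝 z] fun y => wdb w f y + wdb w g y := by
    filter_upwards [hf.eventually (by simp), hg.eventually (by simp)] with y h1 h2
    exact wdb_add (h1.differentiableAt (by norm_num)) (h2.differentiableAt (by norm_num)) w
  rw [wd_congr e, wd_add (differentiableAt_wdb hf w) (differentiableAt_wdb hg w)]

theorem wd_wdb_clm_comp {E W' : Type*} [NormedAddCommGroup E] [NormedSpace ℝ E] [NormedSpace ℂ E]
    [IsScalarTower ℝ ℂ E] [NormedAddCommGroup W'] [NormedSpace ℝ W'] [NormedSpace ℂ W']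
    [IsScalarTower ℝ ℂ W'] (L : W →L[ℂ] W') {f : E → W} {z : E} (hf : ContDiffAt ℝ 2 f z)
    (v w : E) : wd v (wdb w (fun y => L (f y))) z = L (wd v (wdb w f) z) := by
  have e : wdb w (fun y => L (f y)) =ᶠ[𝓝 z] fun y => L (wdb w f y) := by
    filter_upwards [hf.eventually (by simp)] with y h1
    exact wdb_clm_comp L (h1.differentiableAt (by norm_num)) w
  rw [wd_congr e, wd_clm_comp L (differentiableAt_wdb hf w)]

theorem wd_wdb_neg {E : Type*} [NormedAddCommGroup E] [NormedSpace ℝ E] [NormedSpace ℂ E]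
    [IsScalarTower ℝ ℂ E] (f : E → W) (z : E) (v w : E) :
    wd v (wdb w (fun y => - f y)) z = - wd v (wdb w f) z := by
  have e : wdb w (fun y => - f y) = fun y => - wdb w f y := by
    ext1 y; exact wdb_neg f y w
  rw [e, wd_neg]

theorem wd_wdb_sum {E ι : Type*} [NormedAddCommGroup E] [NormedSpace ℝ E] [NormedSpace ℂ E]
    [IsScalarTower ℝ ℂ E] (s : Finset ι) {f : ι → E → W} {z : E}
    (hf : ∀ i ∈ s, ContDiffAt ℝ 2 (f i) z) (v w : E) :
    wd v (wdb w (fun y => ∑ i ∈ s, f i y)) z = ∑ i ∈ s, wd v (wdb w (f i)) z := by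
  classical
  induction s using Finset.induction_on with
  | empty =>
    have e : wdb w (fun _ : E => (0 : W)) = fun _ => 0 := by ext1 y; exact wdb_const w 0 y
    simp only [Finset.sum_empty, e, wd_const]
  | insert a s ha ih =>
    have h1 := hf a (Finset.mem_insert_self _ _)
    have h2 : ∀ i ∈ s, ContDiffAt ℝ 2 (f i) z := fun i hi => hf i (Finset.mem_insert_of_mem hi)
    simp only [Finset.sum_insert ha]
    rw [wd_wdb_add h1 (ContDiffAt.sum h2), ih h2]

theorem hess_add {F F' : Cn n → ℂ} {z : Cn n} (hF : ContDiffAt ℝ 2 F z)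
    (hF' : ContDiffAt ℝ 2 F' z) : hess (fun y => F y + F' y) z = hess F z + hess F' z := by
  ext i j
  exact wd_wdb_add hF hF' _ _

theorem hess_sub {F F' : Cn n → ℂ} {z : Cn n} (hF : ContDiffAt ℝ 2 F z)
    (hF' : ContDiffAt ℝ 2 F' z) : hess (fun y => F y - F' y) z = hess F z - hess F' z := by
  simp only [sub_eq_add_neg]
  rw [hess_add hF hF'.neg]
  congr 1
  ext i j
  exact wd_wdb_neg _ _ _ _

theorem hess_sum {ι : Type*} (s : Finset ι) {F : ι → Cn n → ℂ} {z : Cn n}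
    (hF : ∀ i ∈ s, ContDiffAt ℝ 2 (F i) z) :
    hess (fun y => ∑ i ∈ s, F i y) z = ∑ i ∈ s, hess (F i) z := by
  ext i j
  rw [Matrix.sum_apply]
  exact wd_wdb_sum s hF _ _

theorem hess_const_mul (c : ℂ) {F : Cn n → ℂ} {z : Cn n} (hF : ContDiffAt ℝ 2 F z) :
    hess (fun y => c * F y) z = c • hess F z := by
  ext i j
  exact wd_wdb_clm_comp (c • ContinuousLinearMap.id ℂ ℂ) hF _ _

theorem contDiffAt_ofReal {E : Type*} [NormedAddCommGroup E] [NormedSpace ℝ E] {k : WithTop ℕ∞}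
    {f : E → ℝ} {z : E} (hf : ContDiffAt ℝ k f z) : ContDiffAt ℝ k (fun y => (f y : ℂ)) z :=
  Complex.ofRealCLM.contDiff.contDiffAt.comp z hf

theorem conj_wd_wdb_ofReal {E : Type*} [NormedAddCommGroup E] [NormedSpace ℝ E] [NormedSpace ℂ E]
    [IsScalarTower ℝ ℂ E] {f : E → ℝ} {z : E} (hf : ContDiffAt ℝ 2 f z) (v w : E) :
    conj (wd v (wdb w fun y => (f y : ℂ)) z) = wd w (wdb v fun y => (f y : ℂ)) z := by
  have h1 : (fun y => star ((f y : ℂ))) = fun y => (f y : ℂ) := by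
    ext1 y; simp
  have h2 : wd w (fun y => (f y : ℂ)) = fun y => star (wdb w (fun y => (f y : ℂ)) y) := by
    ext1 y; conv_lhs => rw [← h1]
    exact wd_star _ _ _
  rw [wd_wdb_comm (contDiffAt_ofReal hf) w v, h2, wdb_star]
  rfl

theorem conj_wd_ofReal {E : Type*} [NormedAddCommGroup E] [NormedSpace ℝ E] [NormedSpace ℂ E]
    [IsScalarTower ℝ ℂ E] (f : E → ℝ) (z : E) (v : E) :
    conj (wd v (fun y => (f y : ℂ)) z) = wdb v (fun y => (f y : ℂ)) z := by
  have h1 : (fun y => star ((f y : ℂ))) = fun y => (f y : ℂ) := by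
    ext1 y; simp
  conv_rhs => rw [← h1]
  exact (wdb_star _ _ _).symm

theorem hess_isHermitian {f : Cn n → ℝ} {z : Cn n} (hf : ContDiffAt ℝ 2 f z) :
    (hess (fun y => (f y : ℂ)) z).IsHermitian := by
  ext i j
  rw [conjTranspose_apply, hess_apply, hess_apply]
  exact conj_wd_wdb_ofReal hf _ _

theorem continuousAt_hess {F : Cn n → ℂ} {z : Cn n} (hF : ContDiffAt ℝ 2 F z) :
    ContinuousAt (hess F) z := by
  have : ∀ i j, ContDiffAt ℝ 0 (fun y => hess F y i j) z := fun i j =>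
    contDiffAt_wd (contDiffAt_wdb (m := 1) hF (by norm_num) _) (by norm_num) _
  exact (contDiffAt_of_entries this).continuousAt

/-- The second derivatives of Φ do not contribute: ∂̄_w brings out conjugated components of Φ', and
these are annihilated by ∂_v. -/
theorem wd_wdb_comp_holomorphic {E : Type*} [NormedAddCommGroup E] [NormedSpace ℝ E]
    [NormedSpace ℂ E] [IsScalarTower ℝ ℂ E] {Φ : E → Cn n} {f : Cn n → W} {z : E}
    (hf : ContDiffAt ℝ 2 f (Φ z)) (hΦ : ContDiffAt ℂ 2 Φ z) (v w : E) :
    wd v (wdb w fun y => f (Φ y)) z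
      = wd (fderiv ℂ Φ z v) (wdb (fderiv ℂ Φ z w) f) (Φ z) := by
  have hΦc : ContinuousAt Φ z := hΦ.continuousAt
  have hΦd : DifferentiableAt ℂ Φ z := hΦ.differentiableAt (by norm_num)
  have hw : DifferentiableAt ℂ (fun y => fderiv ℂ Φ y w) z :=
    ((hΦ.fderiv_right (m := 1) (by norm_num)).clm_apply contDiffAt_const).differentiableAt
      (by norm_num)
  have hwj : ∀ j, DifferentiableAt ℂ (fun y => (fderiv ℂ Φ y w) j) z := fun j =>
    (EuclideanSpace.proj (𝕜 := ℂ) j).differentiableAt.comp z hw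
  have hwr : ∀ j, DifferentiableAt ℝ (fun y => star ((fderiv ℂ Φ y w) j)) z := fun j =>
    ((hwj j).restrictScalars ℝ).star
  have e : wdb w (fun y => f (Φ y)) =ᶠ[𝓝 z]
      fun y => ∑ j, star ((fderiv ℂ Φ y w) j) • wdb (stdVec j) f (Φ y) := by
    filter_upwards [hΦ.eventually (by simp), hΦc.eventually (hf.eventually (by simp))] with y h1 h2
    rw [wdb_comp_holomorphic (h2.differentiableAt (by norm_num))
      (h1.differentiableAt (by norm_num)), wdb_eq_sum]
    rfl
  have hd : ∀ j, DifferentiableAt ℝ (wdb (stdVec j) f) (Φ z) := fun j => differentiableAt_wdb hf _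
  have hdc : ∀ j, DifferentiableAt ℝ (fun y => wdb (stdVec j) f (Φ y)) z := fun j =>
    (hd j).comp z (hΦd.restrictScalars ℝ)
  have e2 : wdb (fderiv ℂ Φ z w) f = fun y => ∑ j, conj (fderiv ℂ Φ z w j) • wdb (stdVec j) f y := by
    ext1 y; exact wdb_eq_sum _ f y
  have hd' : ∀ j, DifferentiableAt ℝ (fun y => conj (fderiv ℂ Φ z w j) • wdb (stdVec j) f y)
      (Φ z) := fun j =>
    differentiableAt_clm_comp (conj (fderiv ℂ Φ z w j) • ContinuousLinearMap.id ℂ W) (hd j)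
  rw [wd_congr e, wd_sum _ (fun j _ => (hwr j).fun_smul (hdc j)), e2,
    wd_sum _ (fun j _ => hd' j)]
  refine Finset.sum_congr rfl fun j _ => ?_
  rw [wd_smul (hwr j) (hdc j), wd_star, wdb_of_holomorphic (hwj j), star_zero, zero_smul, zero_add,
    wd_comp_holomorphic (hd j) hΦd, wd_const_smul _ (hd j)]
  rfl

/-- The Hessian of a composition with a holomorphic map, in terms of its Jacobian matrix (row `i` is
`∂_i Φ`). -/
theorem hess_comp_holomorphic {Φ : Cn n → Cn n} {f : Cn n → ℂ} {z : Cn n}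
    (hf : ContDiffAt ℝ 2 f (Φ z)) (hΦ : ContDiffAt ℂ 2 Φ z) :
    hess (fun y => f (Φ y)) z = (Matrix.of fun i k => fderiv ℂ Φ z (stdVec i) k) * hess f (Φ z)
      * (Matrix.of fun i k => fderiv ℂ Φ z (stdVec i) k)ᴴ := by
  ext i j
  rw [mul_mul_conjTranspose_apply]
  exact (wd_wdb_comp_holomorphic hf hΦ _ _).trans (sesq_hess hf _ _).symm

end Hessian

/-! ### Consequences of closedness of the Kähler form. -/

section Closed

variable {n : ℕ}

/-- The coefficient matrix of a Kähler form on an open subset of `ℂⁿ`. -/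
structure LocalKahler (γ : Cn n → Matrix (Fin n) (Fin n) ℂ) (U : Set (Cn n)) : Prop where
  isOpen : IsOpen U
  smooth : ∀ z ∈ U, ContDiffAt ℝ ∞ γ z
  posDef : ∀ z ∈ U, (γ z).PosDef
  closed : ∀ z ∈ U, ∀ i j k, wd (stdVec k) γ z i j = wd (stdVec i) γ z k j

variable {γ : Cn n → Matrix (Fin n) (Fin n) ℂ} {U : Set (Cn n)} {z : Cn n}

theorem LocalKahler.contDiffAt (h : LocalKahler γ U) (hz : z ∈ U) (k : ℕ) :
    ContDiffAt ℝ k γ z := (h.smooth z hz).of_le (by exact_mod_cast le_top)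

theorem LocalKahler.conjTranspose_wd (h : LocalKahler γ U) (hz : z ∈ U) (v : Cn n) :
    (wd v γ z)ᴴ = wdb v γ z := by
  have e : (fun y => star (γ y)) =ᶠ[𝓝 z] γ := by
    filter_upwards [h.isOpen.mem_nhds hz] with y hy using (h.posDef y hy).1
  rw [← wdb_congr e, wdb_star]; rfl

theorem LocalKahler.closed_bar (h : LocalKahler γ U) (hz : z ∈ U) (i j k : Fin n) :
    wdb (stdVec k) γ z i j = wdb (stdVec j) γ z i k := by
  rw [← h.conjTranspose_wd hz, ← h.conjTranspose_wd hz, conjTranspose_apply, conjTranspose_apply,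
    h.closed z hz]

theorem wd_matrix_apply (v : Cn n) (i j : Fin n) :
    wd v γ z i j = ∑ k, v k * wd (stdVec k) γ z i j := by
  rw [wd_eq_sum, Matrix.sum_apply]; rfl

theorem wdb_matrix_apply (v : Cn n) (i j : Fin n) :
    wdb v γ z i j = ∑ k, conj (v k) * wdb (stdVec k) γ z i j := by
  rw [wdb_eq_sum, Matrix.sum_apply]; rfl

theorem LocalKahler.sesq_wd (h : LocalKahler γ U) (hz : z ∈ U) (v x y : Cn n) :
    sesq (wd v γ z) x y = sesq (wd x γ z) v y := by
  have e : ∀ u i j, wd u γ z i j = ∑ k, u k * wd (stdVec k) γ z i j := fun u i j =>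
    wd_matrix_apply u i j
  simp only [sesq, e v, e x, Finset.sum_mul]
  rw [Finset.sum_congr rfl fun i _ => Finset.sum_comm, Finset.sum_comm]
  refine Finset.sum_congr rfl fun k _ => ?_
  rw [Finset.sum_comm]
  refine Finset.sum_congr rfl fun j _ => Finset.sum_congr rfl fun i _ => ?_
  rw [h.closed z hz]; ring

theorem LocalKahler.sesq_wdb (h : LocalKahler γ U) (hz : z ∈ U) (w x y : Cn n) :
    sesq (wdb w γ z) x y = sesq (wdb y γ z) x w := by
  have e : ∀ u i j, wdb u γ z i j = ∑ k, conj (u k) * wdb (stdVec k) γ z i j := fun u i j =>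
    wdb_matrix_apply u i j
  simp only [sesq, e w, e y, Finset.sum_mul]
  refine Finset.sum_congr rfl fun i _ => ?_
  rw [Finset.sum_comm]
  refine Finset.sum_congr rfl fun j _ => Finset.sum_congr rfl fun k _ => ?_
  rw [h.closed_bar hz]; ring

theorem LocalKahler.wd_wdb_symm (h : LocalKahler γ U) (hz : z ∈ U) (i j k l : Fin n) :
    wd (stdVec i) (wdb (stdVec j) γ) z k l = wd (stdVec k) (wdb (stdVec l) γ) z i j := by
  have h2 := h.contDiffAt hz 2
  have hU := h.isOpen.mem_nhds hz
  have e1 : (fun y => wdb (stdVec j) γ y k l) =ᶠ[𝓝 z] fun y => wdb (stdVec l) γ y k j := by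
    filter_upwards [hU] with y hy using h.closed_bar hy _ _ _
  have e2 : (fun y => wd (stdVec i) γ y k j) =ᶠ[𝓝 z] fun y => wd (stdVec k) γ y i j := by
    filter_upwards [hU] with y hy using h.closed y hy _ _ _
  rw [← wd_entry (differentiableAt_wdb h2 _), wd_congr e1, wd_entry (differentiableAt_wdb h2 _),
    wd_wdb_comm h2, ← wdb_entry (differentiableAt_wd h2 _), wdb_congr e2,
    wdb_entry (differentiableAt_wd h2 _), wd_wdb_comm h2]

/-- Were γ = ∂∂̄u, both sides would be the same fourth derivative of u. Here the symmetry comes from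
the first-order closedness relations and commuting Wirtinger derivatives. It underlies both the
symmetry of the curvature and `LocalKahler.wd_wdb_shift`. -/
theorem LocalKahler.sesq_wd_wdb (h : LocalKahler γ U) (hz : z ∈ U) (v w x y : Cn n) :
    sesq (wd v (wdb w γ) z) x y = sesq (wd x (wdb y γ) z) v w := by
  have h2 := h.contDiffAt hz 2
  simp only [sesq, wd_wdb_eq_sum h2 v w, wd_wdb_eq_sum h2 x y, Matrix.sum_apply, Matrix.smul_apply, smul_eq_mul,
    Finset.sum_mul]
  have swap : ∀ (a : Fin n → Fin n → Fin n → Fin n → ℂ),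
      ∑ i, ∑ j, ∑ k, ∑ l, a i j k l = ∑ k, ∑ l, ∑ i, ∑ j, a i j k l := by
    intro a
    rw [Finset.sum_congr rfl fun i _ => Finset.sum_comm]
    rw [Finset.sum_comm]
    refine Finset.sum_congr rfl fun k _ => ?_
    rw [Finset.sum_congr rfl fun i _ => Finset.sum_comm]
    rw [Finset.sum_comm]
  rw [swap]
  refine Finset.sum_congr rfl fun i _ => Finset.sum_congr rfl fun j _ =>
    Finset.sum_congr rfl fun k _ => Finset.sum_congr rfl fun l _ => ?_
  rw [h.wd_wdb_symm hz]; ring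

end Closed

end

section

open Matrix

/-! ### Four-point quotients along complex lines, with parameters. -/

section FourPointOfLine

variable {E V V' : Type*} [NormedAddCommGroup E] [NormedSpace ℝ E] [NormedSpace ℂ E]
  [IsScalarTower ℝ ℂ E] [NormedAddCommGroup V] [NormedSpace ℝ V]
  [NormedAddCommGroup V'] [NormedSpace ℝ V']

theorem fourPoint_line (F : E → V) (h : ℝ) (z v : E) :
    fourPoint (fun t : ℂ => F (z + t • v)) h 0 1 = fourPoint F h z v := by
  have e1 : ∀ u : ℂ, (h • u) • v = h • (u • v) := fun u => smul_assoc _ _ _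
  simp only [fourPoint, zero_add, zero_sub, neg_smul, e1, one_smul, smul_eq_mul, mul_one, zero_smul,
    add_zero, ← sub_eq_add_neg]

theorem fourPoint_eq_sum (X : ℂ → V) (h : ℝ) : fourPoint X h 0 1 =
    (4⁻¹ * (h ^ 2)⁻¹) • ∑ k : Fin 4, (X (h * Complex.I ^ (k : ℕ)) - X 0) := by
  have e3 : Complex.I ^ 3 = -Complex.I := by
    rw [pow_succ, Complex.I_sq]; ring
  simp only [fourPoint, Fin.sum_univ_four, zero_add, zero_sub, Complex.real_smul, smul_eq_mul,
    mul_one, Fin.isValue, pow_zero, pow_one, Complex.I_sq,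
    mul_neg, Fin.coe_ofNat_eq_mod, Nat.reduceMod, e3]
  module

theorem fourPoint_add (X Y : ℂ → V) (h : ℝ) :
    fourPoint (fun t => X t + Y t) h 0 1 = fourPoint X h 0 1 + fourPoint Y h 0 1 := by
  simp only [fourPoint]; module

variable {W : Type*} [NormedAddCommGroup W] [NormedSpace ℝ W] [NormedSpace ℂ W]
  [IsScalarTower ℝ ℂ W]

/-- View the quotient in t as a quotient of Ψ on the product in the fixed direction (1, 0), whose
base point (0, z) may move. -/
theorem tendsto_fourPoint_param {ι : Type*} {l : Filter ι} {Ψ : ℂ × E → W} {p : E}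
    (hΨ : ContDiffAt ℝ 2 Ψ (0, p)) {h : ι → ℝ} {z : ι → E} (hh : Tendsto h l (𝓝 0))
    (hh0 : ∀ᶠ i in l, h i ≠ 0) (hz : Tendsto z l (𝓝 p)) :
    Tendsto (fun i => fourPoint (fun t => Ψ (t, z i)) (h i) 0 1) l
      (𝓝 (wd 1 (wdb 1 fun t => Ψ (t, p)) 0)) := by
  have T := tendsto_fourPoint (v₀ := ((1 : ℂ), (0 : E))) hΨ hh hh0
    (tendsto_const_nhds.prodMk_nhds hz) (tendsto_const_nhds (x := ((1 : ℂ), (0 : E))))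
  have hι : ∀ t : ℂ, HasFDerivAt (fun t : ℂ => (t, p)) (ContinuousLinearMap.inl ℂ ℂ E) t :=
    fun t => (hasFDerivAt_prodMk_left t p)
  have e : wd 1 (wdb 1 fun t => Ψ (t, p)) 0 = wd ((1 : ℂ), (0 : E)) (wdb ((1 : ℂ), (0 : E)) Ψ) (0, p) := by
    have c : ContinuousAt (fun t : ℂ => (t, p)) 0 := (hι 0).continuousAt
    have e1 : wdb 1 (fun t => Ψ (t, p)) =ᶠ[𝓝 0] fun t => wdb ((1 : ℂ), (0 : E)) Ψ (t, p) := by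
      filter_upwards [c.eventually (hΨ.eventually (by simp))] with t ht
      rw [wdb_comp_holomorphic (Φ := fun t : ℂ => (t, p)) (ht.differentiableAt (by norm_num))
        (hι t).differentiableAt, (hι t).fderiv]
      simp
    rw [wd_congr e1, wd_comp_holomorphic (Φ := fun t : ℂ => (t, p)) (differentiableAt_wdb hΨ _)
        (hι 0).differentiableAt, (hι 0).fderiv]
    simp
  rw [e]
  refine T.congr fun i => ?_
  simp [fourPoint]

end FourPointOfLine

/-! ### Holomorphic affine shifts z + tξ(z) and the discretized Monge–Ampère equation. -/

section Shift

variable {n : ℕ}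

/-- The linear map of `ℂⁿ` sending `e_i` to the `i`-th row of `B`. -/
noncomputable def rowMap (B : Matrix (Fin n) (Fin n) ℂ) : Cn n →L[ℂ] Cn n :=
  ∑ i, (EuclideanSpace.proj (𝕜 := ℂ) i).smulRight (WithLp.toLp 2 (B i))

theorem rowMap_apply (B : Matrix (Fin n) (Fin n) ℂ) (z : Cn n) (k : Fin n) :
    rowMap B z k = ∑ i, z i * B i k := by
  simp [rowMap, Finset.sum_apply]

/-- The affine holomorphic vector field `a + (z - p) B`. -/
noncomputable def affField (a : Cn n) (B : Matrix (Fin n) (Fin n) ℂ) (p z : Cn n) : Cn n :=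
  a + rowMap B (z - p)

theorem contDiff_affField (a : Cn n) (B : Matrix (Fin n) (Fin n) ℂ) (p : Cn n)
    {k : WithTop ℕ∞} : ContDiff ℂ k (affField a B p) :=
  contDiff_const.add ((rowMap B).contDiff.comp (contDiff_id.sub contDiff_const))

theorem affField_self (a : Cn n) (B : Matrix (Fin n) (Fin n) ℂ) (p : Cn n) :
    affField a B p p = a := by simp [affField]

theorem hasFDerivAt_affField (a : Cn n) (B : Matrix (Fin n) (Fin n) ℂ) (p z : Cn n) :
    HasFDerivAt (affField a B p) (rowMap B) z := by
  have h1 : HasFDerivAt (fun y : Cn n => y - p) (ContinuousLinearMap.id ℂ (Cn n)) z :=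
    (hasFDerivAt_id z).sub_const p
  exact ((rowMap B).hasFDerivAt.comp z h1).const_add a

theorem rowMap_stdVec (B : Matrix (Fin n) (Fin n) ℂ) (i k : Fin n) :
    rowMap B (stdVec i) k = B i k := by
  simp [rowMap_apply, stdVec]

theorem hess_shift {F : Cn n → ℂ} (a : Cn n) (B : Matrix (Fin n) (Fin n) ℂ) (p z : Cn n) (t : ℂ)
    (hF : ContDiffAt ℝ 2 F (z + t • affField a B p z)) :
    hess (fun y => F (y + t • affField a B p y)) z
      = (1 + t • B) * hess F (z + t • affField a B p z) * (1 + t • B)ᴴ := by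
  have hd : HasFDerivAt (fun y => y + t • affField a B p y)
      (ContinuousLinearMap.id ℂ (Cn n) + t • rowMap B) z :=
    (hasFDerivAt_id z).add ((hasFDerivAt_affField a B p z).const_smul t)
  have hc : ContDiffAt ℂ 2 (fun y => y + t • affField a B p y) z :=
    contDiffAt_id.add ((contDiff_affField a B p).contDiffAt.const_smul t)
  have e : (Matrix.of fun i k => fderiv ℂ (fun y => y + t • affField a B p y) z (stdVec i) k)
      = 1 + t • B := by
    ext i k
    rw [hd.fderiv]
    have h1 : (stdVec i : Cn n) k = (1 : Matrix (Fin n) (Fin n) ℂ) i k := by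
      simp [Matrix.one_apply, stdVec, eq_comm]
    have h2 := rowMap_stdVec B i k
    simp [h1, h2]
  rw [hess_comp_holomorphic (Φ := fun y => y + t • affField a B p y) hF hc, e]

/-- The logarithm of the (real part of the) determinant. -/
noncomputable def logDetRe (A : Matrix (Fin n) (Fin n) ℂ) : ℝ := Real.log A.det.re

theorem logDetRe_shift {g g' M : Matrix (Fin n) (Fin n) ℂ} {c : ℝ} (hg : g.PosDef)
    (hM : IsUnit M) (h : g'.det = (Real.exp c : ℂ) * g.det) :
    logDetRe (M * g' * Mᴴ) = c + logDetRe g + logDetRe (M * Mᴴ) := by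
  have hMM : (M * Mᴴ).PosDef := by
    have := (IsUnit.posDef_star_right_conjugate_iff hM (x := 1)).2 PosDef.one
    simpa [star_eq_conjTranspose] using this
  have e : (M * g' * Mᴴ).det = ((Real.exp c * g.det.re * (M * Mᴴ).det.re : ℝ) : ℂ) := by
    push_cast
    rw [← det_eq_re hg, ← det_eq_re hMM, det_mul, det_mul, det_mul, h]
    push_cast; ring
  rw [logDetRe, e, Complex.ofReal_re, Real.log_mul, Real.log_mul, Real.log_exp]
  · rfl
  · exact (Real.exp_pos c).ne'
  · exact (det_re_pos hg).ne'
  · exact (mul_pos (Real.exp_pos c) (det_re_pos hg)).ne'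
  · exact (det_re_pos hMM).ne'

/-- This function is log |det(1 + tB)|², which is harmonic near t = 0. The Jacobian factors
introduced by the shifts therefore disappear in the limit. -/
theorem wd_wdb_logDet_shift (B : Matrix (Fin n) (Fin n) ℂ) :
    ContDiffAt ℝ 2 (fun t : ℂ => logDet ((1 + t • B) * (1 + t • B)ᴴ)) 0 ∧
    wd 1 (wdb 1 fun t : ℂ => logDet ((1 + t • B) * (1 + t • B)ᴴ)) 0 = 0 := by
  have hM : ∀ t, HasFDerivAt (fun t : ℂ => 1 + t • B)
      ((ContinuousLinearMap.id ℂ ℂ).smulRight B) t := fun t => by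
    simpa using ((hasFDerivAt_id t).smul_const B).const_add (1 : Matrix (Fin n) (Fin n) ℂ)
  have hMd : ∀ t, DifferentiableAt ℝ (fun t : ℂ => 1 + t • B) t := fun t =>
    (hM t).differentiableAt.restrictScalars ℝ
  have hMw : ∀ t, wd 1 (fun t : ℂ => 1 + t • B) t = B := fun t => by
    rw [wd_of_holomorphic (hM t).differentiableAt, (hM t).fderiv]; simp
  have hMwb : ∀ t, wdb 1 (fun t : ℂ => 1 + t • B) t = 0 := fun t =>
    wdb_of_holomorphic (hM t).differentiableAt _
  have hsd : ∀ t, DifferentiableAt ℝ (fun t : ℂ => star (1 + t • B)) t := fun t => (hMd t).star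
  have hMc : ContDiff ℝ 2 (fun t : ℂ => 1 + t • B) :=
    contDiff_const.add (contDiff_id.smul contDiff_const)
  have hMsc : ContDiff ℝ 2 (fun t : ℂ => star (1 + t • B)) :=
    (starL' ℝ (A := Matrix (Fin n) (Fin n) ℂ)).contDiff.comp hMc
  have hc : ContDiffAt ℝ 2 (fun t : ℂ => (1 + t • B) * (1 + t • B)ᴴ) 0 :=
    (hMc.mul hMsc).contDiffAt
  have hu : ∀ᶠ t : ℂ in 𝓝 0, IsUnit (1 + t • B) :=
    eventually_isUnit hMc.continuous.continuousAt (by simp)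
  have hp : ∀ᶠ t : ℂ in 𝓝 0, ((1 + t • B) * (1 + t • B)ᴴ).PosDef := by
    filter_upwards [hu] with t ht
    have := (IsUnit.posDef_star_right_conjugate_iff ht (x := 1)).2 PosDef.one
    simpa [star_eq_conjTranspose] using this
  refine ⟨contDiffAt_logDet hc hp, ?_⟩
  have ewb : wdb 1 (fun t : ℂ => (1 + t • B) * (1 + t • B)ᴴ) = fun t => (1 + t • B) * Bᴴ := by
    ext1 t
    have := wdb_mul (hMd t) (hsd t) 1
    rw [hMwb, wdb_star, hMw, zero_mul, zero_add] at this
    exact this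
  have ew : wd 1 (fun t : ℂ => (1 + t • B) * (1 + t • B)ᴴ) 0 = B := by
    have := wd_mul (hMd 0) (hsd 0) 1
    rw [wd_star, hMw, hMwb, star_zero, mul_zero, add_zero] at this
    refine this.trans ?_
    simp
  have eww : wd 1 (fun t : ℂ => (1 + t • B) * Bᴴ) 0 = B * Bᴴ := by
    have := wd_mul (hMd 0) (differentiableAt_const Bᴴ) 1
    rw [hMw, wd_const] at this
    simpa using this
  rw [wd_wdb_logDet hc hp, ewb, ew, eww]
  simp

/-- The discrete substitute for differentiating the equation twice. At each shifted point apply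
concavity of log det, based at γ'(z), to the congruent matrix (1 + tB) γ' (1 + tB)ᴴ. The equation
replaces log det γ' by f + log det γ, and averaging over the four points leaves no derivative of γ'.
-/
theorem fourPoint_logDet_le {U : Set (Cn n)} {γ : Cn n → Matrix (Fin n) (Fin n) ℂ}
    (hγ : LocalKahler γ U) {φ f : Cn n → ℝ}
    (hpos : ∀ z ∈ U, (γ z + hess (fun y => (φ y : ℂ)) z).PosDef)
    (hMA : ∀ z ∈ U, (γ z + hess (fun y => (φ y : ℂ)) z).det = (Real.exp (f z) : ℂ) * (γ z).det)
    (v : Cn n) (B : Matrix (Fin n) (Fin n) ℂ) {z : Cn n} (hz : z ∈ U) {h : ℝ}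
    (hT : ∀ k : Fin 4, z + ((h : ℂ) * Complex.I ^ (k : ℕ)) • v ∈ U)
    (hM : ∀ k : Fin 4, IsUnit (1 + ((h : ℂ) * Complex.I ^ (k : ℕ)) • B)) :
    fourPoint (fun y => f y + logDetRe (γ y)) h z v
      + fourPoint (fun t : ℂ => logDetRe ((1 + t • B) * (1 + t • B)ᴴ)) h 0 1
    ≤ (((γ z + hess (fun y => (φ y : ℂ)) z)⁻¹ *
      (fourPoint (fun t : ℂ => (1 + t • B) * γ (z + t • v) * (1 + t • B)ᴴ) h 0 1
      + fourPoint (fun t : ℂ => (1 + t • B) * hess (fun y => (φ y : ℂ)) (z + t • v)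
        * (1 + t • B)ᴴ) h 0 1)).trace).re := by
  set γ' := fun y => γ y + hess (fun y => (φ y : ℂ)) y with hγ'
  have e1 : (fourPoint (fun t : ℂ => (1 + t • B) * γ (z + t • v) * (1 + t • B)ᴴ) h 0 1
      + fourPoint (fun t : ℂ => (1 + t • B) * hess (fun y => (φ y : ℂ)) (z + t • v)
        * (1 + t • B)ᴴ) h 0 1) =
      fourPoint (fun t : ℂ => (1 + t • B) * γ' (z + t • v) * (1 + t • B)ᴴ) h 0 1 := by
    rw [← fourPoint_add]
    congr 1; ext1 t
    rw [hγ']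
    noncomm_ring
  rw [e1, ← fourPoint_line, ← fourPoint_add]
  have hL : ∀ X : ℂ → Matrix (Fin n) (Fin n) ℂ, (((γ' z)⁻¹ * fourPoint X h 0 1).trace).re
      = fourPoint (fun t => (((γ' z)⁻¹ * X t).trace).re) h 0 1 := by
    intro X
    have := fourPoint_clm_comp (Complex.reCLM.comp ((traceL (n := n)).restrictScalars ℝ |>.comp
      ((ContinuousLinearMap.mul ℂ (Matrix (Fin n) (Fin n) ℂ) (γ' z)⁻¹).restrictScalars ℝ)))
      X h 0 1
    exact this.symm
  rw [hL, fourPoint_eq_sum, fourPoint_eq_sum, smul_eq_mul, smul_eq_mul]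
  refine mul_le_mul_of_nonneg_left (Finset.sum_le_sum fun k _ => ?_) (by positivity)
  set t : ℂ := (h : ℂ) * Complex.I ^ (k : ℕ)
  have hG : ((1 + t • B) * γ' (z + t • v) * (1 + t • B)ᴴ).PosDef := by
    rw [← star_eq_conjTranspose]
    exact (IsUnit.posDef_star_right_conjugate_iff (hM k)).2 (hpos _ (hT k))
  have key := log_det_sub_log_det_le (hpos z hz) hG
  have s1 := logDetRe_shift (hγ.posDef _ (hT k)) (hM k) (hMA _ (hT k))
  have s2 := logDetRe_shift (hγ.posDef _ hz) (isUnit_one) (hMA _ hz)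
  -- The equation at the centre point: the trivial shift, with the identity as Jacobian.
  have s3 : logDetRe (γ' z) = f z + logDetRe (γ z) := by
    simpa [logDetRe] using s2
  rw [Matrix.mul_sub, Matrix.trace_sub, Complex.sub_re] at key
  have s0 : logDetRe (((1 : Matrix (Fin n) (Fin n) ℂ) + (0 : ℂ) • B)
      * ((1 : Matrix (Fin n) (Fin n) ℂ) + (0 : ℂ) • B)ᴴ) = 0 := by simp [logDetRe]
  have s4 : (1 + (0 : ℂ) • B) * γ' (z + (0 : ℂ) • v) * (1 + (0 : ℂ) • B)ᴴ = γ' z := by simp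
  rw [s0, s4]
  simp only [zero_smul, add_zero]
  have key' : logDetRe ((1 + t • B) * γ' (z + t • v) * (1 + t • B)ᴴ) - logDetRe (γ' z) ≤ _ := key
  rw [s1, s3] at key'
  have key2 : f (z + t • v) + logDetRe (γ (z + t • v)) + logDetRe ((1 + t • B) * (1 + t • B)ᴴ)
      - (f z + logDetRe (γ z)) ≤ ((γ' z)⁻¹ * ((1 + t • B) * γ' (z + t • v)
        * (1 + t • B)ᴴ)).trace.re - ((γ' z)⁻¹ * γ' z).trace.re := key'
  linarith

end Shift

end

/-! ### Touching from above: the differential inequality in the viscosity sense. -/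

section

open Matrix

/-- Maximum points of locally uniformly convergent perturbations converge to a strict maximum. -/
theorem exists_tendsto_isLocalMax {E : Type*} [NormedAddCommGroup E] [ProperSpace E] {p : E} {R : ℝ}
    (hR : 0 < R) {D : ℝ → E → ℝ} {u Q : E → ℝ}
    (hDc : ∀ᶠ h in 𝓝[>] (0 : ℝ), ContinuousOn (D h) (Metric.closedBall p R))
    (hQc : ContinuousOn Q (Metric.closedBall p R))
    (hD : ∀ (l : Filter ℝ) (z : ℝ → E), ∀ x ∈ Metric.closedBall p R, l ≤ 𝓝[>] 0 →
      Tendsto z l (𝓝 x) → Tendsto (fun h => D h (z h)) l (𝓝 (u x)))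
    (hp : u p = Q p) (hlt : ∀ x ∈ Metric.closedBall p R, x ≠ p → u x < Q x) :
    ∃ (l : Ultrafilter ℝ) (z : ℝ → E), (l : Filter ℝ) ≤ 𝓝[>] 0 ∧ Tendsto z l (𝓝 p) ∧
      ∀ᶠ h in (l : Filter ℝ), IsLocalMax (fun y => D h y - Q y) (z h) := by
  set K := Metric.closedBall p R
  have hK : IsCompact K := isCompact_closedBall p R
  have hpK : p ∈ K := Metric.mem_closedBall_self hR.le
  -- Continuity is made a premise inside the statement, so that a point can be chosen for every h,
  -- with p as a dummy value when `D h` is not continuous.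
  have hex : ∀ h, ∃ z ∈ K, ContinuousOn (D h) K → ∀ y ∈ K, D h y - Q y ≤ D h z - Q z := by
    intro h
    by_cases hc : ContinuousOn (D h) K
    · obtain ⟨z, hz, hmax⟩ := hK.exists_isMaxOn ⟨p, hpK⟩ (hc.sub hQc)
      exact ⟨z, hz, fun _ y hy => hmax hy⟩
    · exact ⟨p, hpK, fun h => absurd h hc⟩
  choose z hzK hzmax using hex
  -- An ultrafilter replaces the extraction of a subsequence: by compactness the maximum points
  -- converge along it.
  set l : Ultrafilter ℝ := Ultrafilter.of (𝓝[>] 0)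
  have hl : (l : Filter ℝ) ≤ 𝓝[>] 0 := Ultrafilter.of_le _
  obtain ⟨x, hxK, hx⟩ := hK.ultrafilter_le_nhds (l.map z)
    (le_principal_iff.2 (Filter.mem_map.2 (Eventually.of_forall hzK)))
  have hzx : Tendsto z l (𝓝 x) := hx
  have hQx : Tendsto (fun h => Q (z h)) l (𝓝 (Q x)) :=
    (hQc x hxK).tendsto.comp (tendsto_nhdsWithin_iff.2 ⟨hzx, Eventually.of_forall hzK⟩)
  have t1 := (hD l z x hxK hl hzx).sub hQx
  have t2 := (hD l (fun _ => p) p hpK hl tendsto_const_nhds).sub_const (Q p)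
  -- The maximum dominates the value at p for each h. In the limit, strictness forces x = p.
  have hle : u p - Q p ≤ u x - Q x := by
    refine le_of_tendsto_of_tendsto t2 t1 ?_
    filter_upwards [hl hDc] with h hh using hzmax h hh p hpK
  have hxp : x = p := by
    by_contra hne
    have := hlt x hxK hne
    linarith
  subst hxp
  refine ⟨l, z, hl, hzx, ?_⟩
  filter_upwards [hl hDc, hzx.eventually (Metric.ball_mem_nhds x hR)] with h hh hb
  filter_upwards [Metric.isOpen_ball.mem_nhds hb] with y hy
  exact hzmax h hh y (Metric.ball_subset_closedBall hy)

variable {n : ℕ}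

section Viscosity

variable {U : Set (Cn n)} {γ : Cn n → Matrix (Fin n) (Fin n) ℂ} {φ f : Cn n → ℝ}

theorem fourPoint_ofReal {E : Type*} [NormedAddCommGroup E] [NormedSpace ℝ E] [NormedSpace ℂ E]
    [IsScalarTower ℝ ℂ E] (F : E → ℝ) (h : ℝ) (z v : E) :
    fourPoint (fun y => (F y : ℂ)) h z v = (fourPoint F h z v : ℝ) :=
  fourPoint_clm_comp Complex.ofRealCLM F h z v

/-- The map y ↦ y + tξ(y) is holomorphic with Jacobian 1 + tB, so the Hessian of each shifted copy
of φ is a congruence of the shifted Hessian. Forming the quotient before the Hessian keeps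
everything within two derivatives of φ. -/
theorem hess_fourPoint {z : Cn n} (hφz : ContDiffAt ℝ 2 φ z) (a p : Cn n)
    (B : Matrix (Fin n) (Fin n) ℂ) {h : ℝ}
    (hφ : ∀ k : Fin 4, ContDiffAt ℝ 2 φ
      (z + ((h : ℂ) * Complex.I ^ (k : ℕ)) • affField a B p z)) :
    ContDiffAt ℝ 2 (fun y => fourPoint φ h y (affField a B p y)) z ∧
    hess (fun y => ((fourPoint φ h y (affField a B p y) : ℝ) : ℂ)) z =
      fourPoint (fun t : ℂ => (1 + t • B) *
        hess (fun y => (φ y : ℂ)) (z + t • affField a B p z) * (1 + t • B)ᴴ) h 0 1 := by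
  have hcomp : ∀ k : Fin 4, ContDiffAt ℝ 2
      (fun y => φ (y + ((h : ℂ) * Complex.I ^ (k : ℕ)) • affField a B p y)) z := fun k => by
    have hc : ContDiffAt ℂ 2 (fun y => y + ((h : ℂ) * Complex.I ^ (k : ℕ)) • affField a B p y) z :=
      contDiffAt_id.add ((contDiff_affField a B p).contDiffAt.const_smul _)
    exact (hφ k).comp z (hc.restrict_scalars ℝ)
  have e1 : (fun y => fourPoint φ h y (affField a B p y)) = fun y =>
      (4⁻¹ * (h ^ 2)⁻¹) * ∑ k : Fin 4,
        (φ (y + ((h : ℂ) * Complex.I ^ (k : ℕ)) • affField a B p y) - φ y) := by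
    ext1 y
    rw [← fourPoint_line, fourPoint_eq_sum, smul_eq_mul]
    simp
  have hs : ∀ k : Fin 4, ContDiffAt ℝ 2
      (fun y => φ (y + ((h : ℂ) * Complex.I ^ (k : ℕ)) • affField a B p y) - φ y) z :=
    fun k => (hcomp k).sub hφz
  constructor
  · rw [e1]
    exact contDiffAt_const.mul (ContDiffAt.sum fun k _ => hs k)
  · have e2 : (fun y => ((fourPoint φ h y (affField a B p y) : ℝ) : ℂ)) = fun y =>
        ((4⁻¹ * (h ^ 2)⁻¹ : ℝ) : ℂ) * ∑ k : Fin 4,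
          ((φ (y + ((h : ℂ) * Complex.I ^ (k : ℕ)) • affField a B p y) : ℂ) - (φ y : ℂ)) := by
      ext1 y
      rw [congrFun e1 y]
      push_cast
      rfl
    have hs' : ∀ k : Fin 4, ContDiffAt ℝ 2 (fun y =>
        ((φ (y + ((h : ℂ) * Complex.I ^ (k : ℕ)) • affField a B p y) : ℂ) - (φ y : ℂ))) z :=
      fun k => (contDiffAt_ofReal (hcomp k)).sub (contDiffAt_ofReal hφz)
    rw [e2, hess_const_mul _ (ContDiffAt.sum fun k _ => hs' k), hess_sum _ (fun k _ => hs' k),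
      fourPoint_eq_sum]
    rw [← algebraMap_smul ℂ (4⁻¹ * (h ^ 2)⁻¹ : ℝ), Complex.coe_algebraMap]
    congr 1
    refine Finset.sum_congr rfl fun k _ => ?_
    rw [hess_sub (contDiffAt_ofReal (hcomp k)) (contDiffAt_ofReal hφz)]
    have := hess_shift (F := fun y => (φ y : ℂ)) a B p z ((h : ℂ) * Complex.I ^ (k : ℕ))
      (contDiffAt_ofReal (hφ k))
    rw [this]
    simp

/-- At the maximum the Hessian of the quotient minus Q is seminegative, so its trace against (γ')⁻¹
is nonpositive. This bounds the φ-part of the right side of `fourPoint_logDet_le` by the Hessian of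
Q and leaves only the shifts of the known metric γ. -/
theorem sum_fourPoint_le (hγ : LocalKahler γ U)
    (hφ : ∀ z ∈ U, ContDiffAt ℝ 2 φ z)
    (hpos : ∀ z ∈ U, (γ z + hess (fun y => (φ y : ℂ)) z).PosDef)
    (hMA : ∀ z ∈ U, (γ z + hess (fun y => (φ y : ℂ)) z).det = (Real.exp (f z) : ℂ) * (γ z).det)
    {p : Cn n} (a : Fin n → Cn n) (B : Fin n → Matrix (Fin n) (Fin n) ℂ) {Q : Cn n → ℝ} {z : Cn n}
    (hz : z ∈ U) (hQ : ContDiffAt ℝ 2 Q z) {h : ℝ}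
    (hT : ∀ α, ∀ k : Fin 4, z + ((h : ℂ) * Complex.I ^ (k : ℕ)) • affField (a α) (B α) p z ∈ U)
    (hM : ∀ α, ∀ k : Fin 4, IsUnit (1 + ((h : ℂ) * Complex.I ^ (k : ℕ)) • B α))
    (hmax : IsLocalMax
      (fun y => (∑ α, fourPoint φ h y (affField (a α) (B α) p y)) - Q y) z) :
    ∑ α, (fourPoint (fun y => f y + logDetRe (γ y)) h z (affField (a α) (B α) p z)
      + fourPoint (fun t : ℂ => logDetRe ((1 + t • B α) * (1 + t • B α)ᴴ)) h 0 1) ≤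
    (((γ z + hess (fun y => (φ y : ℂ)) z)⁻¹ * hess (fun y => (Q y : ℂ)) z).trace).re +
      ∑ α, (((γ z + hess (fun y => (φ y : ℂ)) z)⁻¹ * fourPoint (fun t : ℂ => (1 + t • B α) *
        γ (z + t • affField (a α) (B α) p z) * (1 + t • B α)ᴴ) h 0 1).trace).re := by
  have hD := fun α => hess_fourPoint (hφ z hz) (a α) p (B α) (fun k => hφ _ (hT α k))
  have hDs : ContDiffAt ℝ 2 (fun y => ∑ α, fourPoint φ h y (affField (a α) (B α) p y)) z :=
    ContDiffAt.sum fun α _ => (hD α).1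
  have hDQ := hDs.sub hQ
  have hn : ∀ v, (sesq (hess (fun y => (((∑ α, fourPoint φ h y (affField (a α) (B α) p y)) - Q y
      : ℝ) : ℂ)) z) v v).re ≤ 0 := fun v => by
    have h1 := re_wd_wdb_nonpos_of_isLocalMax hDQ hmax (WithLp.toLp 2 v)
    have h2 := sesq_hess (contDiffAt_ofReal hDQ) (WithLp.toLp 2 v) (WithLp.toLp 2 v)
    simp only at h2
    rw [h2]
    exact h1
  have h3 := re_trace_inv_mul_nonpos (hpos z hz) hn
  have e : hess (fun y => (((∑ α, fourPoint φ h y (affField (a α) (B α) p y)) - Q y : ℝ) : ℂ)) z =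
      ∑ α, fourPoint (fun t : ℂ => (1 + t • B α) * hess (fun y => (φ y : ℂ))
        (z + t • affField (a α) (B α) p z) * (1 + t • B α)ᴴ) h 0 1
        - hess (fun y => (Q y : ℂ)) z := by
    rw [← Finset.sum_congr rfl fun α _ => (hD α).2,
      ← hess_sum _ (fun α _ => contDiffAt_ofReal (hD α).1),
      ← hess_sub (ContDiffAt.sum fun α _ => contDiffAt_ofReal (hD α).1) (contDiffAt_ofReal hQ)]
    congr 1
    ext1 y
    push_cast
    rfl
  rw [e, Matrix.mul_sub, Matrix.trace_sub, Complex.sub_re, Matrix.mul_sum, Matrix.trace_sum,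
    Complex.re_sum] at h3
  have h4 := Finset.sum_le_sum fun α (_ : α ∈ Finset.univ) =>
    fourPoint_logDet_le hγ hpos hMA (affField (a α) (B α) p z) (B α) hz (hT α) (hM α)
  simp only [Matrix.mul_add, Matrix.trace_add, Complex.add_re, Finset.sum_add_distrib] at h4 ⊢
  linarith

end Viscosity

end

section

open Matrix

variable {n : ℕ}

/-! ### Passage to the limit in the step size. -/

section Viscosity

variable {U : Set (Cn n)} {γ : Cn n → Matrix (Fin n) (Fin n) ℂ} {φ f : Cn n → ℝ}

theorem contDiffAt_shiftMatrix {k : WithTop ℕ∞} (a p : Cn n) (B : Matrix (Fin n) (Fin n) ℂ)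
    (hγ : ContDiffAt ℝ k γ p) :
    ContDiffAt ℝ k (fun q : ℂ × Cn n => (1 + q.1 • B) *
      γ (q.2 + q.1 • affField a B p q.2) * (1 + q.1 • B)ᴴ) (0, p) := by
  have h1 : ContDiff ℝ k (fun q : ℂ × Cn n => (1 : Matrix (Fin n) (Fin n) ℂ) + q.1 • B) :=
    contDiff_const.add (contDiff_fst.smul contDiff_const)
  have h2 : ContDiff ℝ k (fun q : ℂ × Cn n => star ((1 : Matrix (Fin n) (Fin n) ℂ) + q.1 • B)) :=
    (starL' ℝ (A := Matrix (Fin n) (Fin n) ℂ)).contDiff.comp h1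
  have h3 : ContDiff ℂ k (fun q : ℂ × Cn n => q.2 + q.1 • affField a B p q.2) :=
    contDiff_snd.add (contDiff_fst.smul ((contDiff_affField a B p).comp contDiff_snd))
  have h3' : ContDiffAt ℝ k (fun q : ℂ × Cn n => q.2 + q.1 • affField a B p q.2) (0, p) :=
    (h3.restrict_scalars ℝ).contDiffAt
  have h4 : ContDiffAt ℝ k (fun q : ℂ × Cn n => γ (q.2 + q.1 • affField a B p q.2)) (0, p) := by
    refine ContDiffAt.comp (0, p) (f := fun q : ℂ × Cn n => q.2 + q.1 • affField a B p q.2) ?_ h3'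
    simpa using hγ
  exact (h1.contDiffAt.mul h4).mul h2.contDiffAt

theorem logDet_eq_logDetRe (A : Matrix (Fin n) (Fin n) ℂ) : logDet A = (logDetRe A : ℝ) := rfl

set_option maxHeartbeats 1000000 in
-- The quotients converge to Σ φ_{ξ_α ξ̄_α} along any converging points, so strict touching by Q at
-- p produces maximum points tending to p. Let h → 0 in `sum_fourPoint_le` there: f, γ and Q are C²
-- near p, while γ' enters only through the continuous factor (γ')⁻¹.
theorem viscosity_of_strict (hγ : LocalKahler γ U)
    (hφ : ∀ z ∈ U, ContDiffAt ℝ 2 φ z)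
    (hpos : ∀ z ∈ U, (γ z + hess (fun y => (φ y : ℂ)) z).PosDef)
    (hMA : ∀ z ∈ U, (γ z + hess (fun y => (φ y : ℂ)) z).det = (Real.exp (f z) : ℂ) * (γ z).det)
    {p : Cn n} (hp : p ∈ U) (hf : ContDiffAt ℝ 2 f p)
    (a : Fin n → Cn n) (B : Fin n → Matrix (Fin n) (Fin n) ℂ) {Q : Cn n → ℝ}
    (hQ : ContDiffAt ℝ 2 Q p)
    (heq : ∑ α, (sesq (hess (fun y => (φ y : ℂ)) p) (a α) (a α)).re = Q p)
    (hlt : ∀ᶠ z in 𝓝[≠] p, ∑ α, (sesq (hess (fun y => (φ y : ℂ)) z) (affField (a α) (B α) p z)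
      (affField (a α) (B α) p z)).re < Q z) :
    ∑ α, (wd (a α) (wdb (a α) fun y => ((f y + logDetRe (γ y) : ℝ) : ℂ)) p).re ≤
    (((γ p + hess (fun y => (φ y : ℂ)) p)⁻¹ * hess (fun y => (Q y : ℂ)) p).trace).re +
      ∑ α, (((γ p + hess (fun y => (φ y : ℂ)) p)⁻¹ * wd 1 (wdb 1 fun t : ℂ => (1 + t • B α) *
        γ (p + t • a α) * (1 + t • B α)ᴴ) 0).trace).re := by
  set ξ : Fin n → Cn n → Cn n := fun α z => affField (a α) (B α) p z with hξ
  set φc : Cn n → ℂ := fun y => (φ y : ℂ) with hφc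
  have hφc2 : ∀ z ∈ U, ContDiffAt ℝ 2 φc z := fun z hz => contDiffAt_ofReal (hφ z hz)
  have hξc : ∀ α, Continuous (ξ α) := fun α => (contDiff_affField (k := 0) _ _ _).continuous
  -- Base points range over the ball of radius R; the doubled radius leaves room for the shifted
  -- points.
  obtain ⟨R, hR, hball⟩ : ∃ R > 0, ∀ z ∈ Metric.closedBall p (2 * R), z ∈ U ∧ ContDiffAt ℝ 2 Q z ∧
      (z ≠ p → ∑ α, (sesq (hess φc z) (ξ α z) (ξ α z)).re < Q z) := by
    have : ∀ᶠ z in 𝓝 p, z ∈ U ∧ ContDiffAt ℝ 2 Q z ∧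
      (z ≠ p → ∑ α, (sesq (hess φc z) (ξ α z) (ξ α z)).re < Q z) := by
      filter_upwards [hγ.isOpen.mem_nhds hp, hQ.eventually (by simp),
        eventually_nhdsWithin_iff.1 hlt] with z h1 h2 h3 using ⟨h1, h2, h3⟩
    obtain ⟨R, hR, h⟩ := Metric.nhds_basis_closedBall.mem_iff.1 this
    refine ⟨R / 2, by positivity, fun z hz => h ?_⟩
    simpa [mul_div_cancel₀] using hz
  have hsub : Metric.closedBall p R ⊆ Metric.closedBall p (2 * R) :=
    Metric.closedBall_subset_closedBall (by linarith)
  obtain ⟨C, hC, hbd⟩ : ∃ C > 0, ∀ z ∈ Metric.closedBall p R, ∀ α, ‖ξ α z‖ ≤ C := by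
    obtain ⟨C, hC⟩ := (isCompact_closedBall p R).exists_bound_of_continuousOn
      (f := fun z => ∑ α, ‖ξ α z‖) (continuous_finsetSum _ fun α _ => (hξc α).norm).continuousOn
    refine ⟨max C 1, by positivity, fun z hz α => ?_⟩
    have h1 := hC z hz
    rw [Real.norm_of_nonneg (Finset.sum_nonneg fun α _ => norm_nonneg _)] at h1
    exact (Finset.single_le_sum (f := fun α => ‖ξ α z‖) (fun α _ => norm_nonneg _)
      (Finset.mem_univ α)).trans (h1.trans (le_max_left _ _))
  have hshift : ∀ h : ℝ, 0 < h → h * C ≤ R → ∀ z ∈ Metric.closedBall p R, ∀ α, ∀ c : ℂ, ‖c‖ = h →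
      z + c • ξ α z ∈ Metric.closedBall p (2 * R) := by
    intro h hh hhC z hz α c hc
    rw [Metric.mem_closedBall, dist_eq_norm] at hz ⊢
    calc ‖z + c • ξ α z - p‖ = ‖(z - p) + c • ξ α z‖ := by congr 1; abel
      _ ≤ ‖z - p‖ + ‖c‖ * ‖ξ α z‖ := (norm_add_le _ _).trans (by rw [norm_smul])
      _ ≤ R + h * C := by
        rw [hc]; gcongr; exact hbd z (by rwa [Metric.mem_closedBall, dist_eq_norm]) α
      _ ≤ 2 * R := by linarith
  have hunit : ∀ h : ℝ, 0 < h → ∀ k : Fin 4, ‖(h : ℂ) * Complex.I ^ (k : ℕ)‖ = h := by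
    intro h hh k
    simp [abs_of_pos hh]
  have hsmall : ∀ᶠ h : ℝ in 𝓝[>] 0, 0 < h ∧ h * C ≤ R := by
    have : Tendsto (fun h : ℝ => h * C) (𝓝[>] 0) (𝓝 0) := by
      exact ((continuous_mul_const C).tendsto' 0 0 (zero_mul C)).mono_left nhdsWithin_le_nhds
    filter_upwards [self_mem_nhdsWithin, this.eventually_lt_const hR] with h h1 h2
    exact ⟨h1, h2.le⟩
  have hφcont : ContinuousOn φ (Metric.closedBall p (2 * R)) := fun z hz =>
    (hφ z (hball z hz).1).continuousAt.continuousWithinAt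
  have hDc : ∀ᶠ h in 𝓝[>] (0 : ℝ), ContinuousOn (fun y => ∑ α, fourPoint φ h y (ξ α y))
      (Metric.closedBall p R) := by
    filter_upwards [hsmall] with h hh
    refine continuousOn_finsetSum _ fun α _ => ?_
    have e1 : (fun y => fourPoint φ h y (ξ α y)) = fun y =>
      (4⁻¹ * (h ^ 2)⁻¹) * ∑ k : Fin 4, (φ (y + ((h : ℂ) * Complex.I ^ (k : ℕ)) • ξ α y) - φ y) := by
      ext1 y
      rw [← fourPoint_line, fourPoint_eq_sum, smul_eq_mul]
      simp
    rw [e1]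
    refine continuousOn_const.mul (continuousOn_finsetSum _ fun k _ => ContinuousOn.sub ?_
      (hφcont.mono hsub))
    have hc : Continuous (fun y => y + ((h : ℂ) * Complex.I ^ (k : ℕ)) • ξ α y) :=
      continuous_id.add (Continuous.const_smul (hξc α) ((h : ℂ) * Complex.I ^ (k : ℕ)))
    exact hφcont.comp hc.continuousOn
      (fun z hz => hshift h hh.1 hh.2 z hz α _ (hunit h hh.1 k))
  have hid : ∀ l : Filter ℝ, l ≤ 𝓝[>] 0 → Tendsto (fun h : ℝ => h) l (𝓝 0) := fun l hl =>
    hl.trans nhdsWithin_le_nhds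
  have hne : ∀ l : Filter ℝ, l ≤ 𝓝[>] 0 → ∀ᶠ h in l, h ≠ 0 := fun l hl =>
    hl (by filter_upwards [self_mem_nhdsWithin] with h hh using ne_of_gt hh)
  have hD : ∀ (l : Filter ℝ) (z : ℝ → Cn n), ∀ x ∈ Metric.closedBall p R, l ≤ 𝓝[>] 0 →
      Tendsto z l (𝓝 x) → Tendsto (fun h => ∑ α, fourPoint φ h (z h) (ξ α (z h))) l
        (𝓝 (∑ α, (sesq (hess φc x) (ξ α x) (ξ α x)).re)) := by
    intro l z x hx hl hz
    refine tendsto_finsetSum _ fun α _ => ?_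
    have hxU := (hball x (hsub hx)).1
    have t := tendsto_fourPoint (hφc2 x hxU) (hid l hl) (hne l hl) hz
      (((hξc α).tendsto x).comp hz)
    rw [← sesq_hess (hφc2 x hxU)] at t
    refine ((Complex.continuous_re.tendsto _).comp t).congr fun h => ?_
    simp only [Function.comp, hφc, fourPoint_ofReal, Complex.ofReal_re]
  have hξp : ∀ α, ξ α p = a α := fun α => affField_self _ _ _
  have heq' : ∑ α, (sesq (hess φc p) (ξ α p) (ξ α p)).re = Q p := by simpa only [hξp] using heq
  obtain ⟨l, z, hl, hz, hmax⟩ := exists_tendsto_isLocalMax hR hDc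
    (fun y hy => (hball y (hsub hy)).2.1.continuousAt.continuousWithinAt) hD heq'
    (fun x hx hxp => (hball x (hsub hx)).2.2 hxp)
  have hzK : ∀ᶠ h in (l : Filter ℝ), z h ∈ Metric.closedBall p R :=
    hz.eventually (Metric.closedBall_mem_nhds p hR)
  have hMu : ∀ᶠ h : ℝ in (l : Filter ℝ), ∀ α, ∀ k : Fin 4,
      IsUnit (1 + ((h : ℂ) * Complex.I ^ (k : ℕ)) • B α) := by
    rw [eventually_all]; intro α
    rw [eventually_all]; intro k
    have hc : Continuous (fun h : ℝ => 1 + ((h : ℂ) * Complex.I ^ (k : ℕ)) • B α) := by fun_prop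
    have h1 : IsUnit (1 + (((0 : ℝ) : ℂ) * Complex.I ^ (k : ℕ)) • B α) := by simp
    exact (hid l hl) (hc.continuousAt.eventually (Units.isOpen.mem_nhds h1))
  have hsmall' : ∀ᶠ h : ℝ in (l : Filter ℝ), 0 < h ∧ h * C ≤ R := hl hsmall
  have hineq := (((hsmall'.and hzK).and hMu).and hmax).mono fun h hh =>
    sum_fourPoint_le (f := f) hγ hφ hpos hMA a B (p := p) (Q := Q)
      (hball _ (hsub hh.1.1.2)).1 (hball _ (hsub hh.1.1.2)).2.1
      (fun α k => (hball _ (hshift h hh.1.1.1.1 hh.1.1.1.2 _ hh.1.1.2 α _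
        (hunit h hh.1.1.1.1 k))).1) hh.1.2 hh.2
  have hγp : ContDiffAt ℝ 2 γ p := hγ.contDiffAt hp 2
  have hFc : ContDiffAt ℝ 2 (fun y => ((f y + logDetRe (γ y) : ℝ) : ℂ)) p := by
    have h1 : ContDiffAt ℝ 2 (fun y => logDet (γ y)) p := contDiffAt_logDet hγp
      (by filter_upwards [hγ.isOpen.mem_nhds hp] with y hy using hγ.posDef y hy)
    have := (contDiffAt_ofReal hf).add h1
    refine this.congr_of_eventuallyEq (Eventually.of_forall fun y => ?_)
    simp [logDet_eq_logDetRe]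
  have L1 : ∀ α, Tendsto (fun h => fourPoint (fun y => f y + logDetRe (γ y)) h (z h) (ξ α (z h))) l
      (𝓝 (wd (a α) (wdb (a α) fun y => ((f y + logDetRe (γ y) : ℝ) : ℂ)) p).re) := by
    intro α
    have t := tendsto_fourPoint hFc (hid l hl) (hne l hl) hz (((hξc α).tendsto p).comp hz)
    rw [hξp] at t
    refine ((Complex.continuous_re.tendsto _).comp t).congr fun h => ?_
    simp only [Function.comp, fourPoint_ofReal, Complex.ofReal_re]
  have L2 : ∀ α, Tendsto (fun h => fourPoint (fun t : ℂ =>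
      logDetRe ((1 + t • B α) * (1 + t • B α)ᴴ)) h 0 1) l (𝓝 0) := by
    intro α
    obtain ⟨h1, h2⟩ := wd_wdb_logDet_shift (B α)
    have t := tendsto_fourPoint h1 (hid l hl) (hne l hl) (tendsto_const_nhds (x := (0 : ℂ)))
      (tendsto_const_nhds (x := (1 : ℂ)))
    rw [h2] at t
    have t' := (Complex.continuous_re.tendsto _).comp t
    rw [Complex.zero_re] at t'
    refine t'.congr fun h => ?_
    simp only [Function.comp, logDet_eq_logDetRe, fourPoint_ofReal, Complex.ofReal_re]
  have hγ'c : ContinuousAt (fun y => γ y + hess φc y) p :=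
    hγp.continuousAt.add (continuousAt_hess (hφc2 p hp))
  have hinv : Tendsto (fun h => (γ (z h) + hess φc (z h))⁻¹) l (𝓝 (γ p + hess φc p)⁻¹) := by
    obtain ⟨u, hu⟩ := (hpos p hp).isUnit
    have h1 : ContinuousAt Ring.inverse (γ p + hess φc p) := by
      rw [← hu]; exact NormedRing.inverse_continuousAt u
    simp only [Matrix.nonsing_inv_eq_ringInverse]
    exact h1.tendsto.comp (hγ'c.tendsto.comp hz)
  have hQc := continuousAt_hess (contDiffAt_ofReal hQ)
  have tr : ∀ {X : ℝ → Matrix (Fin n) (Fin n) ℂ} {Y : Matrix (Fin n) (Fin n) ℂ},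
      Tendsto X l (𝓝 Y) → Tendsto (fun h => (((γ (z h) + hess φc (z h))⁻¹ * X h).trace).re) l
        (𝓝 ((((γ p + hess φc p)⁻¹ * Y).trace).re)) := by
    intro X Y hX
    have := (traceL (n := n)).continuous.tendsto _ |>.comp (hinv.mul hX)
    exact (Complex.continuous_re.tendsto _).comp this
  have L3 := tr (hQc.tendsto.comp hz)
  have L4 : ∀ α, Tendsto (fun h => fourPoint (fun t : ℂ => (1 + t • B α) *
        γ (z h + t • ξ α (z h)) * (1 + t • B α)ᴴ) h 0 1) l
        (𝓝 (wd 1 (wdb 1 fun t : ℂ => (1 + t • B α) * γ (p + t • a α) * (1 + t • B α)ᴴ) 0)) := by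
    intro α
    have t := tendsto_fourPoint_param (contDiffAt_shiftMatrix (a α) p (B α) hγp)
      (hid l hl) (hne l hl) hz
    simpa only [affField_self] using t
  have L := le_of_tendsto_of_tendsto
    (tendsto_finsetSum Finset.univ fun α _ => (L1 α).add (L2 α))
    (L3.add (tendsto_finsetSum Finset.univ fun α _ => tr (L4 α))) hineq
  simpa only [add_zero] using L

end Viscosity

end

section

open Matrix

variable {n : ℕ}

/-! ### Second derivatives of X A Xᴴ for a holomorphic affine X. -/

section Sandwich

variable {E : Type*} [NormedAddCommGroup E] [NormedSpace ℝ E] [NormedSpace ℂ E]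
  [IsScalarTower ℝ ℂ E] {X : E → Matrix (Fin n) (Fin n) ℂ} {L : E →L[ℂ] Matrix (Fin n) (Fin n) ℂ}

theorem contDiff_of_hasFDerivAt_const (hX : ∀ y, HasFDerivAt X L y) {k : WithTop ℕ∞} :
    ContDiff ℂ k X := by
  have e : X = fun y => X 0 + L y := by
    have hd : ∀ y, HasFDerivAt (fun y => X y - L y) (0 : E →L[ℂ] Matrix (Fin n) (Fin n) ℂ) y :=
      fun y => by simpa using (hX y).fun_sub L.hasFDerivAt
    ext1 y
    have := is_const_of_fderiv_eq_zero (𝕜 := ℂ) (fun y => (hd y).differentiableAt)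
      (fun y => (hd y).fderiv) y 0
    simp only [map_zero, sub_zero] at this
    rw [← this]; abel
  rw [e]
  exact contDiff_const.add L.contDiff

theorem wd_affine (hX : ∀ y, HasFDerivAt X L y) (v z : E) : wd v X z = L v := by
  rw [wd_of_holomorphic (hX z).differentiableAt, (hX z).fderiv]

theorem wdb_affine (hX : ∀ y, HasFDerivAt X L y) (v z : E) : wdb v X z = 0 :=
  wdb_of_holomorphic (hX z).differentiableAt v

theorem wd_star_affine (hX : ∀ y, HasFDerivAt X L y) (v z : E) :
    wd v (fun y => (X y)ᴴ) z = 0 := by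
  have := wd_star X z v
  rw [wdb_affine hX, star_zero] at this
  exact this

theorem wdb_star_affine (hX : ∀ y, HasFDerivAt X L y) (v z : E) :
    wdb v (fun y => (X y)ᴴ) z = (L v)ᴴ := by
  have := wdb_star X z v
  rw [wd_affine hX] at this
  exact this

theorem contDiff_real_of_affine (hX : ∀ y, HasFDerivAt X L y) {k : WithTop ℕ∞} :
    ContDiff ℝ k X := (contDiff_of_hasFDerivAt_const hX).restrict_scalars ℝ

theorem contDiff_star_of_affine (hX : ∀ y, HasFDerivAt X L y) {k : WithTop ℕ∞} :
    ContDiff ℝ k (fun y => (X y)ᴴ) :=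
  (starL' ℝ (A := Matrix (Fin n) (Fin n) ℂ)).contDiff.comp (contDiff_real_of_affine hX)

theorem wd_wdb_sandwich (hX : ∀ y, HasFDerivAt X L y) {A : E → Matrix (Fin n) (Fin n) ℂ} {z : E}
    (hA : ContDiffAt ℝ 2 A z) (v w : E) :
    wd v (wdb w fun y => X y * A y * (X y)ᴴ) z =
      L v * A z * (L w)ᴴ + L v * wdb w A z * (X z)ᴴ + X z * wd v A z * (L w)ᴴ
        + X z * wd v (wdb w A) z * (X z)ᴴ := by
  have dX : ∀ y, DifferentiableAt ℝ X y := fun y =>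
    (contDiff_real_of_affine (k := 1) hX).differentiable (by norm_num) y
  have dXs : ∀ y, DifferentiableAt ℝ (fun y => (X y)ᴴ) y := fun y =>
    (contDiff_star_of_affine (k := 1) hX).differentiable (by norm_num) y
  have dA : DifferentiableAt ℝ A z := hA.differentiableAt (by norm_num)
  have dwA := differentiableAt_wdb hA w
  have e : wdb w (fun y => X y * A y * (X y)ᴴ) =ᶠ[𝓝 z]
      fun y => X y * wdb w A y * (X y)ᴴ + X y * A y * (L w)ᴴ := by
    filter_upwards [hA.eventually (by simp)] with y hy
    have hy' : DifferentiableAt ℝ A y := hy.differentiableAt (by norm_num)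
    rw [wdb_mul (DifferentiableAt.fun_mul (dX y) hy') (dXs y), wdb_mul (dX y) hy', wdb_affine hX,
      wdb_star_affine hX, zero_mul, zero_add]
  have d1 := DifferentiableAt.fun_mul (dX z) dwA
  have d2 := DifferentiableAt.fun_mul (dX z) dA
  rw [wd_congr e, wd_add (DifferentiableAt.fun_mul d1 (dXs z))
    (DifferentiableAt.fun_mul d2 (differentiableAt_const _)), wd_mul d1 (dXs z),
    wd_mul d2 (differentiableAt_const _), wd_mul (dX z) dwA, wd_mul (dX z) dA, wd_affine hX,
    wd_star_affine hX, wd_const]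
  noncomm_ring

theorem wd_wdb_star_mul (hX : ∀ y, HasFDerivAt X L y) (z v w : E) :
    wd v (wdb w fun y => (X y)ᴴ * X y) z = (L w)ᴴ * L v := by
  have dX : ∀ y, DifferentiableAt ℝ X y := fun y =>
    (contDiff_real_of_affine (k := 1) hX).differentiable (by norm_num) y
  have dXs : ∀ y, DifferentiableAt ℝ (fun y => (X y)ᴴ) y := fun y =>
    (contDiff_star_of_affine (k := 1) hX).differentiable (by norm_num) y
  have e : wdb w (fun y => (X y)ᴴ * X y) = fun y => (L w)ᴴ * X y := by
    ext1 y
    rw [wdb_mul (dXs y) (dX y), wdb_affine hX, wdb_star_affine hX, mul_zero, add_zero]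
  rw [e, wd_mul (differentiableAt_const _) (dX z), wd_affine hX, wd_const, zero_mul, zero_add]

end Sandwich

/-! ### Affine holomorphic frames and removal of the strictness assumption. -/

section Frame

variable {U : Set (Cn n)} {γ : Cn n → Matrix (Fin n) (Fin n) ℂ} {φ f : Cn n → ℝ}

/-- The matrix whose rows are the affine fields `a_α + (z - p) B_α`. -/
noncomputable def frame (a : Fin n → Cn n) (B : Fin n → Matrix (Fin n) (Fin n) ℂ) (p z : Cn n) :
    Matrix (Fin n) (Fin n) ℂ :=
  Matrix.of fun α k => affField (a α) (B α) p z k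

/-- The derivative of `frame`. -/
noncomputable def frameDeriv (B : Fin n → Matrix (Fin n) (Fin n) ℂ) :
    Cn n →L[ℂ] Matrix (Fin n) (Fin n) ℂ :=
  LinearMap.toContinuousLinearMap
    { toFun := fun v => Matrix.of fun α k => rowMap (B α) v k
      map_add' := fun v w => by ext α k; simp
      map_smul' := fun c v => by ext α k; simp }

theorem frameDeriv_apply (B : Fin n → Matrix (Fin n) (Fin n) ℂ) (v : Cn n) (α k : Fin n) :
    frameDeriv B v α k = rowMap (B α) v k := rfl

theorem hasFDerivAt_frame (a : Fin n → Cn n) (B : Fin n → Matrix (Fin n) (Fin n) ℂ) (p z : Cn n) :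
    HasFDerivAt (frame a B p) (frameDeriv B) z := by
  have e : frame a B p = fun z => (Matrix.of fun α k => a α k) + frameDeriv B (z - p) := by
    ext z α k
    simp [frame, affField, frameDeriv_apply]
  rw [e]
  have h1 : HasFDerivAt (fun y : Cn n => y - p) (ContinuousLinearMap.id ℂ (Cn n)) z :=
    (hasFDerivAt_id z).sub_const p
  exact ((frameDeriv B).hasFDerivAt.comp z h1).const_add _

/-- For γ = ∂∂̄u this would say that the Hessian of u_{ξξ̄} is the second t-derivative of the
Hessian of u composed with z ↦ z + tξ(z). Both sides expand into four terms, matched by the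
symmetries of a closed form: differentiation directions are exchanged with tensor slots. -/
theorem LocalKahler.wd_wdb_shift (hγ : LocalKahler γ U) {p : Cn n} (hp : p ∈ U)
    (a : Fin n → Cn n) (B : Fin n → Matrix (Fin n) (Fin n) ℂ) (α : Fin n) :
    wd 1 (wdb 1 fun t : ℂ => (1 + t • B α) * γ (p + t • a α) * (1 + t • B α)ᴴ) 0 =
      hess (fun z => (frame a B p z * γ z * (frame a B p z)ᴴ) α α) p := by
  have hM : ∀ t, HasFDerivAt (fun t : ℂ => 1 + t • B α)
      ((ContinuousLinearMap.id ℂ ℂ).smulRight (B α)) t := fun t => by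
    simpa using ((hasFDerivAt_id t).smul_const (B α)).const_add (1 : Matrix (Fin n) (Fin n) ℂ)
  have h2 : ContDiffAt ℝ 2 γ p := hγ.contDiffAt hp 2
  have hl : ∀ t, HasFDerivAt (fun t : ℂ => p + t • a α)
      ((ContinuousLinearMap.id ℂ ℂ).smulRight (a α)) t := fun t => by
    simpa using ((hasFDerivAt_id t).smul_const (a α)).const_add p
  have hlc : ContDiff ℂ 2 (fun t : ℂ => p + t • a α) :=
    contDiff_const.add (contDiff_id.smul contDiff_const)
  have h2' : ContDiffAt ℝ 2 γ (p + (0 : ℂ) • a α) := by simpa using h2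
  have hA : ContDiffAt ℝ 2 (fun t : ℂ => γ (p + t • a α)) 0 :=
    h2'.comp 0 (hlc.restrict_scalars ℝ).contDiffAt
  have e1 : wd 1 (fun t : ℂ => γ (p + t • a α)) 0 = wd (a α) γ p := by
    rw [wd_comp_holomorphic (Φ := fun t : ℂ => p + t • a α)
      (h2'.differentiableAt (by norm_num)) (hl 0).differentiableAt, (hl 0).fderiv]
    simp
  have e2 : wdb 1 (fun t : ℂ => γ (p + t • a α)) 0 = wdb (a α) γ p := by
    rw [wdb_comp_holomorphic (Φ := fun t : ℂ => p + t • a α)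
      (h2'.differentiableAt (by norm_num)) (hl 0).differentiableAt, (hl 0).fderiv]
    simp
  have e3 : wd 1 (wdb 1 (fun t : ℂ => γ (p + t • a α))) 0 = wd (a α) (wdb (a α) γ) p := by
    rw [wd_wdb_comp_holomorphic (Φ := fun t : ℂ => p + t • a α) h2' hlc.contDiffAt, (hl 0).fderiv]
    simp
  rw [wd_wdb_sandwich hM hA, e1, e2, e3]
  ext i j
  have hf := hasFDerivAt_frame a B p
  have hs : ContDiffAt ℝ 2 (fun z => frame a B p z * γ z * (frame a B p z)ᴴ) p :=
    ((contDiff_real_of_affine hf).contDiffAt.mul h2).mul (contDiff_star_of_affine hf).contDiffAt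
  rw [hess_apply, wd_wdb_entry hs, wd_wdb_sandwich hf h2]
  have r1 : ∀ i, frameDeriv B (stdVec i) α = B α i := fun i => by
    ext k; rw [frameDeriv_apply, rowMap_stdVec]
  have r2 : frame a B p p α = a α := by
    ext k; simp [frame, affField_self]
  have r3 : ∀ i, (1 : Matrix (Fin n) (Fin n) ℂ) i = (stdVec i : Cn n) := fun i => by
    ext k; simp [stdVec, Matrix.one_apply, eq_comm]
  have s1 := hγ.sesq_wdb hp (a α) (WithLp.toLp 2 (B α i)) (stdVec j)
  have s2 := hγ.sesq_wd hp (a α) (stdVec i) (WithLp.toLp 2 (B α j))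
  have s3 := hγ.sesq_wd_wdb hp (a α) (a α) (stdVec i) (stdVec j)
  simp only [zero_smul, add_zero, ContinuousLinearMap.smulRight_apply, ContinuousLinearMap.id_apply,
    one_smul]
  simp only [Matrix.add_apply, mul_mul_conjTranspose_apply, r1, r2, r3, s1, s2, s3]

/-- Subtracting tr(Y γ Yᴴ) from the majorant turns it into a test function for Σ φ_{ξ_α ξ̄_α}. By
`LocalKahler.wd_wdb_shift` its Hessian cancels the shift terms in γ exactly. The barrier δN makes
the touching strict, and its contribution is linear in δ. -/
theorem viscosity_frame (hγ : LocalKahler γ U)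
    (hφ : ∀ z ∈ U, ContDiffAt ℝ 2 φ z)
    (hpos : ∀ z ∈ U, (γ z + hess (fun y => (φ y : ℂ)) z).PosDef)
    (hMA : ∀ z ∈ U, (γ z + hess (fun y => (φ y : ℂ)) z).det = (Real.exp (f z) : ℂ) * (γ z).det)
    {p : Cn n} (hp : p ∈ U) (hf : ContDiffAt ℝ 2 f p)
    (a : Fin n → Cn n) (B : Fin n → Matrix (Fin n) (Fin n) ℂ) {P N : Cn n → ℝ}
    (hP : ContDiffAt ℝ 2 P p) (hN : ContDiffAt ℝ 2 N p) (hN0 : N p = 0) (hNpos : ∀ z ≠ p, 0 < N z)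
    (heq : ((frame a B p p * (γ p + hess (fun y => (φ y : ℂ)) p) * (frame a B p p)ᴴ).trace).re
      = P p)
    (hle : ∀ δ > 0, ∀ᶠ z in 𝓝 p, ((frame a B p z * (γ z + hess (fun y => (φ y : ℂ)) z)
      * (frame a B p z)ᴴ).trace).re ≤ P z + δ * N z) :
    ∑ α, (wd (a α) (wdb (a α) fun y => ((f y + logDetRe (γ y) : ℝ) : ℂ)) p).re ≤
    (((γ p + hess (fun y => (φ y : ℂ)) p)⁻¹ * hess (fun y => (P y : ℂ)) p).trace).re := by
  set Y := frame a B p with hY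
  set φc : Cn n → ℂ := fun y => (φ y : ℂ) with hφc
  have hYd := hasFDerivAt_frame a B p
  have hγ2 : ContDiffAt ℝ 2 γ p := hγ.contDiffAt hp 2
  have hUn := hγ.isOpen.mem_nhds hp
  have hs : ContDiffAt ℝ 2 (fun z => Y z * γ z * (Y z)ᴴ) p :=
    ((contDiff_real_of_affine hYd).contDiffAt.mul hγ2).mul
      (contDiff_star_of_affine hYd).contDiffAt
  have hst : ContDiffAt ℝ 2 (fun z => (Y z * γ z * (Y z)ᴴ).trace) p := contDiffAt_clm_comp traceL hs
  have hsr : ContDiffAt ℝ 2 (fun z => ((Y z * γ z * (Y z)ᴴ).trace).re) p :=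
    Complex.reCLM.contDiff.contDiffAt.comp p hst
  have hreal : (fun z => ((((Y z * γ z * (Y z)ᴴ).trace).re : ℝ) : ℂ)) =ᶠ[𝓝 p]
      fun z => (Y z * γ z * (Y z)ᴴ).trace := by
    filter_upwards [hUn] with z hz
    have hH : (Y z * γ z * (Y z)ᴴ).IsHermitian :=
      isHermitian_mul_mul_conjTranspose _ (hγ.posDef z hz).1
    have h1 : star (Y z * γ z * (Y z)ᴴ).trace = (Y z * γ z * (Y z)ᴴ).trace := by
      rw [← trace_conjTranspose, hH.eq]
    exact Complex.conj_eq_iff_re.1 h1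
  have hsplit : ∀ z, ∑ α, (sesq (hess φc z) (affField (a α) (B α) p z)
      (affField (a α) (B α) p z)).re =
      ((Y z * (γ z + hess φc z) * (Y z)ᴴ).trace).re - ((Y z * γ z * (Y z)ᴴ).trace).re := by
    intro z
    rw [Matrix.mul_add, Matrix.add_mul, trace_add, Complex.add_re, add_sub_cancel_left, trace,
      Complex.re_sum]
    refine Finset.sum_congr rfl fun α _ => ?_
    rw [diag_apply, mul_mul_conjTranspose_apply]
    rfl
  have main : ∀ δ > 0, ∑ α, (wd (a α) (wdb (a α) fun y => ((f y + logDetRe (γ y) : ℝ) : ℂ)) p).re ≤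
      (((γ p + hess φc p)⁻¹ * hess (fun y => (P y : ℂ)) p).trace).re
      + δ * (((γ p + hess φc p)⁻¹ * hess (fun y => (N y : ℂ)) p).trace).re := by
    intro δ hδ
    have hQ : ContDiffAt ℝ 2 (fun z => P z + δ * N z - ((Y z * γ z * (Y z)ᴴ).trace).re) p :=
      (hP.add (contDiffAt_const.mul hN)).sub hsr
    have key := viscosity_of_strict hγ hφ hpos hMA hp hf a B hQ ?_ ?_
    · refine key.trans (le_of_eq ?_)
      have e1 : hess (fun y => ((P y + δ * N y - ((Y y * γ y * (Y y)ᴴ).trace).re : ℝ) : ℂ)) p =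
          hess (fun y => (P y : ℂ)) p + (δ : ℂ) • hess (fun y => (N y : ℂ)) p
            - ∑ α, hess (fun z => (Y z * γ z * (Y z)ᴴ) α α) p := by
        have hent : ∀ α, ContDiffAt ℝ 2 (fun z => (Y z * γ z * (Y z)ᴴ) α α) p := fun α =>
          contDiffAt_entry hs α α
        have e2 : (fun y => ((P y + δ * N y - ((Y y * γ y * (Y y)ᴴ).trace).re : ℝ) : ℂ))
            =ᶠ[𝓝 p] fun y => ((P y : ℂ) + (δ : ℂ) * (N y : ℂ)) - ∑ α, (Y y * γ y * (Y y)ᴴ) α α := by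
          filter_upwards [hreal] with y hy
          rw [Complex.ofReal_sub, hy]
          push_cast
          rfl
        have hNc : ContDiffAt ℝ 2 (fun y => (δ : ℂ) * (N y : ℂ)) p :=
          contDiffAt_const.mul (contDiffAt_ofReal hN)
        rw [hess_congr e2, hess_sub ((contDiffAt_ofReal hP).add hNc)
          (ContDiffAt.sum fun α _ => hent α), hess_add (contDiffAt_ofReal hP) hNc,
          hess_const_mul _ (contDiffAt_ofReal hN), hess_sum _ (fun α _ => hent α)]
      rw [e1]
      simp only [hγ.wd_wdb_shift hp a B]
      rw [Matrix.mul_sub, Matrix.mul_add, Matrix.mul_smul, trace_sub, trace_add, trace_smul,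
        Complex.sub_re, Complex.add_re, Matrix.mul_sum, trace_sum, Complex.re_sum, smul_eq_mul,
        Complex.re_ofReal_mul]
      ring
    · have := hsplit p
      simp only [affField_self] at this
      rw [this, heq, hN0]
      ring
    -- Half of the barrier pays for the error in the touching hypothesis; the other half gives
    -- strictness away from p.
    · have h3 := hle (δ / 2) (by positivity)
      rw [eventually_nhdsWithin_iff]
      filter_upwards [h3] with z hz hzp
      rw [hsplit z]
      have := mul_pos hδ (hNpos z hzp)
      linarith
  by_contra hcon
  push Not at hcon
  set c := (((γ p + hess φc p)⁻¹ * hess (fun y => (N y : ℂ)) p).trace).re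
  set A := ∑ α, (wd (a α) (wdb (a α) fun y => ((f y + logDetRe (γ y) : ℝ) : ℂ)) p).re
  set A' := (((γ p + hess φc p)⁻¹ * hess (fun y => (P y : ℂ)) p).trace).re
  -- This δ makes the barrier term at most half of the supposed gap A − A', a contradiction.
  have h := main ((A - A') / (2 * (|c| + 1))) (div_pos (sub_pos.2 hcon) (by positivity))
  have h1 : (A - A') / (2 * (|c| + 1)) * c ≤ (A - A') / 2 := by
    rw [div_mul_eq_mul_div, div_le_div_iff₀ (by positivity) (by norm_num)]
    nlinarith [le_abs_self c, sub_pos.2 hcon, abs_nonneg c]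
  linarith

end Frame

end

section

open Matrix

variable {n : ℕ}

/-! ### Scalar product and exponential rules; second-order vanishing. -/

section Scalar

variable {E : Type*} [NormedAddCommGroup E] [NormedSpace ℝ E] [NormedSpace ℂ E]
  [IsScalarTower ℝ ℂ E]

theorem wd_wdb_mul {f g : E → ℂ} {z : E} (hf : ContDiffAt ℝ 2 f z) (hg : ContDiffAt ℝ 2 g z)
    (v w : E) : wd v (wdb w fun y => f y * g y) z =
      wd v (wdb w f) z * g z + wdb w f z * wd v g z + wd v f z * wdb w g z
        + f z * wd v (wdb w g) z := by
  have e : wdb w (fun y => f y * g y) =ᶠ[𝓝 z] fun y => wdb w f y * g y + f y * wdb w g y := by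
    filter_upwards [hf.eventually (by simp), hg.eventually (by simp)] with y h1 h2
    exact wdb_mul (h1.differentiableAt (by norm_num)) (h2.differentiableAt (by norm_num)) w
  have f1 := hf.differentiableAt (by norm_num)
  have g1 := hg.differentiableAt (by norm_num)
  have f2 := differentiableAt_wdb hf w
  have g2 := differentiableAt_wdb hg w
  rw [wd_congr e, wd_add (f2.fun_mul g1) (f1.fun_mul g2), wd_mul f2 g1, wd_mul f1 g2]
  ring

theorem wd_exp {g : E → ℂ} {z : E} (hg : DifferentiableAt ℝ g z) (v : E) :
    wd v (fun y => Complex.exp (g y)) z = Complex.exp (g z) * wd v g z := by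
  rw [wd_holomorphic_comp Complex.differentiableAt_exp hg, ← toSpanSingleton_deriv,
    Complex.deriv_exp]
  simp [mul_comm]

theorem wdb_exp {g : E → ℂ} {z : E} (hg : DifferentiableAt ℝ g z) (v : E) :
    wdb v (fun y => Complex.exp (g y)) z = Complex.exp (g z) * wdb v g z := by
  rw [wdb_holomorphic_comp Complex.differentiableAt_exp hg, ← toSpanSingleton_deriv,
    Complex.deriv_exp]
  simp [mul_comm]

theorem contDiffAt_cexp {g : E → ℂ} {z : E} {k : WithTop ℕ∞} (hg : ContDiffAt ℝ k g z) :
    ContDiffAt ℝ k (fun y => Complex.exp (g y)) z :=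
  (Complex.contDiff_exp (𝕜 := ℝ)).contDiffAt.comp z hg

theorem wd_wdb_exp {g : E → ℂ} {z : E} (hg : ContDiffAt ℝ 2 g z) (v w : E) :
    wd v (wdb w fun y => Complex.exp (g y)) z =
      Complex.exp (g z) * (wd v g z * wdb w g z + wd v (wdb w g) z) := by
  have e : wdb w (fun y => Complex.exp (g y)) =ᶠ[𝓝 z] fun y => Complex.exp (g y) * wdb w g y := by
    filter_upwards [hg.eventually (by simp)] with y h1
    exact wdb_exp (h1.differentiableAt (by norm_num)) w
  have g1 := hg.differentiableAt (by norm_num)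
  rw [wd_congr e, wd_mul ((contDiffAt_cexp hg).differentiableAt (by norm_num))
    (differentiableAt_wdb hg w), wd_exp g1]
  ring

theorem isBigO_of_fderiv_eq_zero {W : Type*} [NormedAddCommGroup W] [NormedSpace ℝ W] {f : E → W}
    {p : E} (hf : ContDiffAt ℝ 2 f p) (h0 : f p = 0) (h1 : fderiv ℝ f p = 0) :
    ∃ C > 0, ∀ᶠ z in 𝓝 p, ‖f z‖ ≤ C * ‖z - p‖ ^ 2 := by
  have hd : DifferentiableAt ℝ (fderiv ℝ f) p :=
    (hf.fderiv_right (m := 1) (by norm_num)).differentiableAt (by norm_num)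
  obtain ⟨C, hC, hb⟩ := hd.isBigO_sub.exists_pos
  refine ⟨C, hC, ?_⟩
  have hall : ∀ᶠ z in 𝓝 p, DifferentiableAt ℝ f z ∧ ‖fderiv ℝ f z‖ ≤ C * ‖z - p‖ := by
    filter_upwards [hf.eventually (by simp), hb.bound] with z h2 h3
    rw [h1, sub_zero] at h3
    exact ⟨h2.differentiableAt (by norm_num), h3⟩
  obtain ⟨r, hr, hball⟩ := Metric.eventually_nhds_iff_ball.1 hall
  filter_upwards [Metric.ball_mem_nhds p hr] with z hz
  have hz' : ‖z - p‖ < r := by rwa [Metric.mem_ball, dist_eq_norm] at hz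
  have hsub : ∀ y ∈ Metric.closedBall p ‖z - p‖, y ∈ Metric.ball p r := fun y hy =>
    lt_of_le_of_lt hy hz'
  have := Convex.norm_image_sub_le_of_norm_fderiv_le (𝕜 := ℝ) (f := f) (C := C * ‖z - p‖)
    (s := Metric.closedBall p ‖z - p‖) (x := p) (y := z) (fun y hy => (hball y (hsub y hy)).1)
    (fun y hy => ((hball y (hsub y hy)).2).trans (by
      have : ‖y - p‖ ≤ ‖z - p‖ := by rwa [Metric.mem_closedBall, dist_eq_norm] at hy
      gcongr)) (convex_closedBall _ _)
    (Metric.mem_closedBall_self (norm_nonneg _)) (by rw [Metric.mem_closedBall, dist_eq_norm])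
  rw [h0, sub_zero] at this
  calc _ ≤ _ := this
    _ = _ := by ring

end Scalar

/-! ### The weight w and the frame Y adapted to the maximum point. -/

section Touching

variable {U : Set (Cn n)} {γ : Cn n → Matrix (Fin n) (Fin n) ℂ} {φ f : Cn n → ℝ}

/-- The curvature matrix `R_{kl̄}(v, w̄)`. -/
noncomputable def curvMat (γ : Cn n → Matrix (Fin n) (Fin n) ℂ) (z v w : Cn n) :
    Matrix (Fin n) (Fin n) ℂ :=
  wd v γ z * (γ z)⁻¹ * wdb w γ z - wd v (wdb w γ) z

/-- The rows of the endomorphisms `- (K φ_i + γ_i γ⁻¹)`, applied to the rows of `V`. -/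
noncomputable def twist (γ : Cn n → Matrix (Fin n) (Fin n) ℂ) (φ : Cn n → ℝ) (K : ℝ)
    (V : Matrix (Fin n) (Fin n) ℂ) (p : Cn n) (α : Fin n) : Matrix (Fin n) (Fin n) ℂ :=
  Matrix.of fun i k => -(V * (((K : ℂ) * wd (stdVec i) (fun y => (φ y : ℂ)) p) • 1
    + wd (stdVec i) γ p * (γ p)⁻¹)) α k

theorem frameDeriv_twist (K : ℝ) (V : Matrix (Fin n) (Fin n) ℂ) (p v : Cn n) :
    frameDeriv (twist γ φ K V p) v = -(V * (((K : ℂ) * wd v (fun y => (φ y : ℂ)) p) • 1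
      + wd v γ p * (γ p)⁻¹)) := by
  have e : ∀ α k, frameDeriv (twist γ φ K V p) v α k = ∑ i, v i * twist γ φ K V p α i k :=
    fun α k => by rw [frameDeriv_apply, rowMap_apply]
  have e2 : -(V * (((K : ℂ) * wd v (fun y => (φ y : ℂ)) p) • 1 + wd v γ p * (γ p)⁻¹)) =
      ∑ i, v i • -(V * (((K : ℂ) * wd (stdVec i) (fun y => (φ y : ℂ)) p) • 1
        + wd (stdVec i) γ p * (γ p)⁻¹)) := by
    rw [wd_eq_sum v, wd_eq_sum v, Finset.mul_sum, Finset.sum_smul, Finset.sum_mul,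
      ← Finset.sum_add_distrib, Finset.mul_sum, ← Finset.sum_neg_distrib]
    refine Finset.sum_congr rfl fun i _ => ?_
    rw [smul_eq_mul, smul_mul_assoc, mul_left_comm, mul_smul, ← smul_add, mul_smul_comm, smul_neg]
  rw [e2]
  ext α k
  rw [e, Matrix.sum_apply]
  rfl

/-- The holomorphic linear function with the same `∂` at `p` as the function `φ`. -/
noncomputable def linPart (φ : Cn n → ℝ) (p : Cn n) : Cn n →L[ℂ] ℂ :=
  ∑ i, (wd (stdVec i) (fun y => (φ y : ℂ)) p) • EuclideanSpace.proj (𝕜 := ℂ) i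

theorem linPart_apply (p v : Cn n) : linPart φ p v = wd v (fun y => (φ y : ℂ)) p := by
  rw [wd_eq_sum]
  simp [linPart, mul_comm]

/-- `1 - K ∂φ(p)(z - p)`. -/
noncomputable def weight (φ : Cn n → ℝ) (K : ℝ) (p z : Cn n) : ℂ := 1 - K * linPart φ p (z - p)

theorem hasFDerivAt_weight (K : ℝ) (p z : Cn n) :
    HasFDerivAt (weight φ K p) (-((K : ℂ) • linPart φ p)) z := by
  have h1 : HasFDerivAt (fun y : Cn n => y - p) (ContinuousLinearMap.id ℂ (Cn n)) z :=
    (hasFDerivAt_id z).sub_const p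
  have h2 : HasFDerivAt (fun y : Cn n => linPart φ p (y - p)) (linPart φ p) z :=
    (linPart φ p).hasFDerivAt.comp z h1
  exact (h2.const_mul (K : ℂ)).const_sub 1

theorem weight_self (K : ℝ) (p : Cn n) : weight φ K p p = 1 := by simp [weight]

theorem contDiff_weight (K : ℝ) (p : Cn n) {k : WithTop ℕ∞} : ContDiff ℝ k (weight φ K p) :=
  ((contDiff_const.sub (contDiff_const.mul ((linPart φ p).contDiff.comp
    (contDiff_id.sub contDiff_const))) : ContDiff ℂ k (weight φ K p))).restrict_scalars ℝ

/-- `|1 - K ∂φ(p)(z - p)|²`. -/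
noncomputable def weightSq (φ : Cn n → ℝ) (K : ℝ) (p z : Cn n) : ℂ :=
  weight φ K p z * star (weight φ K p z)

theorem weightSq_eq (K : ℝ) (p z : Cn n) :
    weightSq φ K p z = (Complex.normSq (weight φ K p z) : ℝ) := by
  rw [weightSq, RCLike.star_def, Complex.mul_conj]

theorem contDiff_weightSq (K : ℝ) (p : Cn n) {k : WithTop ℕ∞} : ContDiff ℝ k (weightSq φ K p) :=
  (contDiff_weight K p).mul ((starL' ℝ (A := ℂ)).contDiff.comp (contDiff_weight K p))

theorem weightSq_self (K : ℝ) (p : Cn n) : weightSq φ K p p = 1 := by simp [weightSq, weight_self]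

theorem wd_weightSq (K : ℝ) (p v : Cn n) :
    wd v (weightSq φ K p) p = -(K * wd v (fun y => (φ y : ℂ)) p) := by
  have d1 : DifferentiableAt ℝ (weight φ K p) p :=
    (contDiff_weight (k := 1) K p).differentiable (by norm_num) p
  have h : wd v (weightSq φ K p) p = _ := wd_mul d1 d1.star v
  rw [h, wd_star, wdb_of_holomorphic (hasFDerivAt_weight K p p).differentiableAt,
    wd_of_holomorphic (hasFDerivAt_weight K p p).differentiableAt, (hasFDerivAt_weight K p p).fderiv,
    weight_self]
  simp [linPart_apply]

theorem wdb_weightSq (K : ℝ) (p v : Cn n) :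
    wdb v (weightSq φ K p) p = -(K * wdb v (fun y => (φ y : ℂ)) p) := by
  have d1 : DifferentiableAt ℝ (weight φ K p) p :=
    (contDiff_weight (k := 1) K p).differentiable (by norm_num) p
  have h : wdb v (weightSq φ K p) p = _ := wdb_mul d1 d1.star v
  rw [h, wdb_star, wdb_of_holomorphic (hasFDerivAt_weight K p p).differentiableAt,
    wd_of_holomorphic (hasFDerivAt_weight K p p).differentiableAt, (hasFDerivAt_weight K p p).fderiv,
    weight_self, ← conj_wd_ofReal]
  simp [linPart_apply]

theorem conjTranspose_frameDeriv_twist (hγ : LocalKahler γ U) {p : Cn n} (hp : p ∈ U) (K : ℝ)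
    (V : Matrix (Fin n) (Fin n) ℂ) (v : Cn n) :
    (frameDeriv (twist γ φ K V p) v)ᴴ = -((((K : ℂ) * wdb v (fun y => (φ y : ℂ)) p) • 1
      + (γ p)⁻¹ * wdb v γ p) * Vᴴ) := by
  rw [frameDeriv_twist, conjTranspose_neg, conjTranspose_mul, conjTranspose_add,
    conjTranspose_smul, conjTranspose_mul, hγ.conjTranspose_wd hp, conjTranspose_nonsing_inv,
    (hγ.posDef p hp).1.eq, conjTranspose_one, ← conj_wd_ofReal]
  simp

/-- The error `w γ⁻¹ - Yᴴ Y` vanishes to second order. -/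
theorem frame_error_bound (hγ : LocalKahler γ U) {p : Cn n} (hp : p ∈ U) (K : ℝ)
    {V : Matrix (Fin n) (Fin n) ℂ} (hV : V * γ p * Vᴴ = 1) :
    ∃ C > 0, ∀ᶠ z in 𝓝 p, ‖weightSq φ K p z • (γ z)⁻¹
      - (frame (fun α => WithLp.toLp 2 (V α)) (twist γ φ K V p) p z)ᴴ
        * frame (fun α => WithLp.toLp 2 (V α)) (twist γ φ K V p) p z‖ ≤ C * ‖z - p‖ ^ 2 := by
  set Y := frame (fun α => WithLp.toLp 2 (V α)) (twist γ φ K V p) p with hY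
  have hYd := hasFDerivAt_frame (fun α => WithLp.toLp 2 (V α)) (twist γ φ K V p) p
  have hYp : Y p = V := by ext α k; simp [hY, frame, affField_self]
  have hinv := inv_eq_conjTranspose_mul_self hV
  have h2 : ContDiffAt ℝ 2 γ p := hγ.contDiffAt hp 2
  have h1 : ContDiffAt ℝ 1 γ p := hγ.contDiffAt hp 1
  have hu := (hγ.posDef p hp).isUnit
  have hwc : ContDiffAt ℝ 2 (weightSq φ K p) p := (contDiff_weightSq K p).contDiffAt
  have hw1 := hwc.differentiableAt (by norm_num)
  have hic := contDiffAt_inv h2 hu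
  have hi1 := hic.differentiableAt (by norm_num)
  have dY : DifferentiableAt ℝ Y p :=
    (contDiff_real_of_affine (k := 1) hYd).differentiable (by norm_num) p
  have dYs : DifferentiableAt ℝ (fun z => (Y z)ᴴ) p :=
    (contDiff_star_of_affine (k := 1) hYd).differentiable (by norm_num) p
  refine isBigO_of_fderiv_eq_zero ((hwc.smul hic).sub
    ((contDiff_star_of_affine hYd).contDiffAt.mul (contDiff_real_of_affine hYd).contDiffAt)) ?_ ?_
  · simp [weightSq_self, hYp, hinv]
  · ext1 v
    -- This equation dictates `twist`. At p, ∂_v(w γ⁻¹) = −K φ_v γ⁻¹ − γ⁻¹ γ_v γ⁻¹, while ∂_v(YᴴY) =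
    -- Vᴴ ∂_v Y with VᴴV = γ⁻¹.
    have e1 : wd v (fun z => weightSq φ K p z • (γ z)⁻¹ - (Y z)ᴴ * Y z) p = 0 := by
      rw [wd_sub (hw1.fun_smul hi1) (dYs.fun_mul dY), wd_smul hw1 hi1, wd_mul dYs dY,
        wd_affine hYd, wd_star_affine hYd, wd_weightSq, weightSq_self, wd_inv h1 hu,
        frameDeriv_twist, hYp, Matrix.mul_neg, ← Matrix.mul_assoc, ← hinv]
      simp only [mul_add, mul_smul_comm, mul_one, one_smul, neg_smul, zero_mul, zero_add,
        Matrix.mul_assoc]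
      abel
    have e2 : wdb v (fun z => weightSq φ K p z • (γ z)⁻¹ - (Y z)ᴴ * Y z) p = 0 := by
      rw [wdb_sub (hw1.fun_smul hi1) (dYs.fun_mul dY), wdb_smul hw1 hi1, wdb_mul dYs dY,
        wdb_affine hYd, wdb_star_affine hYd, wdb_weightSq, weightSq_self, wdb_inv h1 hu,
        conjTranspose_frameDeriv_twist hγ hp, hYp, Matrix.neg_mul, Matrix.mul_assoc _ Vᴴ V, ← hinv]
      simp only [add_mul, smul_mul_assoc, one_mul, one_smul, neg_smul, mul_zero, add_zero,
        Matrix.mul_assoc]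
      abel
    rw [_root_.zero_apply]
    exact (fderiv_eq_wd_add_wdb _ _ _).trans (by rw [e1, e2, add_zero])

end Touching

end

section

open Matrix

variable {n : ℕ}

/-! ### The C² majorant P and its Hessian at p. -/

section Comparison

variable {U : Set (Cn n)} {γ : Cn n → Matrix (Fin n) (Fin n) ℂ} {φ f : Cn n → ℝ}

/-- The function `|1 - K ∂φ(p)(z - p)|² (S e^{K(φ - φ(p))} - tr (γ⁻¹ H)) + tr (Yᴴ Y H)`. -/
noncomputable def comparison (γ : Cn n → Matrix (Fin n) (Fin n) ℂ) (φ : Cn n → ℝ) (K S : ℝ)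
    (H : Matrix (Fin n) (Fin n) ℂ) (p : Cn n) (Y : Cn n → Matrix (Fin n) (Fin n) ℂ) (z : Cn n) :
    ℂ :=
  weightSq φ K p z * (S * Complex.exp (K * (φ z - φ p)) - ((γ z)⁻¹ * H).trace)
    + ((Y z)ᴴ * Y z * H).trace

theorem contDiffAt_trace_mul {W : Type*} [NormedAddCommGroup W] [NormedSpace ℝ W]
    {k : WithTop ℕ∞} {X : W → Matrix (Fin n) (Fin n) ℂ} {z : W}
    (hX : ContDiffAt ℝ k X z) (H : Matrix (Fin n) (Fin n) ℂ) :
    ContDiffAt ℝ k (fun y => (X y * H).trace) z :=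
  (traceL (n := n)).restrictScalars ℝ |>.contDiff.contDiffAt.comp z (hX.mul contDiffAt_const)

/-- The linear map `X ↦ tr (X H)`. -/
noncomputable def traceMulL (H : Matrix (Fin n) (Fin n) ℂ) : Matrix (Fin n) (Fin n) ℂ →L[ℂ] ℂ :=
  traceL.comp ((ContinuousLinearMap.mul ℂ (Matrix (Fin n) (Fin n) ℂ)).flip H)

theorem traceMulL_apply (H X : Matrix (Fin n) (Fin n) ℂ) : traceMulL H X = (X * H).trace := rfl

theorem contDiffAt_expPart {p : Cn n} (hφ : ContDiffAt ℝ 2 φ p) (K S : ℝ) :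
    ContDiffAt ℝ 2 (fun z => (S : ℂ) * Complex.exp (K * (φ z - φ p))) p :=
  contDiffAt_const.mul (contDiffAt_cexp
    (contDiffAt_const.mul ((contDiffAt_ofReal hφ).sub contDiffAt_const)))

theorem wd_expPart {p : Cn n} (hφ : ContDiffAt ℝ 2 φ p) (K S : ℝ) (v : Cn n) :
    wd v (fun z => (S : ℂ) * Complex.exp (K * (φ z - φ p))) p
      = S * K * wd v (fun y => (φ y : ℂ)) p := by
  have h1 := contDiffAt_ofReal hφ
  have hg : ContDiffAt ℝ 2 (fun z => (K : ℂ) * (φ z - φ p)) p :=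
    contDiffAt_const.mul (h1.sub contDiffAt_const)
  have h2 : wd v (fun z => (K : ℂ) * (φ z - φ p)) p = K * wd v (fun y => (φ y : ℂ)) p := by
    rw [wd_mul (differentiableAt_const _) ((h1.sub contDiffAt_const).differentiableAt
      (by norm_num)), wd_sub (h1.differentiableAt (by norm_num)) (differentiableAt_const _),
      wd_const, wd_const]
    ring
  rw [wd_mul (differentiableAt_const _) ((contDiffAt_cexp hg).differentiableAt (by norm_num)),
    wd_exp (hg.differentiableAt (by norm_num)), h2, wd_const]
  simp
  ring

theorem wdb_expPart {p : Cn n} (hφ : ContDiffAt ℝ 2 φ p) (K S : ℝ) (v : Cn n) :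
    wdb v (fun z => (S : ℂ) * Complex.exp (K * (φ z - φ p))) p
      = S * K * wdb v (fun y => (φ y : ℂ)) p := by
  have h1 := contDiffAt_ofReal hφ
  have hg : ContDiffAt ℝ 2 (fun z => (K : ℂ) * (φ z - φ p)) p :=
    contDiffAt_const.mul (h1.sub contDiffAt_const)
  have h2 : wdb v (fun z => (K : ℂ) * (φ z - φ p)) p = K * wdb v (fun y => (φ y : ℂ)) p := by
    rw [wdb_mul (differentiableAt_const _) ((h1.sub contDiffAt_const).differentiableAt
      (by norm_num)), wdb_sub (h1.differentiableAt (by norm_num)) (differentiableAt_const _),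
      wdb_const, wdb_const]
    ring
  rw [wdb_mul (differentiableAt_const _) ((contDiffAt_cexp hg).differentiableAt (by norm_num)),
    wdb_exp (hg.differentiableAt (by norm_num)), h2, wdb_const]
  simp
  ring

theorem wd_wdb_expPart {p : Cn n} (hφ : ContDiffAt ℝ 2 φ p) (K S : ℝ) (v w : Cn n) :
    wd v (wdb w fun z => (S : ℂ) * Complex.exp (K * (φ z - φ p))) p
      = S * (K ^ 2 * (wd v (fun y => (φ y : ℂ)) p * wdb w (fun y => (φ y : ℂ)) p)
        + K * wd v (wdb w fun y => (φ y : ℂ)) p) := by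
  have h1 := contDiffAt_ofReal hφ
  have hs : ContDiffAt ℝ 2 (fun z => (φ z : ℂ) - φ p) p := h1.sub contDiffAt_const
  have hg : ContDiffAt ℝ 2 (fun z => (K : ℂ) * (φ z - φ p)) p := contDiffAt_const.mul hs
  have d1 := h1.differentiableAt (by norm_num)
  have ds := hs.differentiableAt (by norm_num)
  have c0 : ∀ c : ℂ, wdb w (fun _ : Cn n => c) = fun _ => 0 := fun c => by
    ext1 y; exact wdb_const _ _ _
  have e1 : wd v (fun z => (K : ℂ) * (φ z - φ p)) p = K * wd v (fun y => (φ y : ℂ)) p := by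
    rw [wd_mul (differentiableAt_const _) ds, wd_sub d1 (differentiableAt_const _), wd_const,
      wd_const]; ring
  have e2 : wdb w (fun z => (K : ℂ) * (φ z - φ p)) p = K * wdb w (fun y => (φ y : ℂ)) p := by
    rw [wdb_mul (differentiableAt_const _) ds, wdb_sub d1 (differentiableAt_const _), wdb_const,
      wdb_const]; ring
  have e3 : wd v (wdb w fun z => (K : ℂ) * (φ z - φ p)) p
      = K * wd v (wdb w fun y => (φ y : ℂ)) p := by
    rw [wd_wdb_mul contDiffAt_const hs]
    simp only [sub_eq_add_neg]
    rw [wd_wdb_add h1 contDiffAt_const]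
    simp only [c0, wd_const, wdb_const]
    ring
  rw [wd_wdb_mul contDiffAt_const (contDiffAt_cexp hg), wd_wdb_exp hg, e1, e2, e3]
  simp only [c0, wd_const, wdb_const, sub_self, mul_zero, Complex.exp_zero]
  ring

/-- Since w is |1 − Kℓ|² with ℓ the linear part ∂φ(p), the K² φ_v φ_w̄ contributions of w, of the
exponential and of the cross terms cancel, leaving S K φ_{v w̄}. In −w tr(γ⁻¹H) + tr(YᴴYH), the
derivative of Y produces one of the two quadratic terms of ∂∂̄(γ⁻¹) and cancels it; the remainder is
the curvature. -/
theorem wd_wdb_comparison (hγ : LocalKahler γ U) {p : Cn n} (hp : p ∈ U)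
    (hφ : ContDiffAt ℝ 2 φ p) (K S : ℝ) {V : Matrix (Fin n) (Fin n) ℂ}
    {H : Matrix (Fin n) (Fin n) ℂ} (hV : V * γ p * Vᴴ = 1) (hS : ((γ p)⁻¹ * H).trace = S)
    (v w : Cn n) :
    wd v (wdb w (comparison γ φ K S H p
      (frame (fun α => WithLp.toLp 2 (V α)) (twist γ φ K V p) p))) p =
      S * K * wd v (wdb w fun y => (φ y : ℂ)) p
        - ((γ p)⁻¹ * curvMat γ p v w * (γ p)⁻¹ * H).trace := by
  set Y := frame (fun α => WithLp.toLp 2 (V α)) (twist γ φ K V p) p with hY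
  have hYd := hasFDerivAt_frame (fun α => WithLp.toLp 2 (V α)) (twist γ φ K V p) p
  have hYp : Y p = V := by ext α k; simp [hY, frame, affField_self]
  have hinv := inv_eq_conjTranspose_mul_self hV
  have h2 : ContDiffAt ℝ 2 γ p := hγ.contDiffAt hp 2
  have h1 : ContDiffAt ℝ 1 γ p := hγ.contDiffAt hp 1
  have hu := (hγ.posDef p hp).isUnit
  have hwc : ContDiffAt ℝ 2 (weightSq φ K p) p := (contDiff_weightSq K p).contDiffAt
  have hic := contDiffAt_inv h2 hu
  have hi1 := hic.differentiableAt (by norm_num)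
  have hit : ContDiffAt ℝ 2 (fun z => traceMulL H ((γ z)⁻¹)) p := contDiffAt_clm_comp _ hic
  have hitd := hit.differentiableAt (by norm_num)
  have hex := contDiffAt_expPart hφ K S
  have hexd := hex.differentiableAt (by norm_num)
  have hk : ContDiffAt ℝ 2 (fun z => (S : ℂ) * Complex.exp (K * (φ z - φ p))
      + -traceMulL H ((γ z)⁻¹)) p := hex.add hit.neg
  have hYY : ContDiffAt ℝ 2 (fun z => (Y z)ᴴ * Y z) p :=
    (contDiff_star_of_affine hYd).contDiffAt.mul (contDiff_real_of_affine hYd).contDiffAt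
  have e : comparison γ φ K S H p Y = fun z => weightSq φ K p z *
      (S * Complex.exp (K * (φ z - φ p)) + -traceMulL H ((γ z)⁻¹))
        + traceMulL H ((Y z)ᴴ * Y z) := by
    ext1 z
    rw [comparison, traceMulL_apply, traceMulL_apply, sub_eq_add_neg]
  rw [e, wd_wdb_add (hwc.mul hk) (contDiffAt_clm_comp _ hYY), wd_wdb_mul hwc hk,
    wd_wdb_clm_comp _ hYY, wd_wdb_star_mul hYd, wd_wdb_add hex hit.neg, wd_wdb_neg,
    wd_wdb_clm_comp _ hic, wd_wdb_expPart hφ, wd_add hexd hitd.fun_neg, wdb_add hexd hitd.fun_neg,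
    wd_neg, wdb_neg, wd_clm_comp _ hi1, wdb_clm_comp _ hi1, wd_expPart hφ K S, wdb_expPart hφ K S,
    wd_wdb_inv h2 hu, wd_inv h1 hu, wdb_inv h1 hu, wd_weightSq, wdb_weightSq, weightSq_self,
    conjTranspose_frameDeriv_twist hγ hp, frameDeriv_twist]
  have e3 : ∀ A B : Matrix (Fin n) (Fin n) ℂ, -(A * Vᴴ) * -(V * B) = A * (γ p)⁻¹ * B := by
    intro A B
    rw [neg_mul_neg, hinv]
    simp only [Matrix.mul_assoc]
  rw [e3]
  simp only [curvMat, traceMulL_apply, add_mul, mul_add, sub_mul, mul_sub, trace_add, trace_sub,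
    smul_mul_assoc, mul_smul_comm, trace_smul, one_mul, mul_one, neg_mul, mul_neg, trace_neg,
    Matrix.mul_assoc, hS, smul_eq_mul]
  simp
  ring

theorem comparison_self {p : Cn n} (K S : ℝ)
    {V : Matrix (Fin n) (Fin n) ℂ}
    {H : Matrix (Fin n) (Fin n) ℂ} (hV : V * γ p * Vᴴ = 1) (hS : ((γ p)⁻¹ * H).trace = S) :
    comparison γ φ K S H p (frame (fun α => WithLp.toLp 2 (V α)) (twist γ φ K V p) p) p = S := by
  have hYp : frame (fun α => WithLp.toLp 2 (V α)) (twist γ φ K V p) p p = V := by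
    ext α k; simp [frame, affField_self]
  rw [comparison, hYp, ← inv_eq_conjTranspose_mul_self hV, hS]
  simp

theorem contDiffAt_comparison (hγ : LocalKahler γ U) {p : Cn n} (hp : p ∈ U)
    (hφ : ContDiffAt ℝ 2 φ p) (K S : ℝ) {V H : Matrix (Fin n) (Fin n) ℂ} :
    ContDiffAt ℝ 2 (comparison γ φ K S H p
      (frame (fun α => WithLp.toLp 2 (V α)) (twist γ φ K V p) p)) p := by
  have hYd := hasFDerivAt_frame (fun α => WithLp.toLp 2 (V α)) (twist γ φ K V p) p
  exact ((contDiff_weightSq K p).contDiffAt.mul ((contDiffAt_expPart hφ K S).sub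
    (contDiffAt_trace_mul (contDiffAt_inv (hγ.contDiffAt hp 2) (hγ.posDef p hp).isUnit) H))).add
    (contDiffAt_trace_mul ((contDiff_star_of_affine hYd).contDiffAt.mul
      (contDiff_real_of_affine hYd).contDiffAt) H)

theorem trace_mul_ofReal {A B : Matrix (Fin n) (Fin n) ℂ} (hA : A.IsHermitian)
    (hB : B.IsHermitian) : ((((A * B).trace).re : ℝ) : ℂ) = (A * B).trace := by
  refine Complex.conj_eq_iff_re.1 ?_
  have : star (A * B).trace = (A * B).trace := by
    rw [← trace_conjTranspose, conjTranspose_mul, hA.eq, hB.eq, trace_mul_comm]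
  exact this

theorem comparison_re (hγ : LocalKahler γ U) {p z : Cn n} (hz : z ∈ U) (K S : ℝ)
    {H : Matrix (Fin n) (Fin n) ℂ} (hH : H.IsHermitian) (Y : Cn n → Matrix (Fin n) (Fin n) ℂ) :
    comparison γ φ K S H p Y z = ((Complex.normSq (weight φ K p z) *
      (S * Real.exp (K * (φ z - φ p)) - (((γ z)⁻¹ * H).trace).re)
        + (((Y z)ᴴ * Y z * H).trace).re : ℝ) : ℂ) := by
  rw [comparison, weightSq_eq]
  push_cast
  rw [trace_mul_ofReal (hγ.posDef z hz).1.inv hH,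
    trace_mul_ofReal (isHermitian_conjTranspose_mul_self _) hH]

/-- With E = wγ⁻¹ − YᴴY one has tr(Yγ'Yᴴ) = w tr(γ⁻¹γ') − tr(Eγ'). Since E = O(|z − p|²), replacing
γ' by its value at p in the last term costs only o(|z − p|²), by continuity of γ'. The maximum
property bounds the first term. -/
theorem eventually_le_comparison (hγ : LocalKahler γ U) {p : Cn n} (hp : p ∈ U)
    (hφ : ContDiffAt ℝ 2 φ p) (K S : ℝ) {V : Matrix (Fin n) (Fin n) ℂ} (hV : V * γ p * Vᴴ = 1)
    (hmax : ∀ᶠ z in 𝓝 p, (((γ z)⁻¹ * (γ z + hess (fun y => (φ y : ℂ)) z)).trace).re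
      ≤ S * Real.exp (K * (φ z - φ p))) {δ : ℝ} (hδ : 0 < δ) :
    ∀ᶠ z in 𝓝 p, ((frame (fun α => WithLp.toLp 2 (V α)) (twist γ φ K V p) p z
      * (γ z + hess (fun y => (φ y : ℂ)) z)
      * (frame (fun α => WithLp.toLp 2 (V α)) (twist γ φ K V p) p z)ᴴ).trace).re ≤
      (comparison γ φ K S (γ p + hess (fun y => (φ y : ℂ)) p) p
        (frame (fun α => WithLp.toLp 2 (V α)) (twist γ φ K V p) p) z).re + δ * ‖z - p‖ ^ 2 := by
  set Y := frame (fun α => WithLp.toLp 2 (V α)) (twist γ φ K V p) p with hY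
  set g' : Cn n → Matrix (Fin n) (Fin n) ℂ := fun z => γ z + hess (fun y => (φ y : ℂ)) z with hg'
  have hH : (g' p).IsHermitian := (hγ.posDef p hp).1.add (hess_isHermitian hφ)
  obtain ⟨C, hC, hb⟩ := frame_error_bound (φ := φ) hγ hp K hV
  have hcont : ContinuousAt g' p :=
    (hγ.contDiffAt hp 2).continuousAt.add (continuousAt_hess (contDiffAt_ofReal hφ))
  have hsm : ∀ᶠ z in 𝓝 p, ‖traceL (n := n)‖ * C * ‖g' z - g' p‖ < δ := by
    have h1 : ContinuousAt (fun z => ‖traceL (n := n)‖ * C * ‖g' z - g' p‖) p :=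
      continuousAt_const.mul (hcont.sub continuousAt_const).norm
    refine h1.eventually_lt_const ?_
    simpa using hδ
  filter_upwards [hb, hsm, hmax, hγ.isOpen.mem_nhds hp] with z hz1 hz2 hz3 hz4
  rw [comparison_re hγ hz4 K S hH, Complex.ofReal_re]
  set E := weightSq φ K p z • (γ z)⁻¹ - (Y z)ᴴ * Y z with hE
  -- Split tr(E g'(z)) into tr(E g'(p)), which becomes part of the comparison function, and the
  -- error tr(E (g'(z) − g'(p))).
  have e1 : (Y z * g' z * (Y z)ᴴ).trace = weightSq φ K p z * ((γ z)⁻¹ * g' z).trace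
      - weightSq φ K p z * ((γ z)⁻¹ * g' p).trace + ((Y z)ᴴ * Y z * g' p).trace
      - (E * (g' z - g' p)).trace := by
    rw [Matrix.mul_assoc, trace_mul_comm (Y z), Matrix.mul_assoc, trace_mul_comm (g' z), hE]
    simp only [sub_mul, mul_sub, trace_sub, smul_mul_assoc, trace_smul, smul_eq_mul]
    ring
  have hn : ‖(E * (g' z - g' p)).trace‖ ≤ δ * ‖z - p‖ ^ 2 := by
    calc ‖(E * (g' z - g' p)).trace‖ = ‖traceL (E * (g' z - g' p))‖ := rfl
      _ ≤ ‖traceL (n := n)‖ * (‖E‖ * ‖g' z - g' p‖) :=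
        (ContinuousLinearMap.le_opNorm _ _).trans (by gcongr; exact norm_mul_le _ _)
      _ ≤ ‖traceL (n := n)‖ * ((C * ‖z - p‖ ^ 2) * ‖g' z - g' p‖) := by gcongr
      _ = ‖traceL (n := n)‖ * C * ‖g' z - g' p‖ * ‖z - p‖ ^ 2 := by ring
      _ ≤ _ := by gcongr
  have hre := (abs_le.1 ((Complex.abs_re_le_norm _).trans hn)).1
  have hw := Complex.normSq_nonneg (weight φ K p z)
  rw [e1, weightSq_eq]
  simp only [Complex.sub_re, Complex.add_re, Complex.re_ofReal_mul]
  nlinarith [mul_le_mul_of_nonneg_left hz3 hw]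

end Comparison

end

section

open Matrix

variable {n : ℕ}

/-! ### Traces in a simultaneously diagonal frame and the curvature sum. -/

section Diagonal

variable {V G H : Matrix (Fin n) (Fin n) ℂ} {lam : Fin n → ℝ}

theorem trace_diagonal_inv_mul (hlam : ∀ i, 0 < lam i)
    (h : V * H * Vᴴ = diagonal (fun i => (lam i : ℂ))) (N : Matrix (Fin n) (Fin n) ℂ) :
    (H⁻¹ * N).trace = ∑ l, ((lam l)⁻¹ : ℝ) * sesq N (V l) (V l) := by
  have h1 : diagonal (fun i => (((lam i)⁻¹ : ℝ) : ℂ)) * V * H * Vᴴ = 1 := by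
    rw [Matrix.mul_assoc, Matrix.mul_assoc, ← Matrix.mul_assoc V, h, diagonal_mul_diagonal,
      ← diagonal_one]
    congr 1
    ext i
    rw [← Complex.ofReal_mul, inv_mul_cancel₀ (hlam i).ne']
    simp
  have h2 : H⁻¹ = Vᴴ * (diagonal (fun i => (((lam i)⁻¹ : ℝ) : ℂ)) * V) := by
    refine inv_eq_left_inv ?_
    rw [Matrix.mul_assoc]
    exact mul_eq_one_comm.1 h1
  rw [h2, Matrix.mul_assoc, trace_mul_comm, Matrix.mul_assoc, Matrix.mul_assoc, trace]
  refine Finset.sum_congr rfl fun l _ => ?_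
  rw [diag_apply, diagonal_mul, ← Matrix.mul_assoc, mul_mul_conjTranspose_apply]

theorem trace_inv_mul_inv_mul (hG : V * G * Vᴴ = 1)
    (hH : V * H * Vᴴ = diagonal (fun i => (lam i : ℂ))) (R : Matrix (Fin n) (Fin n) ℂ) :
    (G⁻¹ * R * G⁻¹ * H).trace = ∑ k, lam k * sesq R (V k) (V k) := by
  have e : G⁻¹ * R * G⁻¹ * H = Vᴴ * ((V * R * Vᴴ) * (V * H)) := by
    rw [inv_eq_conjTranspose_mul_self hG]
    simp only [Matrix.mul_assoc]
  rw [e, trace_mul_comm, Matrix.mul_assoc, hH, trace]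
  refine Finset.sum_congr rfl fun k _ => ?_
  rw [diag_apply, mul_diagonal, mul_mul_conjTranspose_apply, mul_comm]

/-- Symmetrizing in k and l replaces the coefficient, which has no sign, by λ_k/λ_l + λ_l/λ_k − 2 =
(λ_k − λ_l)²/(λ_k λ_l) ≥ 0. Then b ≥ c can be inserted, and the −2 may be dropped because c ≤ 0. -/
theorem sum_div_sub_one_mul_ge {b : Fin n → Fin n → ℝ} {c : ℝ} (hlam : ∀ i, 0 < lam i)
    (hsymm : ∀ k l, b k l = b l k) (hc : c ≤ 0) (hb : ∀ k l, c ≤ b k l) :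
    c * ((∑ k, lam k) * ∑ l, (lam l)⁻¹) ≤ ∑ l, ∑ k, (lam k * (lam l)⁻¹ - 1) * b k l := by
  have e1 : (∑ k, lam k) * ∑ l, (lam l)⁻¹ = ∑ l, ∑ k, lam k * (lam l)⁻¹ := by
    rw [Finset.sum_mul_sum, Finset.sum_comm]
  have hs : ∀ F : Fin n → Fin n → ℝ, 2 * ∑ l, ∑ k, F k l = ∑ l, ∑ k, (F k l + F l k) := by
    intro F
    simp only [Finset.sum_add_distrib]
    rw [two_mul]
    congr 1
    exact Finset.sum_comm
  have key : 2 * (c * ∑ l, ∑ k, lam k * (lam l)⁻¹) ≤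
      2 * ∑ l, ∑ k, (lam k * (lam l)⁻¹ - 1) * b k l := by
    rw [mul_left_comm, hs, hs, Finset.mul_sum]
    refine Finset.sum_le_sum fun l _ => ?_
    rw [Finset.mul_sum]
    refine Finset.sum_le_sum fun k _ => ?_
    have hk := hlam k
    have hl := hlam l
    have h2 : 0 ≤ lam k * (lam l)⁻¹ + lam l * (lam k)⁻¹ - 2 := by
      have : lam k * (lam l)⁻¹ + lam l * (lam k)⁻¹ - 2 = (lam k - lam l) ^ 2 / (lam k * lam l) := by
        field_simp
        ring
      rw [this]
      positivity
    rw [hsymm l k]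
    nlinarith [mul_le_mul_of_nonneg_left (hb k l) h2]
  rw [e1]
  linarith

end Diagonal

/-! ### The differential inequality at a maximum point. -/

section Estimate

variable {U : Set (Cn n)} {γ : Cn n → Matrix (Fin n) (Fin n) ℂ} {φ f : Cn n → ℝ}

/-- The Kähler symmetry R(v, v̄, w, w̄) = R(w, w̄, v, v̄) in a unitary frame. Inserting γ⁻¹ = VᴴV
writes the quadratic term as a sum of products of first derivatives, to which closedness applies
factor by factor. -/
theorem LocalKahler.sesq_curvMat_symm (hγ : LocalKahler γ U) {p : Cn n} (hp : p ∈ U)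
    {V : Matrix (Fin n) (Fin n) ℂ} (hV : V * γ p * Vᴴ = 1) (k l : Fin n) :
    sesq (curvMat γ p (WithLp.toLp 2 (V l)) (WithLp.toLp 2 (V l))) (V k) (V k) =
      sesq (curvMat γ p (WithLp.toLp 2 (V k)) (WithLp.toLp 2 (V k))) (V l) (V l) := by
  have e : ∀ (v : Cn n) (k : Fin n), sesq (curvMat γ p v v) (V k) (V k) =
      ∑ m, sesq (wd v γ p) (V k) (V m) * sesq (wdb v γ p) (V m) (V k)
        - sesq (wd v (wdb v γ) p) (V k) (V k) := by
    intro v k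
    rw [← mul_mul_conjTranspose_apply, curvMat, Matrix.mul_sub, Matrix.sub_mul, Matrix.sub_apply,
      mul_mul_conjTranspose_apply (N := wd v (wdb v γ) p), inv_eq_conjTranspose_mul_self hV,
      show V * (wd v γ p * (Vᴴ * V) * wdb v γ p) * Vᴴ =
        (V * wd v γ p * Vᴴ) * (V * wdb v γ p * Vᴴ) by simp only [Matrix.mul_assoc], mul_apply]
    simp only [mul_mul_conjTranspose_apply]
  rw [e, e]
  congr 1
  · refine Finset.sum_congr rfl fun m _ => ?_
    exact congrArg₂ _ (hγ.sesq_wd hp (WithLp.toLp 2 (V l)) (WithLp.toLp 2 (V k))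
      (WithLp.toLp 2 (V m))) (hγ.sesq_wdb hp (WithLp.toLp 2 (V l)) (WithLp.toLp 2 (V m))
      (WithLp.toLp 2 (V k)))
  · exact hγ.sesq_wd_wdb hp (WithLp.toLp 2 (V l)) (WithLp.toLp 2 (V l)) (WithLp.toLp 2 (V k))
      (WithLp.toLp 2 (V k))

set_option maxHeartbeats 1000000 in
-- `viscosity_frame` with the comparison function as P. On the left, ∂∂̄ log det γ along the frame
-- gives minus the curvature sum, the −1 in λ_k/λ_l − 1. On the right, the trace against (γ')⁻¹ of
-- the curvature term of ∂∂̄P gives the weights λ_k/λ_l.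
theorem laplacian_le_of_max (hγ : LocalKahler γ U) (hφ : ∀ z ∈ U, ContDiffAt ℝ 2 φ z)
    (hpos : ∀ z ∈ U, (γ z + hess (fun y => (φ y : ℂ)) z).PosDef)
    (hMA : ∀ z ∈ U, (γ z + hess (fun y => (φ y : ℂ)) z).det = (Real.exp (f z) : ℂ) * (γ z).det)
    {p : Cn n} (hp : p ∈ U) (hf : ContDiffAt ℝ 2 f p) (K : ℝ)
    {V : Matrix (Fin n) (Fin n) ℂ} {lam : Fin n → ℝ} (hlam : ∀ i, 0 < lam i)
    (hV : V * γ p * Vᴴ = 1)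
    (hH : V * (γ p + hess (fun y => (φ y : ℂ)) p) * Vᴴ = diagonal (fun i => (lam i : ℂ)))
    (hmax : ∀ᶠ z in 𝓝 p, (((γ z)⁻¹ * (γ z + hess (fun y => (φ y : ℂ)) z)).trace).re
      ≤ (∑ i, lam i) * Real.exp (K * (φ z - φ p))) :
    (((γ p)⁻¹ * hess (fun y => (f y : ℂ)) p).trace).re ≤
      (∑ i, lam i) * K * (n - ∑ l, (lam l)⁻¹) - ∑ l, ∑ k, (lam k * (lam l)⁻¹ - 1) *
        (sesq (curvMat γ p (WithLp.toLp 2 (V l)) (WithLp.toLp 2 (V l))) (V k) (V k)).re := by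
  set S := ∑ i, lam i with hSdef
  have hφp := hφ p hp
  have hφc := contDiffAt_ofReal hφp
  set H := γ p + hess (fun y => (φ y : ℂ)) p with hHdef
  have hS : ((γ p)⁻¹ * H).trace = (S : ℂ) := by
    rw [trace_inv_mul hV, hSdef, Complex.ofReal_sum]
    refine Finset.sum_congr rfl fun k _ => ?_
    rw [← mul_mul_conjTranspose_apply, hH, diagonal_apply_eq]
  set Y := frame (fun α => WithLp.toLp 2 (V α)) (twist γ φ K V p) p with hY
  have hYp : Y p = V := by ext α k; simp [hY, frame, affField_self]
  set P : Cn n → ℝ := fun z => (comparison γ φ K S H p Y z).re with hP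
  have hPc : ContDiffAt ℝ 2 (comparison γ φ K S H p Y) p := contDiffAt_comparison hγ hp hφp K S
  have hPr : ContDiffAt ℝ 2 P p := Complex.reCLM.contDiff.contDiffAt.comp p hPc
  have hreal : (fun y => (P y : ℂ)) =ᶠ[𝓝 p] comparison γ φ K S H p Y := by
    filter_upwards [hγ.isOpen.mem_nhds hp] with z hz
    rw [hP]
    simp only
    rw [comparison_re hγ hz K S (hpos p hp).1, Complex.ofReal_re]
  -- The barrier N is |z − p|², matching the order of the error in `eventually_le_comparison`.
  have hNc : ContDiffAt ℝ 2 (fun z : Cn n => ‖z - p‖ ^ 2) p :=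
    (contDiff_id.sub contDiff_const).contDiffAt.norm_sq ℝ
  have key := viscosity_frame hγ hφ hpos hMA hp hf (fun α => WithLp.toLp 2 (V α))
    (twist γ φ K V p) hPr hNc (by simp)
    (fun z hz => by have := norm_pos_iff.2 (sub_ne_zero.2 hz); positivity)
    (by
      rw [← hY, hYp, hH, trace_diagonal, ← Complex.ofReal_sum, Complex.ofReal_re, hP]
      simp only
      rw [comparison_self K S hV hS, Complex.ofReal_re])
    (fun δ hδ => eventually_le_comparison hγ hp hφp K S hV hmax hδ)
  have hev : ∀ᶠ y in 𝓝 p, (γ y).PosDef := by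
    filter_upwards [hγ.isOpen.mem_nhds hp] with y hy using hγ.posDef y hy
  have hl : ContDiffAt ℝ 2 (fun y => logDet (γ y)) p := contDiffAt_logDet (hγ.contDiffAt hp 2) hev
  have lhs : ∀ α, wd (WithLp.toLp 2 (V α)) (wdb (WithLp.toLp 2 (V α))
      fun y => ((f y + logDetRe (γ y) : ℝ) : ℂ)) p = sesq (hess (fun y => (f y : ℂ)) p) (V α) (V α)
      - ∑ k, sesq (curvMat γ p (WithLp.toLp 2 (V α)) (WithLp.toLp 2 (V α))) (V k) (V k) := by
    intro α
    have e : (fun y => ((f y + logDetRe (γ y) : ℝ) : ℂ)) = fun y => (f y : ℂ) + logDet (γ y) := by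
      ext1 y; rw [Complex.ofReal_add, logDet_eq_logDetRe]
    rw [e, wd_wdb_add (contDiffAt_ofReal hf) hl, wd_wdb_logDet (hγ.contDiffAt hp 2) hev,
      ← trace_inv_mul hV]
    refine (congrArg₂ (· + ·) ?_ ?_).trans (sub_eq_add_neg _ _).symm
    · exact (sesq_hess (contDiffAt_ofReal hf) _ _).symm
    · rw [curvMat, Matrix.mul_sub, trace_sub, trace_sub, neg_sub]
      simp only [Matrix.mul_assoc]
  have rhs : ((H⁻¹ * hess (fun y => (P y : ℂ)) p).trace).re = ∑ l, (lam l)⁻¹ * (S * K * (lam l - 1)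
      - ∑ k, lam k *
        (sesq (curvMat γ p (WithLp.toLp 2 (V l)) (WithLp.toLp 2 (V l))) (V k) (V k)).re) := by
    rw [trace_diagonal_inv_mul hlam hH, Complex.re_sum]
    refine Finset.sum_congr rfl fun l _ => ?_
    rw [Complex.re_ofReal_mul]
    congr 1
    have e1 : sesq (hess (fun y => (P y : ℂ)) p) (V l) (V l) =
        wd (WithLp.toLp 2 (V l)) (wdb (WithLp.toLp 2 (V l)) (comparison γ φ K S H p Y)) p := by
      rw [hess_congr hreal]
      exact sesq_hess hPc (WithLp.toLp 2 (V l)) (WithLp.toLp 2 (V l))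
    have e2 : wd (WithLp.toLp 2 (V l)) (wdb (WithLp.toLp 2 (V l)) fun y => (φ y : ℂ)) p
        = ((lam l - 1 : ℝ) : ℂ) := by
      rw [← sesq_hess hφc]
      change sesq _ (V l) (V l) = _
      rw [← mul_mul_conjTranspose_apply, show hess (fun y => (φ y : ℂ)) p = H - γ p by
        rw [hHdef, add_sub_cancel_left], Matrix.mul_sub, Matrix.sub_mul, hH, hV, Matrix.sub_apply,
        diagonal_apply_eq, one_apply_eq]
      push_cast
      rfl
    rw [e1, wd_wdb_comparison hγ hp hφp K S hV hS, e2, trace_inv_mul_inv_mul hV hH, Complex.sub_re,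
      Complex.re_sum]
    simp only [Complex.re_ofReal_mul, ← Complex.ofReal_mul, Complex.ofReal_re]
  have lhs' : ∑ α, (wd (WithLp.toLp 2 (V α)) (wdb (WithLp.toLp 2 (V α))
      fun y => ((f y + logDetRe (γ y) : ℝ) : ℂ)) p).re =
      (((γ p)⁻¹ * hess (fun y => (f y : ℂ)) p).trace).re - ∑ l, ∑ k,
        (sesq (curvMat γ p (WithLp.toLp 2 (V l)) (WithLp.toLp 2 (V l))) (V k) (V k)).re := by
    simp only [lhs, Complex.sub_re, Complex.re_sum, Finset.sum_sub_distrib, trace_inv_mul hV]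
  rw [lhs', rhs] at key
  have e3 : ∀ l, (lam l)⁻¹ * (S * K * (lam l - 1) - ∑ k, lam k *
        (sesq (curvMat γ p (WithLp.toLp 2 (V l)) (WithLp.toLp 2 (V l))) (V k) (V k)).re) =
      S * K * (1 - (lam l)⁻¹) - ∑ k, lam k * (lam l)⁻¹ *
        (sesq (curvMat γ p (WithLp.toLp 2 (V l)) (WithLp.toLp 2 (V l))) (V k) (V k)).re := by
    intro l
    rw [mul_sub, Finset.mul_sum]
    congr 1
    · have := (hlam l).ne'
      field_simp
    · exact Finset.sum_congr rfl fun k _ => by ring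
  simp only [e3, Finset.sum_sub_distrib, ← Finset.mul_sum] at key
  simp only [sub_mul, Finset.sum_sub_distrib, one_mul]
  simp only [Finset.sum_const, Finset.card_univ, Fintype.card_fin, nsmul_eq_mul, mul_one] at key
  linarith

/-- At a local maximum of `tr (γ⁻¹ γ') e^{-Kφ}`, with `K = 1 - c`, where `c ≤ 0` is a lower bound
for the bisectional curvature. -/
theorem sum_mul_sum_inv_le_of_max (hγ : LocalKahler γ U) (hφ : ∀ z ∈ U, ContDiffAt ℝ 2 φ z)
    (hpos : ∀ z ∈ U, (γ z + hess (fun y => (φ y : ℂ)) z).PosDef)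
    (hMA : ∀ z ∈ U, (γ z + hess (fun y => (φ y : ℂ)) z).det = (Real.exp (f z) : ℂ) * (γ z).det)
    {p : Cn n} (hp : p ∈ U) (hf : ContDiffAt ℝ 2 f p) {c D : ℝ} (hc : c ≤ 0)
    (hcurv : ∀ v w : Cn n, (sesq (γ p) v v).re = 1 → (sesq (γ p) w w).re = 1 →
      c ≤ (sesq (curvMat γ p w w) v v).re)
    (hD : D ≤ (((γ p)⁻¹ * hess (fun y => (f y : ℂ)) p).trace).re)
    {V : Matrix (Fin n) (Fin n) ℂ} {lam : Fin n → ℝ} (hlam : ∀ i, 0 < lam i)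
    (hV : V * γ p * Vᴴ = 1)
    (hH : V * (γ p + hess (fun y => (φ y : ℂ)) p) * Vᴴ = diagonal (fun i => (lam i : ℂ)))
    (hmax : ∀ᶠ z in 𝓝 p, (((γ z)⁻¹ * (γ z + hess (fun y => (φ y : ℂ)) z)).trace).re
      ≤ (∑ i, lam i) * Real.exp ((1 - c) * (φ z - φ p))) :
    (∑ i, lam i) * ∑ i, (lam i)⁻¹ ≤ (1 - c) * n * (∑ i, lam i) - D := by
  have h1 := laplacian_le_of_max hγ hφ hpos hMA hp hf (1 - c) hlam hV hH hmax
  have hunit : ∀ k, (sesq (γ p) (V k) (V k)).re = 1 := fun k => by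
    rw [← mul_mul_conjTranspose_apply, hV, one_apply_eq, Complex.one_re]
  have h2 := sum_div_sub_one_mul_ge (lam := lam) (c := c) (b := fun k l =>
      (sesq (curvMat γ p (WithLp.toLp 2 (V l)) (WithLp.toLp 2 (V l))) (V k) (V k)).re) hlam
    (fun k l => congrArg Complex.re (hγ.sesq_curvMat_symm hp hV k l)) hc
    (fun k l => hcurv (WithLp.toLp 2 (V k)) (WithLp.toLp 2 (V l)) (hunit k) (hunit l))
  -- With K = 1 − c the coefficients K and c of S Σ 1/λ_i add up to 1.
  linarith

end Estimate

end

section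

open Matrix

variable {n : ℕ}

theorem natCast_le_infty (k : ℕ) : (k : WithTop ℕ∞) ≤ ∞ := by exact_mod_cast le_top

/-! ### From forms on M to local matrices: transition maps, curvature, norms. -/

section Charts

variable {M : Type*} [TopologicalSpace M] [ChartedSpace (Cn n) M]

theorem contDiffOn_transition [IsManifold 𝓘(ℂ, Cn n) ω M] {e e' : OpenPartialHomeomorph M (Cn n)}
    (he : e ∈ atlas (Cn n) M) (he' : e' ∈ atlas (Cn n) M) :
    ContDiffOn ℂ ω (fun w => e' (e.symm w)) (e.symm ≫ₕ e').source := by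
  have h := (contDiffGroupoid ω 𝓘(ℂ, Cn n)).compatible he he'
  rw [contDiffGroupoid, mem_groupoid_of_pregroupoid] at h
  have h1 := h.1
  simp only [contDiffPregroupoid, modelWithCornersSelf_coe, modelWithCornersSelf_coe_symm,
    Set.preimage_id, Set.range_id, Set.inter_univ, Function.comp_id, Function.id_comp] at h1
  exact h1

theorem contDiffAt_transition [IsManifold 𝓘(ℂ, Cn n) ω M] {e e' : OpenPartialHomeomorph M (Cn n)}
    (he : e ∈ atlas (Cn n) M) (he' : e' ∈ atlas (Cn n) M) {x : M} (hx : x ∈ e.source)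
    (hx' : x ∈ e'.source) {k : WithTop ℕ∞} : ContDiffAt ℂ k (fun w => e' (e.symm w)) (e x) := by
  refine ((contDiffOn_transition he he').contDiffAt
    ((e.symm ≫ₕ e').open_source.mem_nhds ?_)).of_le le_top
  simp [e.left_inv hx, hx, hx', e.map_source]

/-- Restriction of scalars: biholomorphic transition maps are real smooth, so the same atlas serves
for functions of real class C^k. -/
theorem isManifold_real [IsManifold 𝓘(ℂ, Cn n) ω M] : IsManifold 𝓘(ℝ, Cn n) ∞ M := by
  refine isManifold_of_contDiffOn _ _ _ fun e e' he he' => ?_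
  have h := ((contDiffOn_transition he he').restrict_scalars ℝ).of_le (m := ∞) le_top
  simpa only [modelWithCornersSelf_coe, modelWithCornersSelf_coe_symm,
    Set.preimage_id, Set.range_id, Set.inter_univ, Function.comp_id, Function.id_comp,
    OpenPartialHomeomorph.coe_trans, Function.comp_def, id_eq] using h

theorem contDiffAt_chart [IsManifold 𝓘(ℂ, Cn n) ω M] {k : WithTop ℕ∞} (hk : k ≤ ∞)
    {ψ : M → ℝ} (hψ : ContMDiff 𝓘(ℝ, Cn n) 𝓘(ℝ, ℝ) k ψ) {e : OpenPartialHomeomorph M (Cn n)}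
    (he : e ∈ atlas (Cn n) M) {z : Cn n} (hz : z ∈ e.target) :
    ContDiffAt ℝ k (fun w => ψ (e.symm w)) z := by
  have := isManifold_real (n := n) (M := M)
  have hM : IsManifold 𝓘(ℝ, Cn n) k M := IsManifold.of_le hk
  have h1 := hψ.comp_contMDiffOn (contMDiffOn_symm_of_mem_maximalAtlas
    (IsManifold.subset_maximalAtlas (I := 𝓘(ℝ, Cn n)) (n := k) he))
  exact (contMDiffOn_iff_contDiffOn.1 h1).contDiffAt (e.open_target.mem_nhds hz)

theorem ddc_eq_hess (ψ : M → ℝ) (e : OpenPartialHomeomorph M (Cn n)) :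
    ddc ψ e = hess fun w => ((ψ (e.symm w) : ℝ) : ℂ) := by
  ext z i j
  rw [hess_apply, ← dz_eq_wd, ← dzbar_eq_wdb]
  rfl

theorem ddc_transform [IsManifold 𝓘(ℂ, Cn n) ω M] {ψ : M → ℝ}
    (hψ : ContMDiff 𝓘(ℝ, Cn n) 𝓘(ℝ, ℝ) 2 ψ) {e e' : OpenPartialHomeomorph M (Cn n)}
    (he : e ∈ atlas (Cn n) M) (he' : e' ∈ atlas (Cn n) M) {x : M} (hx : x ∈ e.source)
    (hx' : x ∈ e'.source) :
    ddc ψ e (e x) = (jacobian e e' (e x))ᵀ * ddc ψ e' (e' x) * (jacobian e e' (e x))ᵀᴴ := by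
  rw [ddc_eq_hess, ddc_eq_hess]
  have hΦ : e' (e.symm (e x)) = e' x := by rw [e.left_inv hx]
  have hf : ContDiffAt ℝ 2 (fun w => ((ψ (e'.symm w) : ℝ) : ℂ)) (e' (e.symm (e x))) := by
    rw [hΦ]
    exact contDiffAt_ofReal (contDiffAt_chart (natCast_le_infty 2) hψ he'
      (e'.map_source hx'))
  have h := hess_comp_holomorphic (Φ := fun w => e' (e.symm w)) hf
    (contDiffAt_transition he he' hx hx')
  have hev : (fun w => ((ψ (e.symm w) : ℝ) : ℂ)) =ᶠ[𝓝 (e x)]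
      fun w => ((ψ (e'.symm (e' (e.symm w))) : ℝ) : ℂ) := by
    have hs : (e.symm ≫ₕ e').source ∈ 𝓝 (e x) := (e.symm ≫ₕ e').open_source.mem_nhds (by
      simp [e.left_inv hx, hx, hx', e.map_source])
    filter_upwards [hs] with w hw
    rw [e'.left_inv (by simpa using hw.2)]
  rw [hess_congr hev, h, hΦ]
  rfl

theorem IsKahler.transform_matrix {Ω : Form11 n M} (hΩ : IsKahler Ω)
    {e e' : OpenPartialHomeomorph M (Cn n)}
    (he : e ∈ atlas (Cn n) M) (he' : e' ∈ atlas (Cn n) M) {x : M} (hx : x ∈ e.source)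
    (hx' : x ∈ e'.source) :
    Ω e (e x) = (jacobian e e' (e x))ᵀ * Ω e' (e' x) * (jacobian e e' (e x))ᵀᴴ := by
  ext i j
  rw [hΩ.transform e he e' he' x ⟨hx, hx'⟩, mul_mul_conjTranspose_apply]
  rfl

theorem IsKahler.localKahler {Ω : Form11 n M} (hΩ : IsKahler Ω)
    {e : OpenPartialHomeomorph M (Cn n)} (he : e ∈ atlas (Cn n) M) :
    LocalKahler (Ω e) e.target := by
  have hs : ∀ z ∈ e.target, ContDiffAt ℝ ∞ (Ω e) z := fun z hz => contDiffAt_of_entries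
    fun i j => (hΩ.smooth e he i j).contDiffAt (e.open_target.mem_nhds hz)
  refine ⟨e.open_target, hs, hΩ.positive e he, fun z hz i j k => ?_⟩
  have hd : DifferentiableAt ℝ (Ω e) z := (hs z hz).differentiableAt (by simp)
  rw [← wd_entry hd, ← wd_entry hd, ← dz_eq_wd, ← dz_eq_wd]
  exact hΩ.closed e he z hz i j k

theorem isKahler_add_ddc [IsManifold 𝓘(ℂ, Cn n) ω M] {Ω₀ : Form11 n M} (hΩ₀ : IsKahler Ω₀)
    {ψ : M → ℝ} (hψ : ContMDiff 𝓘(ℝ, Cn n) 𝓘(ℝ, ℝ) ∞ ψ)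
    (hpos : IsPositive (Ω₀ + ddc ψ : Form11 n M)) : IsKahler (Ω₀ + ddc ψ : Form11 n M) where
  transform := by
    intro e he e' he' x hx i j
    have h1 := hΩ₀.transform_matrix he he' hx.1 hx.2
    have h2 := ddc_transform (hψ.of_le (natCast_le_infty 2)) he he' hx.1 hx.2
    have h3 : (Ω₀ + ddc ψ : Form11 n M) e (e x) = (jacobian e e' (e x))ᵀ *
        (Ω₀ + ddc ψ : Form11 n M) e' (e' x) * (jacobian e e' (e x))ᵀᴴ := by
      change Ω₀ e (e x) + ddc ψ e (e x) = _ * (Ω₀ e' (e' x) + ddc ψ e' (e' x)) * _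
      rw [h1, h2, Matrix.mul_add, Matrix.add_mul]
    rw [h3, mul_mul_conjTranspose_apply]
    rfl
  smooth := by
    intro e he i j z hz
    have h1 : ContDiffAt ℝ ∞ (fun w => ((ψ (e.symm w) : ℝ) : ℂ)) z :=
      contDiffAt_ofReal (contDiffAt_chart le_rfl hψ he hz)
    have h2 : ContDiffAt ℝ ∞ (fun w => ddc ψ e w i j) z := by
      rw [ddc_eq_hess]
      exact contDiffAt_wd (contDiffAt_wdb (m := ∞) h1 (by simp) _) (by simp) _
    exact (hΩ₀.smooth e he i j z hz).add h2.contDiffWithinAt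
  positive := hpos
  closed := by
    intro e he z hz i j k
    have h1 : ContDiffAt ℝ 3 (fun w => ((ψ (e.symm w) : ℝ) : ℂ)) z :=
      (contDiffAt_ofReal (contDiffAt_chart le_rfl hψ he hz)).of_le (natCast_le_infty 3)
    have h0 : ∀ i j, DifferentiableAt ℝ (fun w => Ω₀ e w i j) z := fun i j =>
      ((hΩ₀.smooth e he i j).contDiffAt (e.open_target.mem_nhds hz)).differentiableAt (by simp)
    have h2 : ContDiffAt ℝ 2 (wdb (stdVec j) fun w => ((ψ (e.symm w) : ℝ) : ℂ)) z :=
      contDiffAt_wdb h1 (by norm_num) _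
    have h3 : ∀ i, DifferentiableAt ℝ (fun w => ddc ψ e w i j) z := fun i => by
      rw [ddc_eq_hess]
      exact differentiableAt_wd h2 _
    have h4 : ∀ k i, dz k (fun w => (Ω₀ + ddc ψ : Form11 n M) e w i j) z =
        dz k (fun w => Ω₀ e w i j) z + wd (stdVec k) (wd (stdVec i)
          (wdb (stdVec j) fun w => ((ψ (e.symm w) : ℝ) : ℂ))) z := fun k i => by
      rw [dz_eq_wd, dz_eq_wd]
      refine (wd_add (h0 i j) (h3 i) _).trans ?_
      rw [ddc_eq_hess]
      rfl
    rw [h4, h4, hΩ₀.closed e he z hz, wd_wd_comm h2]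

theorem curvature_eq {Ω : Form11 n M} (hΩ : IsKahler Ω)
    {e : OpenPartialHomeomorph M (Cn n)} (he : e ∈ atlas (Cn n) M) {z : Cn n} (hz : z ∈ e.target)
    (i j k l : Fin n) :
    curvature Ω e z i j k l = curvMat (Ω e) z (stdVec k) (stdVec l) i j := by
  have h := (hΩ.localKahler he).contDiffAt hz 2
  have hd := h.differentiableAt (by norm_num)
  rw [curvature, curvMat, Matrix.sub_apply, Matrix.mul_apply]
  simp only [Matrix.mul_apply, Finset.sum_mul]
  rw [neg_add_eq_sub]
  simp only [dz_eq_wd, dzbar_eq_wdb]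
  rw [wd_wdb_entry h]
  congr 1
  refine Finset.sum_congr rfl fun p _ => Finset.sum_congr rfl fun q _ => ?_
  rw [wd_entry hd, wdb_entry hd]
  ring

theorem curvMat_eq_sum {γ : Cn n → Matrix (Fin n) (Fin n) ℂ} {z : Cn n}
    (h : ContDiffAt ℝ 2 γ z) (v w : Cn n) :
    curvMat γ z v w = ∑ k, ∑ l, (v k * conj (w l)) • curvMat γ z (stdVec k) (stdVec l) := by
  rw [curvMat, wd_wdb_eq_sum h, wd_eq_sum v, wdb_eq_sum w, Finset.sum_mul, Finset.sum_mul,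
    ← Finset.sum_sub_distrib]
  refine Finset.sum_congr rfl fun k _ => ?_
  rw [Finset.mul_sum, ← Finset.sum_sub_distrib]
  refine Finset.sum_congr rfl fun l _ => ?_
  rw [curvMat, smul_sub, smul_mul_assoc, smul_mul_smul_comm]

theorem bisectional_eq {Ω : Form11 n M} (hΩ : IsKahler Ω)
    {e : OpenPartialHomeomorph M (Cn n)} (he : e ∈ atlas (Cn n) M) {z : Cn n} (hz : z ∈ e.target)
    (v w : Cn n) : bisectional Ω e z v w = (sesq (curvMat (Ω e) z w w) v v).re := by
  rw [bisectional, curvMat_eq_sum ((hΩ.localKahler he).contDiffAt hz 2), sesq]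
  congr 1
  refine Finset.sum_congr rfl fun i _ => Finset.sum_congr rfl fun j _ => ?_
  simp only [Matrix.sum_apply, Finset.sum_mul]
  refine Finset.sum_congr rfl fun k _ => Finset.sum_congr rfl fun l _ => ?_
  rw [curvature_eq hΩ he hz, Matrix.smul_apply, smul_eq_mul]
  ring

theorem laplacian_eq (Ω : Form11 n M) (ψ : M → ℝ) (e : OpenPartialHomeomorph M (Cn n))
    (z : Cn n) : laplacian Ω ψ e z = (((Ω e z)⁻¹ * ddc ψ e z).trace).re := by
  rw [laplacian, trace, Finset.sum_comm]
  simp only [diag_apply, mul_apply]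

theorem formNorm_eq (Ω Θ : Form11 n M) (e : OpenPartialHomeomorph M (Cn n)) (z : Cn n) :
    formNorm Ω Θ e z = Real.sqrt (((Ω e z)⁻¹ * Θ e z * (Ω e z)⁻¹ * Θ e z).trace).re := by
  rw [formNorm]
  congr 2
  have : ((Ω e z)⁻¹ * Θ e z * (Ω e z)⁻¹ * Θ e z).trace =
      ∑ l, ∑ p, ∑ q, ∑ k, (Ω e z)⁻¹ l k * Θ e z k q * (Ω e z)⁻¹ q p * Θ e z p l := by
    simp only [trace, diag_apply, mul_apply, Finset.sum_mul]
  rw [this, Finset.sum_comm]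
  refine Finset.sum_congr rfl fun l _ => ?_
  rw [Finset.sum_comm]
  refine Finset.sum_congr rfl fun p _ => ?_
  rw [Finset.sum_comm]
  refine Finset.sum_congr rfl fun q _ => Finset.sum_congr rfl fun k _ => ?_
  ring

end Charts

end

section

open Matrix

variable {n : ℕ}

/-! ### Smoothness of |s|_h² and of the regularized powers. -/

section LineBundle

variable {M : Type*} [TopologicalSpace M] [ChartedSpace (Cn n) M]

theorem ContMDiffAt.to_real {c : M → ℂ} {x : M}
    (hc : ContMDiffAt 𝓘(ℂ, Cn n) 𝓘(ℂ, ℂ) ω c x) : ContMDiffAt 𝓘(ℝ, Cn n) 𝓘(ℝ, ℂ) ∞ c x := by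
  rw [contMDiffAt_iff] at hc ⊢
  exact ⟨hc.1, (hc.2.restrict_scalars ℝ).of_le le_top⟩

variable {L : M → Type*} [TopologicalSpace (Bundle.TotalSpace ℂ L)]
  [∀ x, AddCommGroup (L x)] [∀ x, Module ℂ (L x)] [∀ x, TopologicalSpace (L x)]
  [FiberBundle ℂ L] [VectorBundle ℂ ℂ L] (h : HermitianLineMetric n L) (s : ∀ x, L x)

theorem HermitianLineMetric.normSq_nonneg (x : M) (v : L x) : 0 ≤ h.normSq x v := by
  by_cases hv : v = 0
  · have := h.normSq_smul x 0 v
    rw [zero_smul, norm_zero, ← hv] at this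
    rw [this]; simp
  · exact (h.normSq_pos x v hv).le

theorem HermitianLineMetric.normSq_eq {t : Bundle.Trivialization ℂ
    (Bundle.TotalSpace.proj : Bundle.TotalSpace ℂ L → M)} [MemTrivializationAtlas t] {x : M}
    (hx : x ∈ t.baseSet) :
    h.normSq x (s x) = ‖(t ⟨x, s x⟩).2‖ ^ 2 * h.normSq x (t.symm x 1) := by
  rw [← h.normSq_smul]
  congr 1
  have h1 : t.symm x (t ⟨x, s x⟩).2 = s x := t.symm_proj_apply ⟨x, s x⟩ hx
  have h2 := (t.symmₗ ℂ x).map_smul (t ⟨x, s x⟩).2 1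
  rw [smul_eq_mul, mul_one, t.coe_symmₗ] at h2
  · rw [← h2, h1]
  · exact hx

/-- In a trivialization |s|_h² is |coefficient of s|² times the square length of the frame; the
first factor is smooth since the coefficient is holomorphic, the second by assumption on h. -/
theorem HermitianLineMetric.contMDiff_normSq [IsManifold 𝓘(ℂ, Cn n) ω M]
    [ContMDiffVectorBundle ω ℂ L 𝓘(ℂ, Cn n)]
    (hs : ContMDiff 𝓘(ℂ, Cn n) (𝓘(ℂ, Cn n).prod 𝓘(ℂ, ℂ)) ω
      (fun x => Bundle.TotalSpace.mk' ℂ x (s x))) :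
    ContMDiff 𝓘(ℝ, Cn n) 𝓘(ℝ, ℝ) ∞ fun x => h.normSq x (s x) := by
  intro x
  set t := trivializationAt ℂ L x
  have hx : x ∈ t.baseSet := FiberBundle.mem_baseSet_trivializationAt' x
  have hc := ContMDiffAt.to_real ((Bundle.contMDiffAt_section x).1 (hs x))
  have h1 : ContMDiffAt 𝓘(ℝ, Cn n) 𝓘(ℝ, ℝ) ∞ (fun y => ‖(t ⟨y, s y⟩).2‖ ^ 2) x :=
    (contDiff_norm_sq ℝ (n := ∞) (E := ℂ)).contMDiff.contMDiffAt.comp x hc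
  have h2 := (h.smooth t).contMDiffAt (t.open_baseSet.mem_nhds hx)
  refine (h1.mul h2).congr_of_eventuallyEq ?_
  filter_upwards [t.open_baseSet.mem_nhds hx] with y hy
  exact h.normSq_eq s hy

theorem contMDiff_rpow_sub_rpow {σ : M → ℝ} (hσ : ContMDiff 𝓘(ℝ, Cn n) 𝓘(ℝ, ℝ) ∞ σ)
    (h0 : ∀ x, 0 ≤ σ x) (τ τ' : ℝ) {ε : ℝ} (hε : 0 < ε) :
    ContMDiff 𝓘(ℝ, Cn n) 𝓘(ℝ, ℝ) ∞ fun x => (σ x + ε) ^ τ - (σ x + ε) ^ τ' := by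
  intro x
  have hne : σ x + ε ≠ 0 := (add_pos_of_nonneg_of_pos (h0 x) hε).ne'
  have h1 : ContDiffAt ℝ ∞ (fun u : ℝ => (u + ε) ^ τ - (u + ε) ^ τ') (σ x) :=
    ((contDiffAt_id.add contDiffAt_const).rpow_const_of_ne hne).sub
      ((contDiffAt_id.add contDiffAt_const).rpow_const_of_ne hne)
  exact h1.contMDiffAt.comp x (hσ x)

end LineBundle

/-! ### Positivity is closed up to semidefiniteness, and open. -/

section Positive

theorem re_sesq_nonneg {N : Matrix (Fin n) (Fin n) ℂ} (hN : N.PosSemidef) (v : Fin n → ℂ) :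
    0 ≤ (sesq N v v).re := by
  have h1 := hN.dotProduct_mulVec_nonneg (star v)
  rw [← sesq_star_star, star_star] at h1
  exact (Complex.nonneg_iff.1 h1).1

theorem posSemidef_of_frequently {X : Type*} [TopologicalSpace X]
    {F : X → Matrix (Fin n) (Fin n) ℂ} {x : X} (hF : ContinuousAt F x) (hx : (F x).IsHermitian)
    (h : ∃ᶠ y in 𝓝 x, (F y).PosSemidef) : (F x).PosSemidef := by
  refine posSemidef_of_sesq hx fun v => ?_
  have hc : ContinuousAt (fun y => (sesq (F y) v v).re) x := by
    refine Complex.continuous_re.continuousAt.comp ?_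
    refine tendsto_finsetSum _ fun i _ => tendsto_finsetSum _ fun j _ => ?_
    exact (((entryL i j).continuous.continuousAt.comp hF).mul continuousAt_const).mul
      continuousAt_const
  refine ge_of_tendsto_of_frequently hc (h.mono fun y hy => ?_)
  exact re_sesq_nonneg hy v

theorem eventually_posDef {X : Type*} [TopologicalSpace X]
    {F : X → Matrix (Fin n) (Fin n) ℂ} {x : X} (hF : ContinuousAt F x) (hx : (F x).PosDef)
    (h : ∀ᶠ y in 𝓝 x, (F y).IsHermitian) : ∀ᶠ y in 𝓝 x, (F y).PosDef := by
  obtain ⟨W, hW⟩ := exists_mul_mul_conjTranspose_eq_one hx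
  have hWu := isUnit_of_mul_mul_conjTranspose_eq_one hW
  have hc : ContinuousAt (fun y => ‖W * F y * Wᴴ - 1‖) x :=
    (((continuousAt_const.mul hF).mul continuousAt_const).sub continuousAt_const).norm
  have hlt : ∀ᶠ y in 𝓝 x, ‖W * F y * Wᴴ - 1‖ < 1 := by
    refine hc.eventually_lt_const ?_
    simp only [hW]
    simp
  filter_upwards [hlt, h] with y hy hyH
  have hH : (W * F y * Wᴴ).IsHermitian := isHermitian_mul_mul_conjTranspose _ hyH
  have hpd : (W * F y * Wᴴ).PosDef := by
    refine hH.posDef_iff_eigenvalues_pos.2 fun i => ?_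
    -- An eigenvalue μ of W F Wᴴ gives the eigenvalue μ − 1 of a matrix of operator norm below 1, so
    -- μ > 0.
    have h1 : (EuclideanSpace.equiv (Fin n) ℂ).symm ((W * F y * Wᴴ - 1) *ᵥ ⇑(hH.eigenvectorBasis i))
        = ((hH.eigenvalues i - 1 : ℝ) : ℂ) • hH.eigenvectorBasis i := by
      rw [Matrix.sub_mulVec, hH.mulVec_eigenvectorBasis, Matrix.one_mulVec]
      ext k
      simp [sub_mul]
    have h2 := Matrix.l2_opNorm_mulVec (W * F y * Wᴴ - 1) (hH.eigenvectorBasis i)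
    rw [h1, norm_smul, hH.eigenvectorBasis.norm_eq_one, mul_one, mul_one, Complex.norm_real] at h2
    replace h2 := h2.trans_lt hy
    rw [Real.norm_eq_abs] at h2
    linarith [(abs_lt.1 h2).1]
  exact (IsUnit.posDef_star_right_conjugate_iff hWu).1 (by rwa [star_eq_conjTranspose])

end Positive

end

section

open Matrix

variable {n : ℕ}

theorem trace_inv_mul_congr {J : Matrix (Fin n) (Fin n) ℂ} (hJ : IsUnit J)
    (G N : Matrix (Fin n) (Fin n) ℂ) :
    ((J * G * Jᴴ)⁻¹ * (J * N * Jᴴ)).trace = (G⁻¹ * N).trace := by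
  have h1 : J⁻¹ * J = 1 := nonsing_inv_mul _ ((isUnit_iff_isUnit_det _).1 hJ)
  have h2 : Jᴴ * Jᴴ⁻¹ = 1 := by
    rw [← conjTranspose_nonsing_inv, ← conjTranspose_mul, h1, conjTranspose_one]
  rw [Matrix.mul_inv_rev, Matrix.mul_inv_rev, show Jᴴ⁻¹ * (G⁻¹ * J⁻¹) * (J * N * Jᴴ) =
    Jᴴ⁻¹ * (G⁻¹ * (J⁻¹ * J) * N * Jᴴ) by simp only [Matrix.mul_assoc], h1, trace_mul_comm,
    Matrix.mul_one, Matrix.mul_assoc, h2, Matrix.mul_one]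

/-! ### Chart independence, positivity of Ω + dd^c φ, and relative eigenvalues. -/

section Global

variable {M : Type*} [TopologicalSpace M] [ChartedSpace (Cn n) M] [IsManifold 𝓘(ℂ, Cn n) ω M]
  {Ω : Form11 n M} {φ f : M → ℝ}

/-- In the transformation law of Ω the left side has nonzero determinant, hence so does each factor
on the right. -/
theorem IsKahler.isUnit_jacobian (hΩ : IsKahler Ω) {e e' : OpenPartialHomeomorph M (Cn n)}
    (he : e ∈ atlas (Cn n) M) (he' : e' ∈ atlas (Cn n) M) {x : M} (hx : x ∈ e.source)
    (hx' : x ∈ e'.source) : IsUnit (jacobian e e' (e x))ᵀ := by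
  have h := (hΩ.positive e he _ (e.map_source hx)).isUnit
  rw [hΩ.transform_matrix he he' hx hx', isUnit_iff_isUnit_det, det_mul, det_mul] at h
  exact (isUnit_iff_isUnit_det _).2 (isUnit_of_mul_isUnit_left (isUnit_of_mul_isUnit_left h))

theorem IsKahler.add_ddc_transform (hΩ : IsKahler Ω) (hφ : ContMDiff 𝓘(ℝ, Cn n) 𝓘(ℝ, ℝ) 2 φ)
    {e e' : OpenPartialHomeomorph M (Cn n)} (he : e ∈ atlas (Cn n) M) (he' : e' ∈ atlas (Cn n) M)
    {x : M} (hx : x ∈ e.source) (hx' : x ∈ e'.source) :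
    Ω e (e x) + ddc φ e (e x) = (jacobian e e' (e x))ᵀ * (Ω e' (e' x) + ddc φ e' (e' x))
      * (jacobian e e' (e x))ᵀᴴ := by
  rw [Matrix.mul_add, Matrix.add_mul, ← ddc_transform hφ he he' hx hx',
    ← hΩ.transform_matrix he he' hx hx']

theorem IsKahler.posDef_add_ddc_iff (hΩ : IsKahler Ω) (hφ : ContMDiff 𝓘(ℝ, Cn n) 𝓘(ℝ, ℝ) 2 φ)
    {e e' : OpenPartialHomeomorph M (Cn n)} (he : e ∈ atlas (Cn n) M) (he' : e' ∈ atlas (Cn n) M)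
    {x : M} (hx : x ∈ e.source) (hx' : x ∈ e'.source) :
    (Ω e (e x) + ddc φ e (e x)).PosDef ↔ (Ω e' (e' x) + ddc φ e' (e' x)).PosDef := by
  rw [hΩ.add_ddc_transform hφ he he' hx hx', ← star_eq_conjTranspose]
  exact IsUnit.posDef_star_right_conjugate_iff (hΩ.isUnit_jacobian he he' hx hx')

theorem contDiffAt_chart_ofReal {k : WithTop ℕ∞} (hk : k ≤ ∞)
    {ψ : M → ℝ} (hψ : ContMDiff 𝓘(ℝ, Cn n) 𝓘(ℝ, ℝ) k ψ) {e : OpenPartialHomeomorph M (Cn n)}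
    (he : e ∈ atlas (Cn n) M) {z : Cn n} (hz : z ∈ e.target) :
    ContDiffAt ℝ k (fun w => ((ψ (e.symm w) : ℝ) : ℂ)) z :=
  contDiffAt_ofReal (contDiffAt_chart hk hψ he hz)

theorem IsKahler.continuousAt_add_ddc (hΩ : IsKahler Ω)
    (hφ : ContMDiff 𝓘(ℝ, Cn n) 𝓘(ℝ, ℝ) 2 φ) {e : OpenPartialHomeomorph M (Cn n)}
    (he : e ∈ atlas (Cn n) M) {z : Cn n} (hz : z ∈ e.target) :
    ContinuousAt (fun w => Ω e w + ddc φ e w) z := by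
  rw [ddc_eq_hess]
  exact ((hΩ.localKahler he).contDiffAt hz 0).continuousAt.add
    (continuousAt_hess (contDiffAt_chart_ofReal (natCast_le_infty 2) hφ he hz))

theorem IsKahler.isHermitian_add_ddc (hΩ : IsKahler Ω)
    (hφ : ContMDiff 𝓘(ℝ, Cn n) 𝓘(ℝ, ℝ) 2 φ) {e : OpenPartialHomeomorph M (Cn n)}
    (he : e ∈ atlas (Cn n) M) {z : Cn n} (hz : z ∈ e.target) :
    (Ω e z + ddc φ e z).IsHermitian := by
  rw [ddc_eq_hess]
  exact (hΩ.positive e he z hz).1.add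
    (hess_isHermitian (contDiffAt_chart (natCast_le_infty 2) hφ he hz))

theorem re_sesq_ddc_nonpos_of_isLocalMax {ψ : M → ℝ}
    (hψ : ContMDiff 𝓘(ℝ, Cn n) 𝓘(ℝ, ℝ) 2 ψ) {x : M} (hmax : IsLocalMax ψ x)
    {e : OpenPartialHomeomorph M (Cn n)} (he : e ∈ atlas (Cn n) M) (hx : x ∈ e.source)
    (v : Cn n) : (sesq (ddc ψ e (e x)) v v).re ≤ 0 := by
  have hz := e.map_source hx
  rw [ddc_eq_hess, sesq_hess (contDiffAt_chart_ofReal (natCast_le_infty 2) hψ he hz)]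
  refine re_wd_wdb_nonpos_of_isLocalMax (contDiffAt_chart (natCast_le_infty 2) hψ he hz) ?_ v
  have h1 : Tendsto e.symm (𝓝 (e x)) (𝓝 x) := by
    have := e.symm.continuousAt (x := e x) hz
    rwa [ContinuousAt, e.left_inv hx] at this
  filter_upwards [h1.eventually hmax] with w hw
  rwa [e.left_inv hx]

/-- A solution of the Monge-Ampère equation on a compact manifold is a Kähler potential: the set
where the form is not positive is open and compact, so it is empty by the minimum principle. -/
theorem IsKahler.isPositive_add_ddc [CompactSpace M] (hΩ : IsKahler Ω)
    (hφ : ContMDiff 𝓘(ℝ, Cn n) 𝓘(ℝ, ℝ) 2 φ) (hMA : SolvesMongeAmpere Ω f φ) :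
    IsPositive (Ω + ddc φ : Form11 n M) := by
  set c : M → OpenPartialHomeomorph M (Cn n) := fun x => chartAt (Cn n) x
  have hc : ∀ x, c x ∈ atlas (Cn n) M := chart_mem_atlas (Cn n)
  have hcx : ∀ x, x ∈ (c x).source := mem_chart_source (Cn n)
  set B : Set M := {x | ¬ (Ω (c x) (c x x) + ddc φ (c x) (c x x)).PosDef} with hB
  have mem_iff : ∀ {x e}, e ∈ atlas (Cn n) M → x ∈ e.source →
      (x ∈ B ↔ ¬ (Ω e (e x) + ddc φ e (e x)).PosDef) := fun {x e} he hx =>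
    not_congr (hΩ.posDef_add_ddc_iff hφ (hc x) he (hcx x) hx)
  have hclosed : IsClosed B := by
    rw [← isOpen_compl_iff, isOpen_iff_mem_nhds]
    intro x hx
    have hz := (c x).map_source (hcx x)
    have hx' : (Ω (c x) (c x x) + ddc φ (c x) (c x x)).PosDef := not_not.1 hx
    have h1 := eventually_posDef (hΩ.continuousAt_add_ddc hφ (hc x) hz) hx'
      (by filter_upwards [(c x).open_target.mem_nhds hz] with w hw
            using hΩ.isHermitian_add_ddc hφ (hc x) hw)
    filter_upwards [((c x).continuousAt (hcx x)).eventually h1,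
      (c x).open_source.mem_nhds (hcx x)] with y hy hys
    rw [Set.mem_compl_iff, mem_iff (hc x) hys, not_not]
    exact hy
  have hempty : B = ∅ := by
    by_contra hne
    -- φ is minimized over the bad set B only. This becomes a local minimum on M once x is known to
    -- be interior to B.
    obtain ⟨x, hxB, hmin⟩ := hclosed.isCompact.exists_isMinOn (Set.nonempty_iff_ne_empty.2 hne)
      hφ.continuous.continuousOn
    have hz := (c x).map_source (hcx x)
    have hnear : ∀ᶠ y in 𝓝 x, y ∈ B := by
      by_contra hcon
      have hfreq : ∃ᶠ y in 𝓝 x, y ∉ B := not_eventually.1 hcon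
      refine hxB ?_
      have hF : ContinuousAt (fun y => Ω (c x) (c x y) + ddc φ (c x) (c x y)) x :=
        (hΩ.continuousAt_add_ddc hφ (hc x) hz).comp ((c x).continuousAt (hcx x))
      have hps := posSemidef_of_frequently hF (hΩ.isHermitian_add_ddc hφ (hc x) hz)
        ((hfreq.and_eventually ((c x).open_source.mem_nhds (hcx x))).mono fun y hy => by
          have := hy.1
          rw [mem_iff (hc x) hy.2, not_not] at this
          exact this.posSemidef)
      -- If x were a limit of good points, the form at x would be positive semidefinite; the
      -- equation makes its determinant nonzero, hence the form definite.
      refine hps.posDef_iff_det_ne_zero.2 ?_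
      rw [show (Ω (c x) (c x x) + ddc φ (c x) (c x x)).det = _ from hMA _ (hc x) _ hz]
      exact mul_ne_zero (Complex.ofReal_ne_zero.2 (Real.exp_pos _).ne')
        (hΩ.positive _ (hc x) _ hz).det_pos.ne'
    have hmax : IsLocalMax (fun y => - φ y) x := by
      filter_upwards [hnear] with y hy
      exact neg_le_neg (hmin hy)
    have hnegC : ContMDiff 𝓘(ℝ, Cn n) 𝓘(ℝ, ℝ) 2 (fun y => - φ y) := hφ.neg
    have hneg : ddc (fun y => - φ y) (c x) (c x x) = - ddc φ (c x) (c x x) := by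
      rw [ddc_eq_hess, ddc_eq_hess]
      ext i j
      simp only [Complex.ofReal_neg]
      exact wd_wdb_neg _ _ _ _
    -- At an interior point of B the minimum is local, so dd^c φ ≥ 0 and Ω + dd^c φ is positive,
    -- against x ∈ B.
    have hpsd : (ddc φ (c x) (c x x)).PosSemidef := by
      have hH : (ddc φ (c x) (c x x)).IsHermitian := by
        rw [ddc_eq_hess]
        exact hess_isHermitian (contDiffAt_chart (natCast_le_infty 2) hφ (hc x) hz)
      refine posSemidef_of_sesq hH fun v => ?_
      have := re_sesq_ddc_nonpos_of_isLocalMax hnegC hmax (hc x) (hcx x) (WithLp.toLp 2 v)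
      rw [hneg, sesq_neg, Complex.neg_re] at this
      exact neg_nonpos.1 this
    exact hxB ((hΩ.positive _ (hc x) _ hz).add_posSemidef hpsd)
  intro e he z hz
  have hs := e.map_target hz
  have : e.symm z ∉ B := by rw [hempty]; exact Set.notMem_empty _
  rw [mem_iff he hs, not_not, e.right_inv hz] at this
  exact this

/-- The trace of `Ω + dd^c φ` with respect to `Ω`. -/
noncomputable def relTrace (Ω : Form11 n M) (φ : M → ℝ) (x : M) : ℝ :=
  (((Ω (chartAt (Cn n) x) (chartAt (Cn n) x x))⁻¹ * (Ω (chartAt (Cn n) x) (chartAt (Cn n) x x)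
    + ddc φ (chartAt (Cn n) x) (chartAt (Cn n) x x))).trace).re

theorem IsKahler.relTrace_eq (hΩ : IsKahler Ω) (hφ : ContMDiff 𝓘(ℝ, Cn n) 𝓘(ℝ, ℝ) 2 φ)
    {e : OpenPartialHomeomorph M (Cn n)} (he : e ∈ atlas (Cn n) M) {x : M} (hx : x ∈ e.source) :
    relTrace Ω φ x = (((Ω e (e x))⁻¹ * (Ω e (e x) + ddc φ e (e x))).trace).re := by
  have h1 := chart_mem_atlas (Cn n) x
  have h2 := mem_chart_source (Cn n) x
  rw [relTrace, hΩ.add_ddc_transform hφ h1 he h2 hx, hΩ.transform_matrix h1 he h2 hx,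
    trace_inv_mul_congr (hΩ.isUnit_jacobian h1 he h2 hx)]

theorem IsKahler.continuous_relTrace (hΩ : IsKahler Ω)
    (hφ : ContMDiff 𝓘(ℝ, Cn n) 𝓘(ℝ, ℝ) 2 φ) : Continuous (relTrace Ω φ) := by
  rw [continuous_iff_continuousAt]
  intro x
  set e := chartAt (Cn n) x
  have he : e ∈ atlas (Cn n) M := chart_mem_atlas (Cn n) x
  have hx : x ∈ e.source := mem_chart_source (Cn n) x
  have hz := e.map_source hx
  have h1 : ContinuousAt (fun w => (Ω e w)⁻¹) (e x) :=
    (contDiffAt_inv ((hΩ.localKahler he).contDiffAt hz 0) (hΩ.positive e he _ hz).isUnit).continuousAt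
  have h2 : ContinuousAt (fun w => (((Ω e w)⁻¹ * (Ω e w + ddc φ e w)).trace).re) (e x) :=
    Complex.continuous_re.continuousAt.comp ((traceL (n := n)).continuous.continuousAt.comp
      (h1.mul (hΩ.continuousAt_add_ddc hφ he hz)))
  refine (ContinuousAt.comp h2 (e.continuousAt hx)).congr ?_
  filter_upwards [e.open_source.mem_nhds hx] with y hy
  exact (hΩ.relTrace_eq hφ he hy).symm

/-- Simultaneous diagonalization of `Ω` and `Ω + dd^c φ`. -/
theorem IsKahler.exists_diagonal (hΩ : IsKahler Ω)
    (hφ : ContMDiff 𝓘(ℝ, Cn n) 𝓘(ℝ, ℝ) 2 φ) (hMA : SolvesMongeAmpere Ω f φ)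
    (hpos : IsPositive (Ω + ddc φ : Form11 n M))
    {e : OpenPartialHomeomorph M (Cn n)} (he : e ∈ atlas (Cn n) M) {x : M} (hx : x ∈ e.source) :
    ∃ (V : Matrix (Fin n) (Fin n) ℂ) (lam : Fin n → ℝ), (∀ i, 0 < lam i) ∧
      V * Ω e (e x) * Vᴴ = 1 ∧
      V * (Ω e (e x) + ddc φ e (e x)) * Vᴴ = diagonal (fun i => (lam i : ℂ)) ∧
      relTrace Ω φ x = ∑ i, lam i ∧ ∏ i, lam i = Real.exp (f x) := by
  have hz := e.map_source hx
  obtain ⟨V, lam, hlam, hV, hH⟩ := exists_simultaneous_diagonalization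
    (hΩ.positive e he _ hz)
    (show (Ω e (e x) + ddc φ e (e x)).PosDef from hpos e he _ hz)
  refine ⟨V, lam, hlam, hV, hH, ?_, ?_⟩
  · rw [hΩ.relTrace_eq hφ he hx, trace_inv_mul hV, Complex.re_sum]
    refine Finset.sum_congr rfl fun k _ => ?_
    rw [← mul_mul_conjTranspose_apply, hH, diagonal_apply_eq, Complex.ofReal_re]
  · have h1 := det_ratio hV hH
    rw [show (Ω e (e x) + ddc φ e (e x)).det = _ from hMA e he _ hz, e.left_inv hx] at h1
    have h2 := mul_right_cancel₀ (hΩ.positive e he _ hz).det_pos.ne' h1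
    exact_mod_cast h2.symm

theorem IsKahler.trace_inv_mul_ddc (hΩ : IsKahler Ω)
    {e : OpenPartialHomeomorph M (Cn n)} (he : e ∈ atlas (Cn n) M) {z : Cn n} (hz : z ∈ e.target) :
    (((Ω e z)⁻¹ * (Ω e z + ddc φ e z)).trace).re = n + laplacian Ω φ e z := by
  rw [laplacian_eq, Matrix.mul_add, nonsing_inv_mul _
    ((isUnit_iff_isUnit_det _).1 (hΩ.positive e he z hz).isUnit), trace_add, Complex.add_re]
  simp

end Global

end

/-! ### The a priori bounds. -/

section

open Matrix

variable {n : ℕ}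

/-- Either the sum is at most 1, or dividing by it bounds Σ 1/λ_i by Kn − D. Upper bounds for all
inverses and for the product bound each λ_k. -/
theorem sum_le_of_sum_mul_sum_inv_le {lam : Fin n → ℝ} (hlam : ∀ i, 0 < lam i) {K D E : ℝ}
    (hD : D ≤ 0) (hK : 0 ≤ K) (hE : ∏ i, lam i ≤ E)
    (h : (∑ i, lam i) * ∑ i, (lam i)⁻¹ ≤ K * n * (∑ i, lam i) - D) :
    ∑ i, lam i ≤ 1 + n * (E * (K * n - D) ^ (n - 1)) := by
  have hprod : 0 < ∏ i, lam i := Finset.prod_pos fun i _ => hlam i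
  have hE0 : 0 ≤ E := hprod.le.trans hE
  have hQ : 0 ≤ K * n - D := by nlinarith [mul_nonneg hK (Nat.cast_nonneg (α := ℝ) n)]
  rcases le_total (∑ i, lam i) 1 with h1 | h1
  · have : 0 ≤ n * (E * (K * n - D) ^ (n - 1)) := by positivity
    linarith
  · have hT : ∑ i, (lam i)⁻¹ ≤ K * n - D := by
      have h2 : (∑ i, lam i) * ∑ i, (lam i)⁻¹ ≤ (∑ i, lam i) * (K * n - D) := by nlinarith
      exact le_of_mul_le_mul_left h2 (by linarith)
    have hk : ∀ k, lam k ≤ E * (K * n - D) ^ (n - 1) := by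
      intro k
      -- The n − 1 remaining factors explain the exponent. For n = 0 there is no index k, and the
      -- factor n in the bound vanishes.
      have e1 : lam k = (∏ i, lam i) * ∏ i ∈ Finset.univ.erase k, (lam i)⁻¹ := by
        rw [← Finset.mul_prod_erase _ _ (Finset.mem_univ k), mul_assoc, ← Finset.prod_mul_distrib,
          Finset.prod_congr rfl fun i _ => mul_inv_cancel₀ (hlam i).ne', Finset.prod_const_one,
          mul_one]
      have e2 : ∏ i ∈ Finset.univ.erase k, (lam i)⁻¹ ≤ (K * n - D) ^ (n - 1) := by
        have h3 : ∏ i ∈ Finset.univ.erase k, (lam i)⁻¹ ≤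
            ∏ _i ∈ Finset.univ.erase k, (K * n - D) :=
          Finset.prod_le_prod (fun i _ => (inv_pos.2 (hlam i)).le) fun i _ =>
            (Finset.single_le_sum (f := fun i => (lam i)⁻¹) (fun i _ => (inv_pos.2 (hlam i)).le)
              (Finset.mem_univ i)).trans hT
        rwa [Finset.prod_const, Finset.card_erase_of_mem (Finset.mem_univ k), Finset.card_univ,
          Fintype.card_fin] at h3
      calc lam k = _ := e1
        _ ≤ E * (K * n - D) ^ (n - 1) := mul_le_mul hE e2
          (Finset.prod_nonneg fun i _ => (inv_pos.2 (hlam i)).le) hE0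
    have := Finset.sum_le_sum fun k (_ : k ∈ (Finset.univ : Finset (Fin n))) => hk k
    rw [Finset.sum_const, Finset.card_univ, Fintype.card_fin, nsmul_eq_mul] at this
    linarith

section Global

variable {M : Type*} [TopologicalSpace M] [ChartedSpace (Cn n) M] [IsManifold 𝓘(ℂ, Cn n) ω M]
  {Ω : Form11 n M} {φ f : M → ℝ}

theorem ddc_add {ψ ψ' : M → ℝ} (hψ : ContMDiff 𝓘(ℝ, Cn n) 𝓘(ℝ, ℝ) 2 ψ)
    (hψ' : ContMDiff 𝓘(ℝ, Cn n) 𝓘(ℝ, ℝ) 2 ψ') {e : OpenPartialHomeomorph M (Cn n)}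
    (he : e ∈ atlas (Cn n) M) {z : Cn n} (hz : z ∈ e.target) :
    ddc (fun x => ψ x + ψ' x) e z = ddc ψ e z + ddc ψ' e z := by
  simp only [ddc_eq_hess]
  rw [← hess_add (contDiffAt_chart_ofReal (natCast_le_infty 2) hψ he hz)
    (contDiffAt_chart_ofReal (natCast_le_infty 2) hψ' he hz)]
  simp only [Complex.ofReal_add]

variable [CompactSpace M]

/-- At a maximum of f + φ one has Δφ ≤ −Δf ≤ −D, so the sum n + Δφ of the λ_i is at most n − D, and
so is each λ_i. Hence e^f = ∏ λ_i ≤ (n − D)^n there, and moving to x changes f by at most 2A. -/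
theorem IsKahler.exp_le (hΩ : IsKahler Ω) (hf : ContMDiff 𝓘(ℝ, Cn n) 𝓘(ℝ, ℝ) 2 f)
    (hφ : ContMDiff 𝓘(ℝ, Cn n) 𝓘(ℝ, ℝ) 2 φ) (hMA : SolvesMongeAmpere Ω f φ) {A D : ℝ}
    (hA : ∀ x, |φ x| ≤ A) (hD : ∀ e ∈ atlas (Cn n) M, ∀ z ∈ e.target, D ≤ laplacian Ω f e z)
    (x : M) : Real.exp (f x) ≤ (n - D) ^ n * Real.exp (2 * A) := by
  have hfφ : ContMDiff 𝓘(ℝ, Cn n) 𝓘(ℝ, ℝ) 2 (fun x => f x + φ x) := hf.add hφ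
  obtain ⟨y, -, hy⟩ := isCompact_univ.exists_isMaxOn ⟨x, Set.mem_univ x⟩ hfφ.continuous.continuousOn
  set e := chartAt (Cn n) y
  have he : e ∈ atlas (Cn n) M := chart_mem_atlas (Cn n) y
  have hye : y ∈ e.source := mem_chart_source (Cn n) y
  have hz := e.map_source hye
  have hmax : IsLocalMax (fun x => f x + φ x) y := Eventually.of_forall fun w => hy (Set.mem_univ w)
  have h1 := re_trace_inv_mul_nonpos (hΩ.positive e he _ hz) fun v =>
    re_sesq_ddc_nonpos_of_isLocalMax hfφ hmax he hye (WithLp.toLp 2 v)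
  rw [ddc_add hf hφ he hz, Matrix.mul_add, trace_add, Complex.add_re, ← laplacian_eq,
    ← laplacian_eq] at h1
  have h2 := hD e he _ hz
  obtain ⟨V, lam, hlam, -, -, hS, hprod⟩ :=
    hΩ.exists_diagonal hφ hMA (hΩ.isPositive_add_ddc hφ hMA) he hye
  rw [hΩ.relTrace_eq hφ he hye, hΩ.trace_inv_mul_ddc he hz] at hS
  have h3 : ∏ i, lam i ≤ (n - D) ^ n := by
    have h4 : ∏ i, lam i ≤ ∏ _i : Fin n, ((n : ℝ) - D) :=
      Finset.prod_le_prod (fun i _ => (hlam i).le) fun i _ => by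
        have := Finset.single_le_sum (f := lam) (fun i _ => (hlam i).le) (Finset.mem_univ i)
        linarith
    rwa [Finset.prod_const, Finset.card_univ, Fintype.card_fin] at h4
  have h5 : f x ≤ f y + 2 * A := by
    have h6 : f x + φ x ≤ f y + φ y := hy (Set.mem_univ x)
    linarith [(abs_le.1 (hA x)).1, (abs_le.1 (hA y)).2]
  calc Real.exp (f x) ≤ Real.exp (f y + 2 * A) := Real.exp_le_exp.2 h5
    _ = Real.exp (f y) * Real.exp (2 * A) := Real.exp_add _ _
    _ ≤ _ := by gcongr; rwa [← hprod]

/-- The maximum principle for S e^{−(1−c)φ} on compact M: the local inequality at the maximum point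
bounds S there, and the oscillation of φ, at most 2A, gives the last exponential factor. -/
theorem IsKahler.relTrace_le (hΩ : IsKahler Ω) (hf : ContMDiff 𝓘(ℝ, Cn n) 𝓘(ℝ, ℝ) 2 f)
    (hφ : ContMDiff 𝓘(ℝ, Cn n) 𝓘(ℝ, ℝ) 2 φ) (hMA : SolvesMongeAmpere Ω f φ) {A c D : ℝ}
    (hA : ∀ x, |φ x| ≤ A) (hc : c ≤ 0) (hcurv : BisectionalBoundedBelow Ω c) (hD0 : D ≤ 0)
    (hD : ∀ e ∈ atlas (Cn n) M, ∀ z ∈ e.target, D ≤ laplacian Ω f e z) (x : M) :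
    relTrace Ω φ x ≤ (1 + n * ((n - D) ^ n * Real.exp (2 * A) * ((1 - c) * n - D) ^ (n - 1)))
      * Real.exp ((1 - c) * (2 * A)) := by
  have hpos := hΩ.isPositive_add_ddc hφ hMA
  have hcont : Continuous fun x => relTrace Ω φ x * Real.exp (-((1 - c) * φ x)) :=
    (hΩ.continuous_relTrace hφ).mul
      (Real.continuous_exp.comp (continuous_const.mul hφ.continuous).neg)
  obtain ⟨y, -, hy⟩ := isCompact_univ.exists_isMaxOn ⟨x, Set.mem_univ x⟩ hcont.continuousOn
  -- The maximum property in the form used both by the comparison function near y and for the final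
  -- transfer to x.
  have hy' : ∀ w, relTrace Ω φ w ≤ relTrace Ω φ y * Real.exp ((1 - c) * (φ w - φ y)) := by
    intro w
    have h1 : relTrace Ω φ w * Real.exp (-((1 - c) * φ w)) ≤
      relTrace Ω φ y * Real.exp (-((1 - c) * φ y)) := hy (Set.mem_univ w)
    have h2 := mul_le_mul_of_nonneg_right h1 (Real.exp_pos ((1 - c) * φ w)).le
    rw [mul_assoc, ← Real.exp_add, mul_assoc, ← Real.exp_add, neg_add_cancel, Real.exp_zero,
      mul_one] at h2
    rwa [show (1 - c) * (φ w - φ y) = -((1 - c) * φ y) + (1 - c) * φ w by ring]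
  set e := chartAt (Cn n) y
  have he : e ∈ atlas (Cn n) M := chart_mem_atlas (Cn n) y
  have hye : y ∈ e.source := mem_chart_source (Cn n) y
  have hz := e.map_source hye
  obtain ⟨V, lam, hlam, hV, hH, hS, hprod⟩ := hΩ.exists_diagonal hφ hMA hpos he hye
  have hloc := hΩ.localKahler he
  have hfp := contDiffAt_chart (natCast_le_infty 2) hf he hz
  have key := sum_mul_sum_inv_le_of_max (φ := fun w => φ (e.symm w)) (f := fun w => f (e.symm w))
    (D := D) hloc (fun z hz => contDiffAt_chart (natCast_le_infty 2) hφ he hz)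
    (fun z hz => by
      rw [← ddc_eq_hess]
      exact hpos e he z hz)
    (fun z hz => by
      rw [← ddc_eq_hess]
      exact hMA e he z hz) hz hfp hc
    (fun v w hv hw => by
      rw [← bisectional_eq hΩ he hz]
      exact hcurv e he _ hz v w hv hw)
    (by
      rw [← ddc_eq_hess, ← laplacian_eq]
      exact hD e he _ hz) hlam hV (by rw [← ddc_eq_hess]; exact hH)
    (by
      filter_upwards [e.open_target.mem_nhds hz] with w hw
      have h1 := hy' (e.symm w)
      rw [hΩ.relTrace_eq hφ he (e.map_target hw), e.right_inv hw, hS] at h1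
      rw [← ddc_eq_hess, e.left_inv hye]
      exact h1)
  have hb := sum_le_of_sum_mul_sum_inv_le hlam hD0 (by linarith)
    (hprod.le.trans (hΩ.exp_le hf hφ hMA hA hD y)) key
  rw [← hS] at hb
  have hSy : 0 ≤ relTrace Ω φ y := by rw [hS]; exact Finset.sum_nonneg fun i _ => (hlam i).le
  refine (hy' x).trans (mul_le_mul hb ?_ (Real.exp_pos _).le (hSy.trans hb))
  refine Real.exp_le_exp.2 (mul_le_mul_of_nonneg_left ?_ (by linarith))
  linarith [(abs_le.1 (hA x)).2, (abs_le.1 (hA y)).1]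

/-- In the diagonal frame dd^c φ has eigenvalues λ_i − 1. As λ_i > 0, Σ (λ_i − 1)² ≤ Σ λ_i² + n ≤ S²
+ n. -/
theorem IsKahler.formNorm_ddc_le (hΩ : IsKahler Ω)
    (hφ : ContMDiff 𝓘(ℝ, Cn n) 𝓘(ℝ, ℝ) 2 φ) (hMA : SolvesMongeAmpere Ω f φ) {C : ℝ}
    (hC : ∀ x, relTrace Ω φ x ≤ C) {e : OpenPartialHomeomorph M (Cn n)}
    (he : e ∈ atlas (Cn n) M) {z : Cn n} (hz : z ∈ e.target) :
    formNorm Ω (ddc φ) e z ≤ Real.sqrt (C ^ 2 + n) := by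
  have hx := e.map_target hz
  obtain ⟨V, lam, hlam, hV, hH, hS, -⟩ :=
    hΩ.exists_diagonal hφ hMA (hΩ.isPositive_add_ddc hφ hMA) he hx
  rw [e.right_inv hz] at hV hH
  rw [formNorm_eq]
  refine Real.sqrt_le_sqrt ?_
  have hΘ : V * ddc φ e z * Vᴴ = diagonal (fun i => ((lam i - 1 : ℝ) : ℂ)) := by
    rw [← add_sub_cancel_left (Ω e z) (ddc φ e z), Matrix.mul_sub, Matrix.sub_mul, hH, hV,
      ← diagonal_one, diagonal_sub]
    congr 1
    ext i
    push_cast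
    rfl
  have e1 : ((Ω e z)⁻¹ * ddc φ e z * (Ω e z)⁻¹ * ddc φ e z).trace =
      ((∑ i, (lam i - 1) ^ 2 : ℝ) : ℂ) := by
    rw [trace_inv_mul_inv_mul hV hΘ, Complex.ofReal_sum]
    refine Finset.sum_congr rfl fun k _ => ?_
    rw [← mul_mul_conjTranspose_apply, hΘ, diagonal_apply_eq, ← Complex.ofReal_mul, sq]
  rw [e1, Complex.ofReal_re]
  have hS0 : 0 ≤ ∑ i, lam i := Finset.sum_nonneg fun i _ => (hlam i).le
  calc ∑ i, (lam i - 1) ^ 2 ≤ ∑ i, (lam i ^ 2 + 1) := Finset.sum_le_sum fun i _ => by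
        nlinarith [hlam i]
    _ = ∑ i, lam i ^ 2 + n := by simp [Finset.sum_add_distrib]
    _ ≤ (∑ i, lam i) ^ 2 + n := by
        gcongr
        exact Finset.sum_sq_le_sq_sum_of_nonneg fun i _ => (hlam i).le
    _ ≤ C ^ 2 + n := by
        gcongr
        rw [← hS]
        exact hC _

end Global

end

end ComplexMA

theorem theorem5p1 (n : ℕ) (A κ B D : ℝ) :
    ∃ C : ℝ,
      ∀ (M : Type u) [TopologicalSpace M] [T2Space M] [CompactSpace M]
        [ChartedSpace (Cn n) M] [IsManifold 𝓘(ℂ, Cn n) ω M]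
        (L : M → Type v) [TopologicalSpace (Bundle.TotalSpace ℂ L)]
        [∀ x, AddCommGroup (L x)] [∀ x, Module ℂ (L x)] [∀ x, TopologicalSpace (L x)]
        [FiberBundle ℂ L] [VectorBundle ℂ ℂ L] [ContMDiffVectorBundle ω ℂ L 𝓘(ℂ, Cn n)]
        (h : HermitianLineMetric n L) (s : ∀ x, L x)
        (Ω₀ : Form11 n M) (τ τ' ε : ℝ) (f φ : M → ℝ),
        -- the holomorphic section `s` and the smooth Kähler form `Ω₀`
        ContMDiff 𝓘(ℂ, Cn n) (𝓘(ℂ, Cn n).prod 𝓘(ℂ, ℂ)) ω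
            (fun x => Bundle.TotalSpace.mk' ℂ x (s x)) →
        IsKahler Ω₀ →
        0 < τ → τ < τ' → τ' < 1 → 0 < ε →
        ∀ Ω : Form11 n M, Ω = approxForm Ω₀ (fun x => h.normSq x (s x)) τ τ' ε →
        IsPositive Ω →
        -- the right-hand side, and a `C³` solution of the equation
        ContMDiff 𝓘(ℝ, Cn n) 𝓘(ℝ, ℝ) ∞ f →
        ContMDiff 𝓘(ℝ, Cn n) 𝓘(ℝ, ℝ) 3 φ →
        SolvesMongeAmpere Ω f φ →
        -- the quantities on which the constant `C` may depend
        (∀ x, |φ x| ≤ A) →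
        BisectionalBoundedBelow Ω κ →
        (∀ x, B ≤ f x) →
        (∀ e ∈ atlas (Cn n) M, ∀ z ∈ e.target, D ≤ min (laplacian Ω f e z) 0) →
        -- the estimate
        ∀ e ∈ atlas (Cn n) M, ∀ z ∈ e.target, formNorm Ω (ddc φ) e z ≤ C := by
  -- The bound of `IsKahler.relTrace_le` with c = min κ 0, inserted into that of
  -- `IsKahler.formNorm_ddc_le`. Replacing κ by min κ 0 supplies the sign needed for the curvature
  -- sum.
  refine ⟨Real.sqrt (((1 + n * ((n - D) ^ n * Real.exp (2 * A)
    * ((1 - min κ 0) * n - D) ^ (n - 1))) * Real.exp ((1 - min κ 0) * (2 * A))) ^ 2 + n), ?_⟩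
  intro M _ _ _ _ _ L _ _ _ _ _ _ _ h s Ω₀ τ τ' ε f φ hs hΩ₀ _ _ _ hε Ω hΩeq hpos hf hφ3 hMA hA hcurv
    _ hD e he z hz
  -- Since ε > 0 the bases |s|² + ε stay positive and the real powers are smooth, so Ω is again a
  -- smooth Kähler form.
  have hψ := contMDiff_rpow_sub_rpow (h.contMDiff_normSq s hs) (fun x => h.normSq_nonneg x (s x))
    τ τ' hε
  have hΩ : IsKahler Ω := by
    rw [hΩeq, approxForm] at hpos ⊢
    exact isKahler_add_ddc hΩ₀ hψ hpos
  have hφ := hφ3.of_le (show (2 : WithTop ℕ∞) ≤ 3 by norm_num)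
  -- The sign D ≤ 0 is read off from the lower bound on the negative part at the given point z.
  refine hΩ.formNorm_ddc_le hφ hMA (fun x => hΩ.relTrace_le (hf.of_le (natCast_le_infty 2)) hφ hMA hA
    (min_le_right _ _) ?_ ((hD e he z hz).trans (min_le_right _ _))
    (fun e he z hz => (hD e he z hz).trans (min_le_left _ _)) x) he hz
  exact fun e he z hz v w hv hw => (min_le_left _ _).trans (hcurv e he z hz v w hv hw)
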